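/- Let $(V,\omega)$ be a symplectic manifold of dimension $2d$, let $J$ be an $\omega$-compatible almost complex structure, and let $\nabla$ denote the gradient for the Riemannian metric $\omega(\cdot,J\cdot)$. Let $h:V\times\mathbb R\to\mathbb R$ be a smooth time-dependent Hamiltonian with flow $\varphi_t$, where Hamiltonian vector fields are defined by $\omega(X_H,\cdot)=-dH$, and let $f:V\to\mathbb R$ be a smooth first integral of $h$, i.e. a function that is constant along the orbits of $X_h^t$. Let $Z=f^{-1}(c)$ be a regular level of $f$, and suppose that $X_f$ generates a free circle action on $Z$. Let $\pi:Z\to W:=Z/S^1$ be the quotient projection onto the Marsden–Weinstein reduced symplectic manifold, let $g:W\times\mathbb R\to\mathbb R$ be the Hamiltonian with $g(\pi(z),t)=h(z,t)$ for $z\in Z$, and let $\psi_t$ be its flow. For a closed orbit $\gamma:[0,T]\to M$, $T>0$, of a Hamiltonian flow $\varphi_t$ on a symplectic manifold $M$ of dimension $2m$, a capping disk is a continuous map $\sigma:D\to M$ from the closed unit disk with $\sigma(e^{2\pi i t/T})=\gamma(t)$. The Conley–Zehnder index $\mu_{CZ}(\gamma,\sigma)$ is the Robbin–Salamon index of the path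 of symplectic matrices $$\Gamma(t)=\Phi(\gamma(t))\circ d\varphi_t(\gamma(0))\circ\Phi(\gamma(0))^{-1},\qquad 0\le t\le T,$$ where $\Phi:\sigma^*TM\to D\times\mathbb R^{2m}$ is any symplectic trivialization. The Robbin–Salamon index of a continuous path $\Gamma:[0,T]\to Sp(2m)$ is the sum, over the crossings $t$ (the times with $\det(\Gamma'(t)-1)=0$) of a path $\Gamma'$ that is homotopic to $\Gamma$ with fixed endpoints and has only regular crossings, of the signatures of the crossing forms $v\mapsto\omega_0(v,\dot\Gamma'(t)v)$ on $\ker(\Gamma'(t)-1)$, the crossings at $t=0$ and $t=T$ being counted with weight $\tfrac12$. Here $\omega_0$ is the standard symplectic form on $\mathbb R^{2m}$. **Lemma.** Suppose that the linearized flow of $h$ leaves the distribution $\operatorname{span}\{\nabla f\}$ along $Z$ invariant, i.e. $d\varphi_t(\nabla f(z))\in\operatorname{span}\{\nabla f(\varphi_t(z))\}$ for all $z\in Z$ and all $t$ for which $\varphi_t(z)$ is defined. Let $\tilde\gamma:[0,T]\to Z$ be a closed orbit of $X_h^t$ that is contractible in $Z$, and let $\sigma_{\tilde\gamma}:D\to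 Z$ be a capping disk of $\tilde\gamma$ with values in $Z$. Then $\gamma:=\pi\circ\tilde\gamma$ is a closed orbit of $X_g^t$ with the same period $T$, the map $\sigma_\gamma:=\pi\circ\sigma_{\tilde\gamma}$ is a capping disk of $\gamma$, and $$\mu_{CZ}(\tilde\gamma,\sigma_{\tilde\gamma})=\mu_{CZ}(\gamma,\sigma_\gamma).$$ The equality holds for every choice of symplectic trivializations of $\sigma_{\tilde\gamma}^*TV$ and $\sigma_\gamma^*TW$ used to compute the two indices. -/

import Mathlib

open Set Bundle Manifold Matrix
open scoped ContDiff Topology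

noncomputable section

/-! ### The Conley-Zehnder (Robbin-Salamon) index of a path of symplectic matrices -/

namespace CZ

/-- Real matrices of size `2n × 2n`, the index type `Fin n ⊕ Fin n` listing the coordinates
`(x₁, …, xₙ, y₁, …, yₙ)` of `ℝ²ⁿ`. Such a matrix `A` is symplectic iff it lies in Mathlib's
`Matrix.symplecticGroup (Fin n) ℝ`, and `Matrix.J (Fin n) ℝ` is the standard complex structure
`J₀ = [[0, -1], [1, 0]]`. -/
abbrev Mat (n : ℕ) : Type := Matrix (Fin n ⊕ Fin n) (Fin n ⊕ Fin n) ℝ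

/-- The standard symplectic form `∑ dxᵢ ∧ dyᵢ` on `ℝ²ⁿ`, i.e. `ω₀(a, b) = ⟨J₀ a, b⟩`. -/
def stdForm {n : ℕ} (a b : Fin n ⊕ Fin n → ℝ) : ℝ := (Matrix.J (Fin n) ℝ *ᵥ a) ⬝ᵥ b

/-- A continuous path of symplectic matrices, parametrized by `[0, T]` (the values of `Γ` outside
`[0, T]` are irrelevant). -/
structure IsSymplecticPath {n : ℕ} (T : ℝ) (Γ : ℝ → Mat n) : Prop where
  continuousOn : ContinuousOn Γ (Icc 0 T)
  symplectic : ∀ t ∈ Icc 0 T, Γ t ∈ Matrix.symplecticGroup (Fin n) ℝ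

/-- The times in `[0, T]` at which the path meets the Maslov cycle `det (A - 1) = 0`. -/
def crossings {n : ℕ} (T : ℝ) (Γ : ℝ → Mat n) : Set ℝ :=
  {t | t ∈ Icc 0 T ∧ (Γ t - 1).det = 0}

/-- The velocity `Γ'(t)`, taken entrywise (and one-sided at `0` and `T`). -/
def velocity {n : ℕ} (T : ℝ) (Γ : ℝ → Mat n) (t : ℝ) : Mat n :=
  Matrix.of fun i j => derivWithin (fun s => Γ s i j) (Icc 0 T) t

/-- The space `ker (Γ(t) - 1)`. -/
def fixedSpace {n : ℕ} (Γ : ℝ → Mat n) (t : ℝ) : Submodule ℝ (Fin n ⊕ Fin n → ℝ) :=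
  LinearMap.ker (Matrix.toLin' (Γ t - 1))

/-- The crossing form `v ↦ ω₀(v, Γ'(t) v)` on `ker (Γ(t) - 1)`. If `Γ' = J₀ S Γ` then this is
`v ↦ ⟨v, S(t) v⟩`. -/
def crossingForm {n : ℕ} (T : ℝ) (Γ : ℝ → Mat n) (t : ℝ) : QuadraticForm ℝ (fixedSpace Γ t) :=
  (Matrix.toBilin' ((Matrix.J (Fin n) ℝ)ᵀ * velocity T Γ t)).toQuadraticMap.restrict
    (fixedSpace Γ t)

/-- The signature of the crossing form: positive minus negative index of inertia. -/
def crossingSignature {n : ℕ} (T : ℝ) (Γ : ℝ → Mat n) (t : ℝ) : ℤ :=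
  (sigPos (crossingForm T Γ t) : ℤ) - (sigNeg (crossingForm T Γ t) : ℤ)

/-- A symplectic path with only regular crossings: there are finitely many of them, and at each
of them the path is differentiable and the crossing form is nondegenerate (its positive and
negative indices of inertia add up to the dimension of its domain). Away from the crossings,
where nothing is counted, continuity suffices. -/
structure IsRegularPath {n : ℕ} (T : ℝ) (Γ : ℝ → Mat n) : Prop extends
    IsSymplecticPath T Γ where
  finite_crossings : (crossings T Γ).Finite
  differentiable : ∀ t ∈ crossings T Γ, ∀ i j,
    DifferentiableWithinAt ℝ (fun s => Γ s i j) (Icc 0 T) t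
  nondegenerate : ∀ t ∈ crossings T Γ,
    sigPos (crossingForm T Γ t) + sigNeg (crossingForm T Γ t)
      = Module.finrank ℝ (fixedSpace Γ t)

open Classical in
/-- The Robbin-Salamon count of a path with regular crossings: the sum of the signatures of the
crossing forms, where a crossing at an endpoint of `[0, T]` counts with weight one half. -/
def crossingNumber {n : ℕ} (T : ℝ) (Γ : ℝ → Mat n) : ℝ :=
  ∑ᶠ t ∈ crossings T Γ,
    (if t = 0 ∨ t = T then (1 / 2 : ℝ) else 1) * (crossingSignature T Γ t : ℝ)

/-- Homotopy with fixed endpoints through symplectic paths on `[0, T]`. -/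
def HomotopicRelEndpoints {n : ℕ} (T : ℝ) (Γ₀ Γ₁ : ℝ → Mat n) : Prop :=
  ∃ H : ℝ × ℝ → Mat n,
    ContinuousOn H (Icc 0 1 ×ˢ Icc 0 T) ∧
    (∀ p ∈ Icc (0 : ℝ) 1 ×ˢ Icc 0 T, H p ∈ Matrix.symplecticGroup (Fin n) ℝ) ∧
    (∀ t ∈ Icc 0 T, H (0, t) = Γ₀ t ∧ H (1, t) = Γ₁ t) ∧
    (∀ s ∈ Icc (0 : ℝ) 1, H (s, 0) = Γ₀ 0 ∧ H (s, T) = Γ₀ T)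

/-- The Conley-Zehnder index of Robbin and Salamon, of a continuous path of symplectic matrices on
`[0, T]`: the crossing number of a path with regular crossings that is homotopic to it with fixed
endpoints. -/
def index {n : ℕ} (T : ℝ) (Γ : ℝ → Mat n) : ℝ :=
  Classical.epsilon fun c : ℝ =>
    ∃ Γ' : ℝ → Mat n, IsRegularPath T Γ' ∧ HomotopicRelEndpoints T Γ Γ' ∧
      crossingNumber T Γ' = c

end CZ

/-! ### Symplectic manifolds, Hamiltonian vector fields and flows -/

section Symplectic

variable {E : Type*} [NormedAddCommGroup E] [NormedSpace ℝ E]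
  {M : Type*} [TopologicalSpace M] [ChartedSpace E M]

/-- The form `Ω` in the coordinates of the chart at `x₀`: its value at the point `y` of the model
space, on the coordinate vectors `u` and `v`. -/
def localForm (Ω : ∀ x : M, TangentSpace 𝓘(ℝ, E) x →L[ℝ] TangentSpace 𝓘(ℝ, E) x →L[ℝ] ℝ)
    (x₀ : M) (y u v : E) : ℝ :=
  Ω ((extChartAt 𝓘(ℝ, E) x₀).symm y)
    (mfderiv 𝓘(ℝ, E) 𝓘(ℝ, E) (extChartAt 𝓘(ℝ, E) x₀).symm y u)
    (mfderiv 𝓘(ℝ, E) 𝓘(ℝ, E) (extChartAt 𝓘(ℝ, E) x₀).symm y v)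

variable (E M) in
/-- A symplectic form on `M`: a smooth, closed, nondegenerate `2`-form. Closedness says that
`dΩ = 0` in the charts:
`∂ᵤ Ω(v, w) + ∂ᵥ Ω(w, u) + ∂_w Ω(u, v) = 0` for constant coordinate vectors `u`, `v`, `w`. -/
structure SymplecticForm [IsManifold 𝓘(ℝ, E) ∞ M] where
  toFun : ∀ x : M, TangentSpace 𝓘(ℝ, E) x →L[ℝ] TangentSpace 𝓘(ℝ, E) x →L[ℝ] ℝ
  smooth : ContMDiff 𝓘(ℝ, E) (𝓘(ℝ, E).prod 𝓘(ℝ, E →L[ℝ] E →L[ℝ] ℝ)) ∞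
    (fun x => TotalSpace.mk' (E →L[ℝ] E →L[ℝ] ℝ)
      (E := fun x : M => TangentSpace 𝓘(ℝ, E) x →L[ℝ] TangentSpace 𝓘(ℝ, E) x →L[ℝ] ℝ)
      x (toFun x))
  alternating : ∀ x u, toFun x u u = 0
  nondegenerate : ∀ x u, (∀ v, toFun x u v = 0) → u = 0
  closed : ∀ x₀ : M, ∀ y ∈ (extChartAt 𝓘(ℝ, E) x₀).target, ∀ u v w : E,
    fderiv ℝ (fun y => localForm toFun x₀ y v w) y u
      + fderiv ℝ (fun y => localForm toFun x₀ y w u) y v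
      + fderiv ℝ (fun y => localForm toFun x₀ y u v) y w = 0

/-- A smooth almost complex structure compatible with `Ω`; the induced Riemannian metric is
`⟨u, v⟩ = Ω(u, J v)`. -/
structure CompatibleAlmostComplex [IsManifold 𝓘(ℝ, E) ∞ M] (Ω : SymplecticForm E M) where
  toFun : ∀ x : M, TangentSpace 𝓘(ℝ, E) x →L[ℝ] TangentSpace 𝓘(ℝ, E) x
  smooth : ContMDiff 𝓘(ℝ, E) (𝓘(ℝ, E).prod 𝓘(ℝ, E →L[ℝ] E)) ∞
    (fun x => TotalSpace.mk' (E →L[ℝ] E)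
      (E := fun x : M => TangentSpace 𝓘(ℝ, E) x →L[ℝ] TangentSpace 𝓘(ℝ, E) x)
      x (toFun x))
  sq : ∀ x u, toFun x (toFun x u) = -u
  compatible : ∀ x u v, Ω.toFun x (toFun x u) (toFun x v) = Ω.toFun x u v
  positive : ∀ x u, u ≠ 0 → 0 < Ω.toFun x u (toFun x u)

/-- The Hamiltonian vector field of `H`, at `x`: the vector `u` with `Ω(u, ·) = -dH`. -/
def hamiltonianVectorField [IsManifold 𝓘(ℝ, E) ∞ M] (Ω : SymplecticForm E M) (H : M → ℝ) (x : M) :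
    TangentSpace 𝓘(ℝ, E) x :=
  Classical.epsilon fun u : TangentSpace 𝓘(ℝ, E) x =>
    ∀ v, Ω.toFun x u v = -(mfderiv 𝓘(ℝ, E) 𝓘(ℝ, ℝ) H x v : ℝ)

/-- The gradient of `f` for the metric `⟨u, v⟩ = Ω(u, J v)`, at `x`: the vector `u` with
`⟨u, ·⟩ = df`. -/
def gradientField [IsManifold 𝓘(ℝ, E) ∞ M] {Ω : SymplecticForm E M}
    (J : CompatibleAlmostComplex Ω) (f : M → ℝ) (x : M) : TangentSpace 𝓘(ℝ, E) x :=
  Classical.epsilon fun u : TangentSpace 𝓘(ℝ, E) x =>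
    ∀ v, Ω.toFun x u (J.toFun x v) = (mfderiv 𝓘(ℝ, E) 𝓘(ℝ, ℝ) f x v : ℝ)

/-- The curve `η` solves `η'(t) = X(t, η(t))` for `t ∈ s`, where `X` is a time-dependent vector
field. -/
def IsSolutionOn (X : ∀ (_ : ℝ) (x : M), TangentSpace 𝓘(ℝ, E) x) (η : ℝ → M) (s : Set ℝ) : Prop :=
  ∀ t ∈ s, HasMFDerivAt 𝓘(ℝ, ℝ) 𝓘(ℝ, E) η t ((1 : ℝ →L[ℝ] ℝ).smulRight (X t (η t)))

/-- `φ` is the (maximal) flow, from time `0`, of the time-dependent vector field `X`, with flow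
domain `D`: `t ↦ φ t x` is the maximal solution with value `x` at time `0`, it is defined for the
times `t` with `(t, x) ∈ D`, and `φ` is smooth on the open set `D`. If `X` is complete then
`D` is everything. Values of `φ` outside `D` are irrelevant. -/
structure IsFlow (X : ∀ (_ : ℝ) (x : M), TangentSpace 𝓘(ℝ, E) x)
    (D : Set (ℝ × M)) (φ : ℝ → M → M) : Prop where
  isOpen : IsOpen D
  smooth : ContMDiffOn (𝓘(ℝ, ℝ).prod 𝓘(ℝ, E)) 𝓘(ℝ, E) ∞ (fun p : ℝ × M => φ p.1 p.2) D
  zero_mem : ∀ x, (0, x) ∈ D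
  zero_apply : ∀ x, φ 0 x = x
  ordConnected : ∀ x, OrdConnected {t : ℝ | (t, x) ∈ D}
  solution : ∀ x, IsSolutionOn X (fun t => φ t x) {t : ℝ | (t, x) ∈ D}
  maximal : ∀ (η : ℝ → M) (a b : ℝ), a < 0 → 0 < b → IsSolutionOn X η (Ioo a b) →
    ∀ t ∈ Ioo a b, (t, η 0) ∈ D

/-- The time-dependent Hamiltonian vector field of `h : M × ℝ → ℝ`, where `h (x, t) = h_t(x)`. -/
def timeHamiltonianVectorField [IsManifold 𝓘(ℝ, E) ∞ M] (Ω : SymplecticForm E M) (h : M × ℝ → ℝ)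
    (t : ℝ) (x : M) : TangentSpace 𝓘(ℝ, E) x :=
  hamiltonianVectorField Ω (fun y => h (y, t)) x

/-- `f` is a first integral of the time-dependent vector field `X`: it is smooth, and constant
along all orbits of `X`. -/
structure IsFirstIntegral (X : ∀ (_ : ℝ) (x : M), TangentSpace 𝓘(ℝ, E) x) (f : M → ℝ) : Prop where
  smooth : ContMDiff 𝓘(ℝ, E) 𝓘(ℝ, ℝ) ∞ f
  const : ∀ (η : ℝ → M) (a b : ℝ), IsSolutionOn X η (Ioo a b) →
    ∀ s ∈ Ioo a b, ∀ t ∈ Ioo a b, f (η s) = f (η t)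

end Symplectic

/-! ### Closed orbits, capping disks and their index -/

/-- The closed unit disk in `ℂ`. -/
abbrev Disk : Type := Metric.closedBall (0 : ℂ) 1

/-- The boundary point `e^{2πis}` of the disk. -/
def boundaryPoint (s : ℝ) : Disk :=
  ⟨Circle.exp (2 * Real.pi * s), by
    rw [mem_closedBall_zero_iff, Circle.norm_coe]⟩

section Orbits

variable {E : Type*} [NormedAddCommGroup E] [NormedSpace ℝ E]
  {M : Type*} [TopologicalSpace M] [ChartedSpace E M]

/-- `γ`, restricted to `[0, T]`, is a closed orbit of period `T > 0` of the flow `φ` with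
domain `D`. -/
structure IsClosedOrbit (D : Set (ℝ × M)) (φ : ℝ → M → M) (T : ℝ) (γ : ℝ → M) : Prop where
  pos : 0 < T
  closed : γ T = γ 0
  mem : ∀ t ∈ Icc 0 T, (t, γ 0) ∈ D
  orbit : ∀ t ∈ Icc 0 T, φ t (γ 0) = γ t

/-- `σ` is a capping disk of the closed curve `γ : [0, T] → N`: it restricts to `γ` on the
boundary circle, parametrized by `t ↦ e^{2πit/T}`. -/
def IsCappingDisk {N : Type*} [TopologicalSpace N] (T : ℝ) (γ : ℝ → N) (σ : C(Disk, N)) : Prop :=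
  ∀ t ∈ Icc 0 T, σ (boundaryPoint (t / T)) = γ t

/-- A (continuous) symplectic trivialization `σ^* TM → Disk × ℝ²ⁿ`. -/
structure SymplecticTrivialization [IsManifold 𝓘(ℝ, E) ∞ M] (Ω : SymplecticForm E M) (n : ℕ)
    (σ : C(Disk, M)) where
  toEquiv : ∀ p : Disk, TangentSpace 𝓘(ℝ, E) (σ p) ≃ₗ[ℝ] (Fin n ⊕ Fin n → ℝ)
  continuous_symm : ∀ a : Fin n ⊕ Fin n → ℝ,
    Continuous fun p : Disk => (⟨σ p, (toEquiv p).symm a⟩ : TangentBundle 𝓘(ℝ, E) M)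
  symplectic : ∀ p u v, Ω.toFun (σ p) u v = CZ.stdForm (toEquiv p u) (toEquiv p v)

open Classical in
/-- The coordinates, in the trivialization at `p`, of a tangent vector at the point `σ p`
(and `0` for a tangent vector with another base point). -/
def SymplecticTrivialization.coord [IsManifold 𝓘(ℝ, E) ∞ M] {Ω : SymplecticForm E M} {n : ℕ}
    {σ : C(Disk, M)} (Φ : SymplecticTrivialization Ω n σ) (p : Disk)
    (w : TangentBundle 𝓘(ℝ, E) M) : Fin n ⊕ Fin n → ℝ :=
  if hw : w.proj = σ p then
    Φ.toEquiv p (cast (congrArg (fun x : M => TangentSpace 𝓘(ℝ, E) x) hw) w.snd)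
  else 0

/-- The linearized flow along the closed orbit `γ(t) = σ(e^{2πit/T})` in the trivialization `Φ`
over the capping disk: the path `t ↦ Φ(γ(t)) ∘ dφ_t(γ(0)) ∘ Φ(γ(0))⁻¹` of matrices. -/
def linearizedPath [IsManifold 𝓘(ℝ, E) ∞ M] {Ω : SymplecticForm E M} {n : ℕ} {σ : C(Disk, M)}
    (φ : ℝ → M → M) (T : ℝ) (Φ : SymplecticTrivialization Ω n σ) (t : ℝ) : CZ.Mat n :=
  Matrix.of fun i j =>
    Φ.coord (boundaryPoint (t / T))
      (tangentMap 𝓘(ℝ, E) 𝓘(ℝ, E) (φ t)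
        ⟨σ (boundaryPoint 0), (Φ.toEquiv (boundaryPoint 0)).symm (Pi.single j 1)⟩) i

/-- The Conley-Zehnder index of the closed orbit `γ(t) = σ(e^{2πit/T})`, `0 ≤ t ≤ T`, of the flow
`φ`, with capping disk `σ`, computed in the symplectic trivialization `Φ` of `σ^* TM`. -/
def orbitIndex [IsManifold 𝓘(ℝ, E) ∞ M] {Ω : SymplecticForm E M} {n : ℕ} {σ : C(Disk, M)}
    (φ : ℝ → M → M) (T : ℝ) (Φ : SymplecticTrivialization Ω n σ) : ℝ :=
  CZ.index T (linearizedPath φ T Φ)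

end Orbits

/-! ### Regular levels and reduction by a circle action -/

/-- The level set `Z = f⁻¹(c)`, with the subspace topology. -/
abbrev LevelSet {V : Type*} (f : V → ℝ) (c : ℝ) : Type _ := {x : V // f x = c}

/-- The orbit space of an action of the circle `ℝ/τℤ`, with the quotient topology. -/
abbrev OrbitSpace (τ : ℝ) (Z : Type*) [AddAction (AddCircle τ) Z] : Type _ :=
  Quotient (AddAction.orbitRel (AddCircle τ) Z)

/-- The quotient projection `π : Z → Z/S¹`. -/
def orbitProj (τ : ℝ) (Z : Type*) [AddAction (AddCircle τ) Z] : Z → OrbitSpace τ Z :=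
  Quotient.mk _

/-- The projection `π ∘ σ` of a disk `σ` in `Z`. -/
def projDisk (τ : ℝ) {Z : Type*} [TopologicalSpace Z] [AddAction (AddCircle τ) Z] (σ : C(Disk, Z)) :
    C(Disk, OrbitSpace τ Z) :=
  ⟨fun p => orbitProj τ Z (σ p), continuous_quotient_mk'.comp σ.continuous⟩

/-- The disk `σ` in the level set `Z`, as a disk in `V`. -/
def inclDisk {V : Type*} [TopologicalSpace V] {f : V → ℝ} {c : ℝ} (σ : C(Disk, LevelSet f c)) :
    C(Disk, V) :=
  ⟨fun p => (σ p : V), continuous_subtype_val.comp σ.continuous⟩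

section Reduction

variable {E E₁ E₂ : Type*} [NormedAddCommGroup E] [NormedSpace ℝ E]
  [NormedAddCommGroup E₁] [NormedSpace ℝ E₁] [NormedAddCommGroup E₂] [NormedSpace ℝ E₂]
  {V : Type*} [TopologicalSpace V] [ChartedSpace E V]

variable (E E₁) in
/-- `Z = f⁻¹(c)` is a regular level of `f`, and the given smooth structure on it is that of a
submanifold of `V`: as `Z` carries the subspace topology, this means that the inclusion is a
smooth immersion. -/
structure IsRegularLevel (f : V → ℝ) (c : ℝ) [ChartedSpace E₁ (LevelSet f c)] : Prop where
  regular : ∀ z : LevelSet f c, mfderiv 𝓘(ℝ, E) 𝓘(ℝ, ℝ) f (z : V) ≠ 0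
  smooth : ContMDiff 𝓘(ℝ, E₁) 𝓘(ℝ, E) ∞ (fun z : LevelSet f c => (z : V))
  immersion : ∀ z : LevelSet f c, Function.Injective
    (mfderiv 𝓘(ℝ, E₁) 𝓘(ℝ, E) (fun z : LevelSet f c => (z : V)) z)

/-- The given action of the circle `ℝ/τℤ` on the level `Z = f⁻¹(c)` is free and generated by the
Hamiltonian vector field of `f`. -/
structure GeneratesFreeCircleAction [IsManifold 𝓘(ℝ, E) ∞ V] (Ω : SymplecticForm E V)
    (f : V → ℝ) (c τ : ℝ) [AddAction (AddCircle τ) (LevelSet f c)] : Prop where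
  period_pos : 0 < τ
  free : ∀ (a : AddCircle τ) (z : LevelSet f c), a +ᵥ z = z → a = 0
  generated : ∀ z : LevelSet f c, IsMIntegralCurve (I := 𝓘(ℝ, E))
    (fun s : ℝ => (((s : AddCircle τ) +ᵥ z : LevelSet f c) : V)) (hamiltonianVectorField Ω f)

variable (E₁) in
/-- The orbit space `W = Z/S¹`, with the given smooth structure and symplectic form `ωW`, is the
Marsden-Weinstein reduced space: the quotient projection `π : Z → W` is a smooth submersion, and
`π^* ωW` is the restriction of `Ω` to `Z`. (Both requirements together determine the smooth
structure and the form `ωW`.) -/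
structure IsMarsdenWeinsteinQuotient [IsManifold 𝓘(ℝ, E) ∞ V] (Ω : SymplecticForm E V)
    (f : V → ℝ) (c τ : ℝ) [ChartedSpace E₁ (LevelSet f c)]
    [AddAction (AddCircle τ) (LevelSet f c)]
    [ChartedSpace E₂ (OrbitSpace τ (LevelSet f c))]
    [IsManifold 𝓘(ℝ, E₂) ∞ (OrbitSpace τ (LevelSet f c))]
    (ωW : SymplecticForm E₂ (OrbitSpace τ (LevelSet f c))) : Prop where
  smooth : ContMDiff 𝓘(ℝ, E₁) 𝓘(ℝ, E₂) ∞ (orbitProj τ (LevelSet f c))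
  submersion : ∀ z, Function.Surjective
    (mfderiv 𝓘(ℝ, E₁) 𝓘(ℝ, E₂) (orbitProj τ (LevelSet f c)) z)
  pullback : ∀ (z : LevelSet f c) (u v : TangentSpace 𝓘(ℝ, E₁) z),
    ωW.toFun (orbitProj τ (LevelSet f c) z)
        (mfderiv 𝓘(ℝ, E₁) 𝓘(ℝ, E₂) (orbitProj τ (LevelSet f c)) z u)
        (mfderiv 𝓘(ℝ, E₁) 𝓘(ℝ, E₂) (orbitProj τ (LevelSet f c)) z v)
      = Ω.toFun (z : V)
        (mfderiv 𝓘(ℝ, E₁) 𝓘(ℝ, E) (fun z : LevelSet f c => (z : V)) z u)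
        (mfderiv 𝓘(ℝ, E₁) 𝓘(ℝ, E) (fun z : LevelSet f c => (z : V)) z v)

/-- `g` is the Hamiltonian induced on the orbit space by `h`: the smooth function with
`g_t ∘ π = h_t` on `Z`. -/
structure IsReducedHamiltonian (h : V × ℝ → ℝ) (f : V → ℝ) (c τ : ℝ)
    [AddAction (AddCircle τ) (LevelSet f c)]
    [ChartedSpace E₂ (OrbitSpace τ (LevelSet f c))]
    (g : OrbitSpace τ (LevelSet f c) × ℝ → ℝ) : Prop where
  smooth : ContMDiff (𝓘(ℝ, E₂).prod 𝓘(ℝ, ℝ)) 𝓘(ℝ, ℝ) ∞ g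
  comp_proj : ∀ (z : LevelSet f c) (t : ℝ), g (orbitProj τ (LevelSet f c) z, t) = h ((z : V), t)

/-- The linearized flow `dφ_t` leaves the distribution `span {∇f}` along the level `Z = f⁻¹(c)`
invariant. -/
def PreservesGradientSpan [IsManifold 𝓘(ℝ, E) ∞ V] {Ω : SymplecticForm E V}
    (J : CompatibleAlmostComplex Ω) (f : V → ℝ) (c : ℝ)
    (D : Set (ℝ × V)) (φ : ℝ → V → V) : Prop :=
  ∀ (t : ℝ) (z : V), (t, z) ∈ D → f z = c →
    mfderiv 𝓘(ℝ, E) 𝓘(ℝ, E) (φ t) z (gradientField J f z)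
      ∈ Submodule.span ℝ {gradientField J f (φ t z)}

end Reduction

end

/-! Scale the gradient of `f` along `Z` to a vector field `N` with `df(N) = 1`. A vector `w` tangent
to `V` at a point of `Z` is described by the vector `dπ(w - df(w) N)` of `TW` together with the two
numbers `df(w)` and `Ω(N, w)`, and these coordinates are symplectic (`stdForm_adaptedCoord`). The
linearized flow preserves `df` because `f` is a first integral, and preserves `Ω` because it is
Hamiltonian. By hypothesis it sends `N` to a multiple of `N`, which invariance of `df` forces to be
`N` itself. So the two numbers do not change, while the component in `TW` moves by the linearized
flow of `g`, whose orbits are the projections of the orbits in `Z`. In the adapted coordinates the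
linearized flow is therefore the block sum of the reduced path and the constant path `1` in `Sp(2)`
(`IsReduction.adaptedFrame_tderiv`). These coordinates exist over the whole capping disk, so their
comparison with a given trivialization is a continuous map from the disk to the symplectic group.

What remains is a statement on matrix paths (`CZ.index_eq_of_conj_blockSum`): the index is unchanged
by adding a constant identity block and by a change of frame that extends over the disk. The change
of frame is contracted radially. The identity block has degenerate crossings, so it is deformed to a
short rotation out of the identity and back; its two end crossings have opposite signatures and
cancel.

As the index is defined by choosing a homotopic regular path, two facts are needed. First, regular
paths that are homotopic with fixed endpoints have the same crossing number
(`CZ.crossingNumber_eq_of_homotopic`). For symplectic `A` the quadratic form `2⟨Au, Ju⟩ - τ|Au -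
u|²` has kernel `ker (A - 1)` as soon as `chartMat τ A` is invertible, which holds for some `τ`. Its
signature is constant off the Maslov cycle and changes by the crossing signature on either side of a
regular crossing. For two values of `τ` the signatures differ by a locally constant function.
Increments of these signatures along a path are thus independent of `τ`, and summing them over the
cells of a fine grid gives homotopy invariance.

Second, every path is homotopic to a regular one (`CZ.exists_isGoodPath_homotopic`). In a Cayley
chart, straight lines in a definite direction have definite crossing forms, so short pieces can be
replaced by two such lines; a generic small rotation removes crossings from the points where the
pieces are joined. -/

noncomputable section

set_option linter.unusedSectionVars false

/-! ### Signatures of perturbed quadratic forms -/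

namespace CZ

variable {ι : Type*} [Fintype ι] [DecidableEq ι]

/-- The quadratic form `u ↦ ⟨u, M u⟩`. -/
def matForm (M : Matrix ι ι ℝ) : QuadraticForm ℝ (ι → ℝ) := (Matrix.toBilin' M).toQuadraticMap

lemma matForm_apply (M : Matrix ι ι ℝ) (u : ι → ℝ) : matForm M u = u ⬝ᵥ M *ᵥ u := by
  simp [matForm, Matrix.toBilin'_apply']

lemma matForm_neg (M : Matrix ι ι ℝ) : matForm (-M) = -matForm M := by
  ext u; simp [matForm_apply, Matrix.neg_mulVec]

/-- The signature (positive minus negative index of inertia) of `u ↦ ⟨u, M u⟩`. -/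
def matSign (M : Matrix ι ι ℝ) : ℤ := (sigPos (matForm M) : ℤ) - sigNeg (matForm M)

lemma continuous_matForm :
    Continuous fun p : Matrix ι ι ℝ × (ι → ℝ) => matForm p.1 p.2 := by
  simp only [matForm_apply]
  fun_prop

/-- By homogeneity positivity need only be tested on the unit sphere of `W`, and compactness of that
sphere makes the local estimates uniform. -/
lemma eventually_posDef_of_sphere {α : Type*} {l : Filter α} (W : Submodule ℝ (ι → ℝ))
    (A : α → Matrix ι ι ℝ)
    (h : ∀ x ∈ W, x ≠ 0 → ∃ U ∈ 𝓝 x, ∀ᶠ a in l, ∀ y ∈ U, y ∈ W → 0 < matForm (A a) y) :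
    ∀ᶠ a in l, ((matForm (A a)).restrict W).PosDef := by
  have hc : IsCompact ((W : Set (ι → ℝ)) ∩ Metric.sphere 0 1) :=
    (isCompact_sphere _ _).inter_left W.closed_of_finiteDimensional
  have key : ∀ᶠ a in l, ∀ y ∈ (W : Set (ι → ℝ)) ∩ Metric.sphere 0 1, 0 < matForm (A a) y := by
    refine hc.induction_on (p := fun s => ∀ᶠ a in l, ∀ y ∈ s, y ∈ W → 0 < matForm (A a) y)
      (by simp) (fun s t hst ht => ht.mono fun a ha y hy => ha y (hst hy)) ?_ ?_
      |>.mono fun a ha y hy => ha y hy hy.1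
    · intro s t hs ht
      filter_upwards [hs, ht] with a h1 h2 y hy
      exact hy.elim (h1 y) (h2 y)
    · rintro x ⟨hxW, hx⟩
      obtain ⟨U, hU, hU'⟩ := h x hxW (by rintro rfl; simp at hx)
      exact ⟨U, mem_nhdsWithin_of_mem_nhds hU, hU'⟩
  filter_upwards [key] with a ha
  rintro ⟨x, hxW⟩ hx
  have hx0 : x ≠ 0 := by simpa using hx
  have hn : ‖x‖ ≠ 0 := norm_ne_zero_iff.2 hx0
  have := ha (‖x‖⁻¹ • x) ⟨W.smul_mem _ hxW, by simp [norm_smul, hn]⟩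
  rw [QuadraticMap.map_smul] at this
  rw [QuadraticMap.restrict_apply]
  exact pos_of_mul_pos_right (by simpa using this) (by positivity)

lemma eventually_posDef_of_tendsto {α : Type*} {l : Filter α} (W : Submodule ℝ (ι → ℝ))
    {A : α → Matrix ι ι ℝ} {A₀ : Matrix ι ι ℝ} (hA : Filter.Tendsto A l (𝓝 A₀))
    (h₀ : ((matForm A₀).restrict W).PosDef) :
    ∀ᶠ a in l, ((matForm (A a)).restrict W).PosDef := by
  refine eventually_posDef_of_sphere W A fun x hx hx0 => ?_
  have hpos : 0 < matForm A₀ x := h₀ ⟨x, hx⟩ (by simpa using hx0)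
  have := (continuous_matForm.tendsto (A₀, x)).eventually (lt_mem_nhds hpos)
  rw [nhds_prod_eq] at this
  obtain ⟨pa, hpa, pb, hpb, hh⟩ := Filter.eventually_prod_iff.1 this
  exact ⟨{y | pb y}, hpb, (hA.eventually hpa).mono fun a ha y hy _ => hh ha hy⟩

/-- Where `A₀` is positive the leading term wins for small `ε`. Near a null vector of `A₀` the
leading term is still nonnegative on `W`, so the first-order term decides. -/
lemma eventually_posDef_of_expansion {α : Type*} {l : Filter α} (W : Submodule ℝ (ι → ℝ))
    {ε : α → ℝ} {R : α → Matrix ι ι ℝ} {A₀ A₁ : Matrix ι ι ℝ}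
    (hε : Filter.Tendsto ε l (𝓝[>] 0)) (hR : Filter.Tendsto R l (𝓝 A₁))
    (h₀ : ∀ x ∈ W, 0 ≤ matForm A₀ x)
    (h₁ : ∀ x ∈ W, x ≠ 0 → matForm A₀ x = 0 → 0 < matForm A₁ x) :
    ∀ᶠ a in l, ((matForm (A₀ + ε a • R a)).restrict W).PosDef := by
  have happ : ∀ (a : α) y, matForm (A₀ + ε a • R a) y = matForm A₀ y + ε a * matForm (R a) y := by
    intro a y
    simp [matForm_apply, Matrix.add_mulVec, Matrix.smul_mulVec]
  have hε0 : Filter.Tendsto ε l (𝓝 0) := hε.mono_right nhdsWithin_le_nhds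
  have hεp : ∀ᶠ a in l, 0 < ε a := hε.eventually self_mem_nhdsWithin
  refine eventually_posDef_of_sphere W _ fun x hx hx0 => ?_
  rcases (h₀ x hx).lt_or_eq with hpos | hz
  · have hlim : Filter.Tendsto (fun a => A₀ + ε a • R a) l (𝓝 A₀) := by
      simpa using tendsto_const_nhds.add (hε0.smul hR)
    have := (continuous_matForm.tendsto (A₀, x)).eventually (lt_mem_nhds hpos)
    rw [nhds_prod_eq] at this
    obtain ⟨pa, hpa, pb, hpb, hh⟩ := Filter.eventually_prod_iff.1 this
    exact ⟨{y | pb y}, hpb, (hlim.eventually hpa).mono fun a ha y hy _ => hh ha hy⟩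
  · have := (continuous_matForm.tendsto (A₁, x)).eventually (lt_mem_nhds (h₁ x hx hx0 hz.symm))
    rw [nhds_prod_eq] at this
    obtain ⟨pa, hpa, pb, hpb, hh⟩ := Filter.eventually_prod_iff.1 this
    refine ⟨{y | pb y}, hpb, ?_⟩
    filter_upwards [hR.eventually hpa, hεp] with a ha hp y hy hyW
    rw [happ]
    have h2 : 0 < matForm (R a) y := hh ha hy
    have := h₀ y hyW
    positivity

/-- Maximal definite subspaces for `A₀` remain definite for nearby matrices. When `A₀` is
nondegenerate their dimensions already exhaust the space, so neither index can grow. -/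
lemma eventually_matSign_eq {α : Type*} {l : Filter α}
    {A : α → Matrix ι ι ℝ} {A₀ : Matrix ι ι ℝ} (hA : Filter.Tendsto A l (𝓝 A₀))
    (h₀ : sigPos (matForm A₀) + sigNeg (matForm A₀) = Fintype.card ι) :
    ∀ᶠ a in l, matSign (A a) = matSign A₀ := by
  obtain ⟨P, hP, hP'⟩ := exists_finrank_eq_sigPos_and_posDef (matForm A₀)
  obtain ⟨N, hN, hN'⟩ := exists_finrank_eq_sigNeg_and_negDef (matForm A₀)
  rw [← matForm_neg] at hN'
  filter_upwards [eventually_posDef_of_tendsto P hA hP',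
    eventually_posDef_of_tendsto N hA.neg hN'] with a h1 h2
  rw [matForm_neg] at h2
  have h3 := le_sigPos_of_posDef _ h1
  have h4 := le_sigNeg_of_negDef _ h2
  have h5 := QuadraticForm.sigPos_add_sigNeg_add_radical (Q := matForm (A a))
  rw [Module.finrank_fintype_fun_eq_card] at h5
  simp only [matSign]
  omega

lemma matForm_add_of_ker {A : Matrix ι ι ℝ} (hA : Aᵀ = A) (u k : ι → ℝ) (hk : A *ᵥ k = 0) :
    matForm A (u + k) = matForm A u := by
  have h : k ⬝ᵥ A *ᵥ u = 0 := by
    rw [Matrix.dotProduct_mulVec, ← Matrix.mulVec_transpose, hA, hk, zero_dotProduct]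
  simp [matForm_apply, Matrix.mulVec_add, hk, h]

lemma radical_matForm {A : Matrix ι ι ℝ} (hA : Aᵀ = A) :
    (matForm A).radical = LinearMap.ker (Matrix.toLin' A) := by
  ext k
  rw [LinearMap.mem_ker, Matrix.toLin'_apply, QuadraticMap.mem_radical_iff']
  constructor
  · rintro ⟨h3, hk⟩
    refine dotProduct_eq_zero _ fun u => ?_
    have h1 := hk u
    have h2 : k ⬝ᵥ A *ᵥ u = u ⬝ᵥ A *ᵥ k := by
      rw [Matrix.dotProduct_mulVec, ← Matrix.mulVec_transpose, hA, dotProduct_comm]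
    simp only [matForm_apply, Matrix.mulVec_add, add_dotProduct, dotProduct_add, h2] at h1 h3
    rw [dotProduct_comm]
    linarith
  · intro hk
    refine ⟨by simp [matForm_apply, hk], fun u => ?_⟩
    rw [add_comm, matForm_add_of_ker hA u k hk]

/-- The signature of a perturbation `A₀ + ε R`, `R → A₁`, of a symmetric matrix `A₀`, if `A₁` is
nondegenerate on `ker A₀`. -/
lemma eventually_matSign_eq_add {α : Type*} {l : Filter α}
    {ε : α → ℝ} {R : α → Matrix ι ι ℝ} {A₀ A₁ : Matrix ι ι ℝ} (hsymm : A₀ᵀ = A₀)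
    (hε : Filter.Tendsto ε l (𝓝[>] 0)) (hR : Filter.Tendsto R l (𝓝 A₁))
    (K : Submodule ℝ (ι → ℝ)) (hK : ∀ u, u ∈ K ↔ A₀ *ᵥ u = 0)
    (hnd : sigPos ((matForm A₁).restrict K) + sigNeg ((matForm A₁).restrict K)
      = Module.finrank ℝ K) :
    ∀ᶠ a in l, sigPos (matForm (A₀ + ε a • R a)) + sigNeg (matForm (A₀ + ε a • R a))
        = Fintype.card ι ∧ matSign (A₀ + ε a • R a) = matSign A₀
      + ((sigPos ((matForm A₁).restrict K) : ℤ) - sigNeg ((matForm A₁).restrict K)) := by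
  -- Lower bound for the positive index: a maximal positive subspace of `A₀` plus a maximal positive
  -- subspace of `A₁` inside `K`. Applied also to `-A₀` and `-A₁`, it gives two bounds that add up
  -- to the full dimension, so both are equalities.
  have aux : ∀ (A₀ A₁ : Matrix ι ι ℝ) (R : α → Matrix ι ι ℝ), A₀ᵀ = A₀ →
      Filter.Tendsto R l (𝓝 A₁) → (∀ u, u ∈ K ↔ A₀ *ᵥ u = 0) →
      ∀ᶠ a in l, sigPos (matForm A₀) + sigPos ((matForm A₁).restrict K) ≤
        sigPos (matForm (A₀ + ε a • R a)) := by
    intro A₀ A₁ R hsymm hR hK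
    obtain ⟨P, hP, hP'⟩ := exists_finrank_eq_sigPos_and_posDef (matForm A₀)
    obtain ⟨L, hL, hL'⟩ := exists_finrank_eq_sigPos_and_posDef ((matForm A₁).restrict K)
    have hLK : ∀ k ∈ L.map K.subtype, A₀ *ᵥ k = 0 ∧ (k ≠ 0 → 0 < matForm A₁ k) := by
      rintro k ⟨k', hk', rfl⟩
      refine ⟨(hK _).1 k'.2, fun h0 => hL' ⟨k', hk'⟩ ?_⟩
      simpa using h0
    have hdisj : Disjoint P (L.map K.subtype) := by
      rw [Submodule.disjoint_def]
      intro x hxP hxL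
      by_contra hx
      have := hP' ⟨x, hxP⟩ (by simpa using hx)
      simp [matForm_apply, (hLK x hxL).1] at this
    have hdim : Module.finrank ℝ ↥(P ⊔ L.map K.subtype)
        = sigPos (matForm A₀) + sigPos ((matForm A₁).restrict K) := by
      have := Submodule.finrank_sup_add_finrank_inf_eq P (L.map K.subtype)
      rw [hdisj.eq_bot, finrank_bot, Submodule.finrank_map_subtype_eq] at this
      omega
    rw [← hdim]
    refine (eventually_posDef_of_expansion (P ⊔ L.map K.subtype) hε hR ?_ ?_).mono
      fun a ha => le_sigPos_of_posDef _ ha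
    · intro x hx
      obtain ⟨u, hu, k, hk, rfl⟩ := Submodule.mem_sup.1 hx
      rw [matForm_add_of_ker hsymm u k (hLK k hk).1]
      by_cases h : u = 0
      · simp [h]
      · exact (hP' ⟨u, hu⟩ (by simpa using h)).le
    · intro x hx hx0 hz
      obtain ⟨u, hu, k, hk, rfl⟩ := Submodule.mem_sup.1 hx
      rw [matForm_add_of_ker hsymm u k (hLK k hk).1] at hz
      obtain rfl : u = 0 := by
        by_contra h
        exact (hP' ⟨u, hu⟩ (by simpa using h)).ne' hz
      rw [zero_add] at hx0 ⊢
      exact (hLK k hk).2 hx0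
  have hneg : (matForm (-A₁)).restrict K = -(matForm A₁).restrict K := by
    rw [matForm_neg]; rfl
  filter_upwards [aux A₀ A₁ R hsymm hR hK, aux (-A₀) (-A₁) (fun a => -R a) (by simp [hsymm]) hR.neg
    (by simpa [Matrix.neg_mulVec] using hK)] with a h1 h2
  have e : -A₀ + ε a • -R a = -(A₀ + ε a • R a) := by rw [smul_neg, neg_add]
  rw [e, hneg, matForm_neg, matForm_neg, sigPos_neg, sigPos_neg, sigPos_neg] at h2
  have h5 := QuadraticForm.sigPos_add_sigNeg_add_radical (Q := matForm (A₀ + ε a • R a))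
  have h6 := QuadraticForm.sigPos_add_sigNeg_add_radical (Q := matForm A₀)
  have h7 : (matForm A₀).radical = K := by
    rw [radical_matForm hsymm]; ext u; simp [hK]
  rw [h7] at h6
  rw [Module.finrank_fintype_fun_eq_card] at h5 h6
  simp only [matSign]
  omega

end CZ

/-! ### Local signature functions on the symplectic group -/

namespace CZ

section Signature

variable {ι : Type*} [Fintype ι] [DecidableEq ι]

/-- Sylvester's law of inertia: `G` is an isometry between the two forms. -/
lemma matSign_congr (M : Matrix ι ι ℝ) {G : Matrix ι ι ℝ} (hG : IsUnit G.det) :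
    matSign (Gᵀ * M * G) = matSign M := by
  have h : (matForm (Gᵀ * M * G)).Equivalent (matForm M) :=
    ⟨{ Matrix.toLin'OfInv (M := G⁻¹) (M' := G) (Matrix.nonsing_inv_mul _ hG)
        (Matrix.mul_nonsing_inv _ hG) with
       map_app' := fun u => by
        change matForm M (Matrix.toLin' G u) = _
        rw [Matrix.toLin'_apply, matForm_apply, matForm_apply, ← Matrix.mulVec_mulVec, ← Matrix.mulVec_mulVec,
          Matrix.dotProduct_mulVec u, Matrix.vecMul_transpose] }⟩
  simp only [matSign, h.sigPos_eq, h.sigNeg_eq]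

lemma matSign_diagonal (d : ι → ℝ) :
    matSign (Matrix.diagonal d) = ∑ i, (SignType.sign (d i) : ℤ) := by
  have h : matForm (Matrix.diagonal d) = QuadraticMap.weightedSumSquares ℝ d := by
    ext u
    simp only [matForm_apply, dotProduct, Matrix.mulVec_diagonal,
      QuadraticMap.weightedSumSquares_apply, smul_eq_mul]
    exact Finset.sum_congr rfl fun i _ => by ring
  classical
  rw [matSign, h, QuadraticForm.sigPos_weightedSumSquares, QuadraticForm.sigNeg_weightedSumSquares,
    Set.ncard_eq_toFinset_card', Set.ncard_eq_toFinset_card', Finset.card_eq_sum_ones,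
    Finset.card_eq_sum_ones, Set.toFinset_ofPred, Set.toFinset_ofPred, Finset.sum_filter,
    Finset.sum_filter]
  push_cast
  rw [← Finset.sum_sub_distrib]
  refine Finset.sum_congr rfl fun i _ => ?_
  rcases lt_trichotomy (d i) 0 with h | h | h
  · simp [h, not_lt.2 h.le]
  · simp [h]
  · simp [h, not_lt.2 h.le]

/-- If `1 - δ * g` is negative then `g` is positive and the two signs on the left differ by `2`;
otherwise they agree. -/
lemma sign_cocycle {g δ : ℝ} (hδ : 0 < δ) (h : 1 - δ * g ≠ 0) :
    (SignType.sign g : ℤ) - SignType.sign (g * (1 - δ * g))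
      = 1 - SignType.sign (1 - δ * g) := by
  rcases h.lt_or_gt with h1 | h1
  · have hg : 0 < g := by
      by_contra hg
      have : δ * g ≤ 0 := mul_nonpos_of_nonneg_of_nonpos hδ.le (not_lt.1 hg)
      linarith
    simp [sign_mul, sign_neg h1, sign_pos hg]
  · simp [sign_mul, sign_pos h1]

/-- An orthogonal diagonalization of `G` diagonalizes all the matrices at once and reduces the
identity to `sign_cocycle`, eigenvalue by eigenvalue. -/
lemma matSign_cocycle {G : Matrix ι ι ℝ} (hG : Gᵀ = G) {δ : ℝ} (hδ : 0 < δ)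
    (hdet : (1 - δ • G).det ≠ 0) :
    matSign G - matSign (G * (1 - δ • G)) = Fintype.card ι - matSign (1 - δ • G) := by
  have hH : G.IsHermitian := by simpa [Matrix.IsHermitian] using hG
  set U : Matrix ι ι ℝ := (hH.eigenvectorUnitary : Matrix ι ι ℝ) with hU
  set d := hH.eigenvalues
  have hUU : Uᵀ * U = 1 := by
    have := Unitary.coe_star_mul_self hH.eigenvectorUnitary
    simpa [Matrix.star_eq_conjTranspose] using this
  have hUU' : U * Uᵀ = 1 := mul_eq_one_comm.1 hUU
  have hspec : G = U * Matrix.diagonal d * Uᵀ := by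
    have := hH.spectral_theorem
    simpa [Unitary.conjStarAlgAut_apply, Matrix.star_eq_conjTranspose, Function.comp_def] using this
  have h1 : 1 - δ • G = U * Matrix.diagonal (fun i => 1 - δ * d i) * Uᵀ := by
    have : Matrix.diagonal (fun i => 1 - δ * d i) = 1 - δ • Matrix.diagonal d := by
      rw [← Matrix.diagonal_one, ← Matrix.diagonal_smul, ← Matrix.diagonal_sub]; rfl
    rw [this, mul_sub, sub_mul, mul_one, hUU', Matrix.mul_smul, Matrix.smul_mul, ← hspec]
  have h2 : G * (1 - δ • G) = U * Matrix.diagonal (fun i => d i * (1 - δ * d i)) * Uᵀ := by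
    rw [h1]
    nth_rewrite 1 [hspec]
    rw [← Matrix.diagonal_mul_diagonal]
    simp only [mul_assoc]
    rw [← mul_assoc Uᵀ U, hUU, one_mul]
  have hu : IsUnit (Uᵀ).det := by
    refine Matrix.isUnit_det_transpose _ ((Matrix.isUnit_iff_isUnit_det _).1 ?_)
    exact ⟨⟨U, Uᵀ, hUU', hUU⟩, rfl⟩
  have hs : ∀ e : ι → ℝ, matSign (U * Matrix.diagonal e * Uᵀ)
      = ∑ i, (SignType.sign (e i) : ℤ) := by
    intro e
    have := matSign_congr (Matrix.diagonal e) hu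
    rw [Matrix.transpose_transpose] at this
    rw [this, matSign_diagonal]
  have hne : ∀ i, 1 - δ * d i ≠ 0 := by
    intro i hi
    apply hdet
    rw [h1, Matrix.det_mul, Matrix.det_mul, Matrix.det_diagonal,
      Finset.prod_eq_zero (Finset.mem_univ i) hi]
    ring
  rw [h2, h1]
  nth_rewrite 1 [hspec]
  rw [hs, hs, hs, ← Finset.sum_sub_distrib, Finset.sum_congr rfl fun i _ => sign_cocycle hδ (hne i),
    Finset.sum_sub_distrib]
  simp

end Signature

/-! ### Symmetric forms attached to a symplectic matrix. -/

variable {n : ℕ}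

/-- The second component of the pair `(A - 1, J (A + 1) - τ (A - 1))` of maps whose joint range is
a Lagrangian subspace, if `A` is symplectic. -/
def chartMat (τ : ℝ) (A : Mat n) : Mat n := Matrix.J (Fin n) ℝ * (A + 1) - τ • (A - 1)

/-- The symmetric matrix of the form `u ↦ 2⟨Au, Ju⟩ - τ|Au - u|²`. -/
def formMat (τ : ℝ) (A : Mat n) : Mat n := (A - 1)ᵀ * chartMat τ A

/-- The signature of `u ↦ 2⟨Au, Ju⟩ - τ|Au - u|²`. -/
def chartSign (τ : ℝ) (A : Mat n) : ℤ := matSign (formMat τ A)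

lemma continuous_chartMat (τ : ℝ) : Continuous (chartMat τ : Mat n → Mat n) := by
  unfold chartMat; fun_prop

lemma continuous_formMat (τ : ℝ) : Continuous (formMat τ : Mat n → Mat n) := by
  unfold formMat chartMat; fun_prop

lemma transpose_mul_J_mul {A : Mat n} (hA : A ∈ Matrix.symplecticGroup (Fin n) ℝ) :
    Aᵀ * Matrix.J (Fin n) ℝ * A = Matrix.J (Fin n) ℝ := SymplecticGroup.mem_iff'.1 hA

lemma formMat_transpose (τ : ℝ) {A : Mat n} (hA : A ∈ Matrix.symplecticGroup (Fin n) ℝ) :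
    (formMat τ A)ᵀ = formMat τ A := by
  have h := transpose_mul_J_mul hA
  rw [mul_assoc] at h
  simp only [formMat, chartMat, Matrix.transpose_mul, Matrix.transpose_sub, Matrix.transpose_add,
    Matrix.transpose_smul, Matrix.transpose_one, Matrix.transpose_transpose, Matrix.J_transpose]
  simp only [sub_mul, mul_sub, add_mul, mul_add, one_mul, mul_one, Matrix.smul_mul, Matrix.mul_smul,
    Matrix.mul_assoc, neg_mul, mul_neg, smul_sub, h]
  abel

lemma transpose_mul_chartMat_comm (τ : ℝ) {A : Mat n}
    (hA : A ∈ Matrix.symplecticGroup (Fin n) ℝ) :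
    (chartMat τ A)ᵀ * (A - 1) = (A - 1)ᵀ * chartMat τ A := by
  have := formMat_transpose τ hA
  simpa [formMat] using this

lemma chartMat_sub (τ τ' : ℝ) (A : Mat n) :
    chartMat τ' A = chartMat τ A - (τ' - τ) • (A - 1) := by
  simp only [chartMat, sub_smul]; abel

lemma J_mulVec_injective {u : Fin n ⊕ Fin n → ℝ} (h : Matrix.J (Fin n) ℝ *ᵥ u = 0) : u = 0 := by
  have : (-Matrix.J (Fin n) ℝ * Matrix.J (Fin n) ℝ) *ᵥ u = 0 := by
    rw [← Matrix.mulVec_mulVec, h, Matrix.mulVec_zero]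
  simpa [Matrix.J_squared] using this

/-- Write `X = A - 1` and `Y = chartMat 0 A`. If `Y - τ X` were singular for every `τ`, its null
vectors `u τ` would have nonzero images `X u τ`, pairwise orthogonal for distinct `τ` because `Xᵀ Y`
is symmetric: an infinite independent family in a finite-dimensional space. -/
lemma exists_chartMat_det_ne_zero {A : Mat n} (hA : A ∈ Matrix.symplecticGroup (Fin n) ℝ) :
    ∃ τ : ℝ, (chartMat τ A).det ≠ 0 := by
  by_contra! hcon
  have hex : ∀ τ : ℝ, ∃ u : Fin n ⊕ Fin n → ℝ, u ≠ 0 ∧ chartMat τ A *ᵥ u = 0 := fun τ =>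
    Matrix.exists_mulVec_eq_zero_iff.2 (hcon τ)
  choose u hu0 hu using hex
  have hY : ∀ τ, chartMat 0 A *ᵥ u τ = τ • ((A - 1) *ᵥ u τ) := by
    intro τ
    have := hu τ
    rw [chartMat_sub 0 τ, Matrix.sub_mulVec, sub_zero, Matrix.smul_mulVec, sub_eq_zero] at this
    exact this
  have hX : ∀ τ, (A - 1) *ᵥ u τ ≠ 0 := by
    intro τ h
    have h2 := hY τ
    rw [h, smul_zero, chartMat, zero_smul, sub_zero, ← Matrix.mulVec_mulVec] at h2
    have h3 := J_mulVec_injective h2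
    rw [Matrix.sub_mulVec, sub_eq_zero] at h
    rw [Matrix.add_mulVec, h, Matrix.one_mulVec, ← two_smul ℝ, smul_eq_zero] at h3
    exact hu0 τ (h3.resolve_left two_ne_zero)
  have hsymm : ∀ v w : Fin n ⊕ Fin n → ℝ, ((A - 1) *ᵥ v) ⬝ᵥ (chartMat 0 A *ᵥ w)
      = ((A - 1) *ᵥ w) ⬝ᵥ (chartMat 0 A *ᵥ v) := by
    intro v w
    rw [Matrix.dotProduct_mulVec, ← Matrix.mulVec_transpose, Matrix.mulVec_mulVec,
      transpose_mul_chartMat_comm 0 hA, ← Matrix.mulVec_mulVec, Matrix.mulVec_transpose,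
      ← Matrix.dotProduct_mulVec, dotProduct_comm]
  have hli : LinearIndependent ℝ fun τ : ℝ => (A - 1) *ᵥ u τ := by
    refine LinearMap.BilinForm.linearIndependent_of_iIsOrtho (B := Matrix.toBilin' (1 : Mat n)) ?_ ?_
    · rw [LinearMap.BilinForm.iIsOrtho_def]
      intro τ τ' hne
      have := hsymm (u τ) (u τ')
      rw [hY, hY, dotProduct_smul, dotProduct_smul, dotProduct_comm ((A - 1) *ᵥ u τ')] at this
      have h2 : (τ' - τ) * (((A - 1) *ᵥ u τ) ⬝ᵥ ((A - 1) *ᵥ u τ')) = 0 := by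
        simp only [smul_eq_mul] at this
        linarith
      rw [Matrix.toBilin'_apply', Matrix.one_mulVec]
      exact (mul_eq_zero.1 h2).resolve_left (sub_ne_zero.2 hne.symm)
    · intro τ h
      rw [Matrix.toBilin'_apply', Matrix.one_mulVec] at h
      exact hX τ (dotProduct_self_eq_zero.1 h)
  have := hli.finite
  exact _root_.not_finite ℝ

/-- By symmetry `formMat τ A` is also `(chartMat τ A)ᵀ * (A - 1)`, and the first factor is
invertible. Hence the form degenerates only on the Maslov cycle. -/
lemma formMat_mulVec_eq_zero_iff {τ : ℝ} {A : Mat n}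
    (hA : A ∈ Matrix.symplecticGroup (Fin n) ℝ) (hτ : (chartMat τ A).det ≠ 0)
    (u : Fin n ⊕ Fin n → ℝ) : formMat τ A *ᵥ u = 0 ↔ (A - 1) *ᵥ u = 0 := by
  rw [formMat, ← transpose_mul_chartMat_comm τ hA, ← Matrix.mulVec_mulVec]
  refine ⟨fun h => ?_, fun h => by rw [h, Matrix.mulVec_zero]⟩
  by_contra h0
  exact hτ (by rw [← Matrix.det_transpose]; exact Matrix.exists_mulVec_eq_zero_iff.1 ⟨_, h0, h⟩)

/-- With `Y = chartMat τ A` and `G = (A - 1) Y⁻¹`, symmetric because `Yᵀ (A - 1)` is, the three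
forms are congruent through `Y` to `G`, `G (1 - δ G)` and `1 - δ G`, where `δ = τ' - τ`. The
right-hand side only involves an invertible matrix, so the difference on the left is stable even
across the Maslov cycle. -/
lemma chartSign_cocycle {τ τ' : ℝ} (hlt : τ < τ') {A : Mat n}
    (hA : A ∈ Matrix.symplecticGroup (Fin n) ℝ) (hτ : (chartMat τ A).det ≠ 0)
    (hτ' : (chartMat τ' A).det ≠ 0) :
    chartSign τ A - chartSign τ' A
      = Fintype.card (Fin n ⊕ Fin n) - matSign ((chartMat τ A)ᵀ * chartMat τ' A) := by
  set Y := chartMat τ A with hYdef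
  have hu : IsUnit Y.det := isUnit_iff_ne_zero.2 hτ
  set X := A - 1 with hX
  set G := X * Y⁻¹ with hGdef
  have hXG : X = G * Y := by rw [hGdef, mul_assoc, Matrix.nonsing_inv_mul _ hu, mul_one]
  have hcomm : Yᵀ * X = Xᵀ * Y := transpose_mul_chartMat_comm τ hA
  have hG : Gᵀ = G := by
    have h1 : Yᵀ * Gᵀ * Y = Yᵀ * G * Y := by
      rw [← Matrix.transpose_mul, ← hXG, mul_assoc, ← hXG, hcomm]
    have h2 : Yᵀ * Gᵀ = Yᵀ * G := by
      have := congrArg (· * Y⁻¹) h1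
      simpa [mul_assoc, Matrix.mul_nonsing_inv _ hu] using this
    have hu' : IsUnit (Yᵀ).det := Matrix.isUnit_det_transpose _ hu
    have := congrArg ((Yᵀ)⁻¹ * ·) h2
    simpa [← mul_assoc, Matrix.nonsing_inv_mul _ hu'] using this
  have hY' : chartMat τ' A = (1 - (τ' - τ) • G) * Y := by
    rw [chartMat_sub τ τ', sub_mul, one_mul, Matrix.smul_mul, ← hXG]
  have hdet : (1 - (τ' - τ) • G).det ≠ 0 := by
    rw [hY', Matrix.det_mul] at hτ'
    exact left_ne_zero_of_mul hτ'
  have e1 : formMat τ A = Yᵀ * G * Y := by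
    rw [formMat, ← hX, ← hYdef, hXG, Matrix.transpose_mul, hG]
  have e2 : formMat τ' A = Yᵀ * (G * (1 - (τ' - τ) • G)) * Y := by
    rw [formMat, ← hX, hXG, hY', Matrix.transpose_mul, hG]; simp only [mul_assoc]
  have e3 : Yᵀ * chartMat τ' A = Yᵀ * (1 - (τ' - τ) • G) * Y := by rw [hY', mul_assoc]
  rw [chartSign, chartSign, e1, e2, e3, matSign_congr _ hu, matSign_congr _ hu, matSign_congr _ hu]
  exact matSign_cocycle hG (sub_pos.2 hlt) hdet

lemma sigPos_add_sigNeg_of_det_ne_zero {ι : Type*} [Fintype ι] [DecidableEq ι] {M : Matrix ι ι ℝ}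
    (hM : Mᵀ = M) (hdet : M.det ≠ 0) :
    sigPos (matForm M) + sigNeg (matForm M) = Fintype.card ι := by
  have h := QuadraticForm.sigPos_add_sigNeg_add_radical (Q := matForm M)
  have h0 : LinearMap.ker (Matrix.toLin' M) = ⊥ := by
    rw [LinearMap.ker_eq_bot']
    intro u hu
    by_contra h0
    exact hdet (Matrix.exists_mulVec_eq_zero_iff.1 ⟨u, h0, by simpa using hu⟩)
  rw [radical_matForm hM, h0, finrank_bot, Module.finrank_fintype_fun_eq_card] at h
  simpa using h

lemma det_ne_zero_of_sigPos_add_sigNeg {ι : Type*} [Fintype ι] [DecidableEq ι] {M : Matrix ι ι ℝ}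
    (hM : Mᵀ = M) (h : sigPos (matForm M) + sigNeg (matForm M) = Fintype.card ι) :
    M.det ≠ 0 := by
  have h' := QuadraticForm.sigPos_add_sigNeg_add_radical (Q := matForm M)
  rw [Module.finrank_fintype_fun_eq_card, h] at h'
  have h0 : (matForm M).radical = ⊥ := Submodule.finrank_eq_zero.1 (by omega)
  rw [radical_matForm hM, LinearMap.ker_eq_bot'] at h0
  intro hdet
  obtain ⟨u, hu, hu'⟩ := Matrix.exists_mulVec_eq_zero_iff.2 hdet
  exact hu (h0 u (by simpa using hu'))

/-- The difference of two local signature functions is locally constant. -/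
lemma eventually_chartSign_sub_eq {α : Type*} {l : Filter α} {A : α → Mat n} {A₀ : Mat n}
    (hA : Filter.Tendsto A l (𝓝 A₀)) (hA₀ : A₀ ∈ Matrix.symplecticGroup (Fin n) ℝ)
    (hsymp : ∀ᶠ a in l, A a ∈ Matrix.symplecticGroup (Fin n) ℝ) {τ τ' : ℝ}
    (hτ : (chartMat τ A₀).det ≠ 0) (hτ' : (chartMat τ' A₀).det ≠ 0) :
    ∀ᶠ a in l, chartSign τ (A a) - chartSign τ' (A a) = chartSign τ A₀ - chartSign τ' A₀ := by
  have aux : ∀ τ τ' : ℝ, τ < τ' → (chartMat τ A₀).det ≠ 0 → (chartMat τ' A₀).det ≠ 0 →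
      ∀ᶠ a in l, chartSign τ (A a) - chartSign τ' (A a) = chartSign τ A₀ - chartSign τ' A₀ := by
    intro τ τ' hlt hτ hτ'
    have hopen : ∀ τ, (chartMat τ A₀).det ≠ 0 → ∀ᶠ a in l, (chartMat τ (A a)).det ≠ 0 :=
      fun τ h => hA.eventually
        (((continuous_chartMat τ).matrix_det.continuousAt (x := A₀)).eventually_ne h)
    have hc : Continuous fun B : Mat n => (chartMat τ B)ᵀ * chartMat τ' B :=
      (continuous_chartMat τ).matrix_transpose.mul (continuous_chartMat τ')
    have hsym : ((chartMat τ A₀)ᵀ * chartMat τ' A₀)ᵀ = (chartMat τ A₀)ᵀ * chartMat τ' A₀ := by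
      rw [Matrix.transpose_mul, Matrix.transpose_transpose, chartMat_sub τ τ',
        Matrix.transpose_sub, sub_mul, mul_sub, Matrix.transpose_smul, Matrix.smul_mul,
        Matrix.mul_smul, transpose_mul_chartMat_comm τ hA₀]
    have hnd := sigPos_add_sigNeg_of_det_ne_zero hsym
      (by rw [Matrix.det_mul, Matrix.det_transpose]; exact mul_ne_zero hτ hτ')
    filter_upwards [hopen τ hτ, hopen τ' hτ', hsymp,
      eventually_matSign_eq ((hc.tendsto A₀).comp hA) hnd] with a h1 h2 h3 h4
    rw [chartSign_cocycle hlt h3 h1 h2, chartSign_cocycle hlt hA₀ hτ hτ']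
    simp only [Function.comp_apply] at h4
    rw [h4]
  rcases lt_trichotomy τ τ' with h | rfl | h
  · exact aux τ τ' h hτ hτ'
  · simp
  · filter_upwards [aux τ' τ h hτ' hτ] with a ha
    omega

/-- Away from the Maslov cycle the local signature functions are locally constant. -/
lemma eventually_chartSign_eq {α : Type*} {l : Filter α} {A : α → Mat n} {A₀ : Mat n}
    (hA : Filter.Tendsto A l (𝓝 A₀)) (hA₀ : A₀ ∈ Matrix.symplecticGroup (Fin n) ℝ) {τ : ℝ}
    (hτ : (chartMat τ A₀).det ≠ 0) (hdet : (A₀ - 1).det ≠ 0) :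
    ∀ᶠ a in l, chartSign τ (A a) = chartSign τ A₀ :=
  eventually_matSign_eq (((continuous_formMat τ).tendsto A₀).comp hA)
    (sigPos_add_sigNeg_of_det_ne_zero (formMat_transpose τ hA₀) (by
      rw [formMat, Matrix.det_mul, Matrix.det_transpose]; exact mul_ne_zero hdet hτ))

/-- The jump of the local signature functions at a regular crossing, and isolatedness of regular
crossings. -/
lemma eventually_chartSign_eq_add {α : Type*} {l : Filter α} {A : α → Mat n} {A₀ D : Mat n}
    {ε : α → ℝ} (hε : Filter.Tendsto ε l (𝓝[>] 0))
    (hA : Filter.Tendsto (fun a => (ε a)⁻¹ • (A a - A₀)) l (𝓝 D))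
    (hA₀ : A₀ ∈ Matrix.symplecticGroup (Fin n) ℝ)
    (hsymp : ∀ᶠ a in l, A a ∈ Matrix.symplecticGroup (Fin n) ℝ)
    {Q : QuadraticForm ℝ (LinearMap.ker (Matrix.toLin' (A₀ - 1)))}
    (hQ : ∀ u, Q u = ((Matrix.J (Fin n) ℝ)ᵀ * D) *ᵥ (u : Fin n ⊕ Fin n → ℝ) ⬝ᵥ u)
    (hnd : sigPos Q + sigNeg Q = Module.finrank ℝ (LinearMap.ker (Matrix.toLin' (A₀ - 1))))
    {τ : ℝ} (hτ : (chartMat τ A₀).det ≠ 0) :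
    ∀ᶠ a in l, (A a - 1).det ≠ 0 ∧
      chartSign τ (A a) = chartSign τ A₀ + ((sigPos Q : ℤ) - sigNeg Q) := by
  set JJ := Matrix.J (Fin n) ℝ with hJ
  set E : α → Mat n := fun a => (ε a)⁻¹ • (A a - A₀) with hE
  -- `formMat τ A` is quadratic in `A`, so it equals its value at `A₀` plus `2 ε R` with `R`
  -- convergent. The factor `1/2` compensates `chartMat τ A₀ u = 2 J u` on the kernel of `A₀ - 1`,
  -- so that the limit of `R` restricts there to `Q` itself.
  set R : α → Mat n := fun a => (2⁻¹ : ℝ) • ((E a)ᵀ * chartMat τ A₀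
    + (A₀ - 1)ᵀ * (JJ * E a - τ • E a) + ε a • ((E a)ᵀ * (JJ * E a - τ • E a))) with hR
  have hε0 : Filter.Tendsto ε l (𝓝 0) := hε.mono_right nhdsWithin_le_nhds
  have hεp : ∀ᶠ a in l, 0 < ε a := hε.eventually self_mem_nhdsWithin
  set A₁ : Mat n := (2⁻¹ : ℝ) • (Dᵀ * chartMat τ A₀ + (A₀ - 1)ᵀ * (JJ * D - τ • D)) with hA₁
  have hRlim : Filter.Tendsto R l (𝓝 A₁) := by
    have hF : Continuous fun p : ℝ × Mat n => (2⁻¹ : ℝ) • ((p.2)ᵀ * chartMat τ A₀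
        + (A₀ - 1)ᵀ * (JJ * p.2 - τ • p.2) + p.1 • ((p.2)ᵀ * (JJ * p.2 - τ • p.2))) := by
      fun_prop
    have := (hF.tendsto (0, D)).comp (hε0.prodMk_nhds hA)
    simpa only [hA₁, hR, Function.comp_def, zero_smul, add_zero] using this
  have hεt : Filter.Tendsto (fun a => 2 * ε a) l (𝓝[>] 0) := by
    rw [tendsto_nhdsWithin_iff]
    refine ⟨by simpa using hε0.const_mul 2, hεp.mono fun a ha => ?_⟩
    simpa using ha
  have hform : ∀ᶠ a in l, formMat τ (A a) = formMat τ A₀ + (2 * ε a) • R a := by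
    filter_upwards [hεp] with a ha
    have hAa : A a = A₀ + ε a • E a := by
      rw [hE]; simp [smul_smul, ha.ne']
    have h2 : (2 * ε a) • R a = ε a • ((E a)ᵀ * chartMat τ A₀
      + (A₀ - 1)ᵀ * (JJ * E a - τ • E a) + ε a • ((E a)ᵀ * (JJ * E a - τ • E a))) := by
      rw [hR, smul_smul]; congr 1; ring
    rw [h2, hAa]
    have h3 : chartMat τ (A₀ + ε a • E a) = chartMat τ A₀ + ε a • (JJ * E a - τ • E a) := by
      simp only [chartMat, ← hJ, mul_add, smul_sub, smul_add, Matrix.mul_smul, smul_comm τ (ε a)]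
      abel
    have h4 : (A₀ + ε a • E a - 1)ᵀ = (A₀ - 1)ᵀ + ε a • (E a)ᵀ := by
      rw [← Matrix.transpose_smul, ← Matrix.transpose_add]; congr 1; abel
    rw [formMat, formMat, h3, h4]
    simp only [add_mul, mul_add, Matrix.smul_mul, Matrix.mul_smul, smul_add]
    abel
  have hK : ∀ u, u ∈ LinearMap.ker (Matrix.toLin' (A₀ - 1)) ↔ formMat τ A₀ *ᵥ u = 0 := by
    intro u
    rw [formMat_mulVec_eq_zero_iff hA₀ hτ, LinearMap.mem_ker, Matrix.toLin'_apply]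
  have hres : (matForm A₁).restrict (LinearMap.ker (Matrix.toLin' (A₀ - 1))) = Q := by
    ext ⟨u, hu⟩
    rw [hQ, QuadraticMap.restrict_apply, matForm_apply]
    rw [LinearMap.mem_ker, Matrix.toLin'_apply] at hu
    have hu1 : A₀ *ᵥ u = u := by
      rwa [Matrix.sub_mulVec, Matrix.one_mulVec, sub_eq_zero] at hu
    have h1 : chartMat τ A₀ *ᵥ u = (2 : ℝ) • (JJ *ᵥ u) := by
      rw [chartMat, Matrix.sub_mulVec, Matrix.smul_mulVec, hu, smul_zero, sub_zero,
        ← Matrix.mulVec_mulVec, Matrix.add_mulVec, hu1, Matrix.one_mulVec, ← two_smul ℝ,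
        Matrix.mulVec_smul]
    have h2 : u ⬝ᵥ ((A₀ - 1)ᵀ * (JJ * D - τ • D)) *ᵥ u = 0 := by
      rw [← Matrix.mulVec_mulVec, Matrix.dotProduct_mulVec, Matrix.vecMul_transpose, hu,
        zero_dotProduct]
    rw [hA₁, Matrix.smul_mulVec, Matrix.add_mulVec, dotProduct_smul, dotProduct_add, h2, add_zero,
      ← Matrix.mulVec_mulVec, h1, Matrix.mulVec_smul, dotProduct_smul, smul_smul,
      Matrix.dotProduct_mulVec, Matrix.vecMul_transpose, ← Matrix.mulVec_mulVec,
      Matrix.mulVec_transpose, ← Matrix.dotProduct_mulVec]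
    simp
  have hnd' := hnd
  rw [← hres] at hnd'
  filter_upwards [eventually_matSign_eq_add (formMat_transpose τ hA₀) hεt hRlim _ hK hnd', hform,
    hsymp] with a h1 h2 h3
  rw [← h2, hres] at h1
  refine ⟨fun h0 => ?_, h1.2⟩
  refine det_ne_zero_of_sigPos_add_sigNeg (formMat_transpose τ h3) h1.1 ?_
  rw [formMat, Matrix.det_mul, Matrix.det_transpose, h0, zero_mul]

end CZ

/-! ### Homotopy invariance of the crossing number -/

namespace CZ

variable {n : ℕ}

/-- The quadratic form `v ↦ ω₀(v, D v)` on `ker (A - 1)`. -/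
def velocityForm (A D : Mat n) : QuadraticForm ℝ (LinearMap.ker (Matrix.toLin' (A - 1))) :=
  (matForm ((Matrix.J (Fin n) ℝ)ᵀ * D)).restrict _

lemma velocityForm_apply (A D : Mat n) (u : LinearMap.ker (Matrix.toLin' (A - 1))) :
    velocityForm A D u = ((Matrix.J (Fin n) ℝ)ᵀ * D) *ᵥ (u : Fin n ⊕ Fin n → ℝ) ⬝ᵥ u := by
  rw [velocityForm, QuadraticMap.restrict_apply, matForm_apply, dotProduct_comm]

lemma velocityForm_neg (A D : Mat n) : velocityForm A (-D) = -velocityForm A D := by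
  ext u
  rw [_root_.neg_apply, velocityForm_apply, velocityForm_apply, mul_neg, Matrix.neg_mulVec,
    neg_dotProduct]

/-- The velocity form of `A, D` is nondegenerate. -/
def IsRegularVelocity (A D : Mat n) : Prop :=
  sigPos (velocityForm A D) + sigNeg (velocityForm A D)
    = Module.finrank ℝ (LinearMap.ker (Matrix.toLin' (A - 1)))

/-- `D` is the entrywise derivative of `Γ` within `S` at `t`. -/
def HasMatDerivWithinAt (Γ : ℝ → Mat n) (D : Mat n) (S : Set ℝ) (t : ℝ) : Prop :=
  ∀ i j, HasDerivWithinAt (fun s => Γ s i j) (D i j) S t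

/-- To the right of `t` the perturbed form gains the signature of the velocity form; on the left the
path is read backwards, with velocity `-D`, and the gain changes sign. The factor `sign (t' - t)`
covers both sides and also the case that `t` is an end of `S`. -/
lemma eventually_chartSign_crossing {S : Set ℝ} {Γ : ℝ → Mat n} {t : ℝ} (ht : t ∈ S)
    (hsymp : ∀ t ∈ S, Γ t ∈ Matrix.symplecticGroup (Fin n) ℝ) {D : Mat n}
    (hD : HasMatDerivWithinAt Γ D S t) (hreg : IsRegularVelocity (Γ t) D) {τ : ℝ}
    (hτ : (chartMat τ (Γ t)).det ≠ 0) :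
    ∀ᶠ t' in 𝓝[S] t, (t' ≠ t → (Γ t' - 1).det ≠ 0) ∧ chartSign τ (Γ t') = chartSign τ (Γ t)
      + SignType.sign (t' - t) *
        ((sigPos (velocityForm (Γ t) D) : ℤ) - sigNeg (velocityForm (Γ t) D)) := by
  have hslope : Filter.Tendsto (fun t' => (t' - t)⁻¹ • (Γ t' - Γ t)) (𝓝[S \ {t}] t) (𝓝 D) := by
    refine tendsto_pi_nhds.2 fun i => tendsto_pi_nhds.2 fun j => ?_
    exact hasDerivWithinAt_iff_tendsto_slope.1 (hD i j)
  have hsub : Filter.Tendsto (fun t' => t' - t) (𝓝 t) (𝓝 0) := by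
    have : Continuous fun t' : ℝ => t' - t := by fun_prop
    simpa using this.tendsto t
  have hright : ∀ᶠ t' in 𝓝[S ∩ Ioi t] t, (Γ t' - 1).det ≠ 0 ∧
      chartSign τ (Γ t') = chartSign τ (Γ t) +
        ((sigPos (velocityForm (Γ t) D) : ℤ) - sigNeg (velocityForm (Γ t) D)) := by
    refine eventually_chartSign_eq_add (ε := fun t' => t' - t) (D := D) ?_ ?_ (hsymp t ht) ?_
      (velocityForm_apply _ _) hreg hτ
    · refine tendsto_nhdsWithin_iff.2 ⟨hsub.mono_left nhdsWithin_le_nhds, ?_⟩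
      filter_upwards [self_mem_nhdsWithin] with t' h
      exact sub_pos.2 (mem_Ioi.1 h.2)
    · exact hslope.mono_left (nhdsWithin_mono _ fun x hx => ⟨hx.1, ne_of_gt hx.2⟩)
    · filter_upwards [self_mem_nhdsWithin] with t' h using hsymp _ h.1
  have hleft : ∀ᶠ t' in 𝓝[S ∩ Iio t] t, (Γ t' - 1).det ≠ 0 ∧
      chartSign τ (Γ t') = chartSign τ (Γ t) +
        ((sigPos (velocityForm (Γ t) (-D)) : ℤ) - sigNeg (velocityForm (Γ t) (-D))) := by
    refine eventually_chartSign_eq_add (ε := fun t' => t - t') (D := -D) ?_ ?_ (hsymp t ht) ?_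
      (velocityForm_apply _ _) ?_ hτ
    · refine tendsto_nhdsWithin_iff.2
        ⟨by simpa using (hsub.neg).mono_left nhdsWithin_le_nhds, ?_⟩
      filter_upwards [self_mem_nhdsWithin] with t' h
      exact sub_pos.2 (mem_Iio.1 h.2)
    · have := (hslope.mono_left (nhdsWithin_mono _ fun x (hx : x ∈ S ∩ Iio t) =>
        ⟨hx.1, ne_of_lt hx.2⟩)).neg
      refine this.congr fun x => ?_
      rw [← neg_smul, ← inv_neg, neg_sub]
    · filter_upwards [self_mem_nhdsWithin] with t' h using hsymp _ h.1
    · rw [velocityForm_neg, sigPos_neg, sigNeg_neg, add_comm]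
      exact hreg
  rw [velocityForm_neg, sigPos_neg, sigNeg_neg] at hleft
  rw [eventually_nhdsWithin_iff] at hright hleft ⊢
  filter_upwards [hright, hleft] with t' h1 h2 hS
  rcases lt_trichotomy t' t with h | rfl | h
  · obtain ⟨h3, h4⟩ := h2 ⟨hS, h⟩
    refine ⟨fun _ => h3, ?_⟩
    rw [h4, sign_neg (sub_neg.2 h)]
    simp only [SignType.coe_neg_one]
    ring
  · simp
  · obtain ⟨h3, h4⟩ := h1 ⟨hS, h⟩
    refine ⟨fun _ => h3, ?_⟩
    rw [h4, sign_pos (sub_pos.2 h)]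
    simp

lemma IsPreconnected.eq_of_eventually_eq {X : Type*} [TopologicalSpace X] {S : Set X}
    (hS : IsPreconnected S) {g : X → ℤ} (hg : ∀ t ∈ S, ∀ᶠ t' in 𝓝[S] t, g t' = g t) {x y : X}
    (hx : x ∈ S) (hy : y ∈ S) : g x = g y :=
  hS.constant (fun t ht => (tendsto_const_nhds.congr' ((hg t ht).mono fun _ h => h.symm) :
    Filter.Tendsto g (𝓝[S] t) (𝓝 (g t)))) hx hy

/-- On a connected set on which two local signature functions are both defined, their increments
agree. -/
lemma chartSign_sub_eq_of_isPreconnected {X : Type*} [TopologicalSpace X] {S : Set X}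
    (hS : IsPreconnected S) {Γ : X → Mat n} (hΓ : ContinuousOn Γ S)
    (hsymp : ∀ t ∈ S, Γ t ∈ Matrix.symplecticGroup (Fin n) ℝ) {τ τ' : ℝ}
    (hτ : ∀ t ∈ S, (chartMat τ (Γ t)).det ≠ 0) (hτ' : ∀ t ∈ S, (chartMat τ' (Γ t)).det ≠ 0)
    {x y : X} (hx : x ∈ S) (hy : y ∈ S) :
    chartSign τ (Γ y) - chartSign τ (Γ x) = chartSign τ' (Γ y) - chartSign τ' (Γ x) := by
  have := IsPreconnected.eq_of_eventually_eq hS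
    (g := fun t => chartSign τ (Γ t) - chartSign τ' (Γ t)) (fun t ht =>
      eventually_chartSign_sub_eq (hΓ t ht) (hsymp t ht)
        (by filter_upwards [self_mem_nhdsWithin] with t' h using hsymp _ h) (hτ t ht) (hτ' t ht))
    hx hy
  omega

/-- A primitive of the crossing count of a regular path. -/
lemma IsRegularPath.exists_primitive {T : ℝ} (hT : 0 < T) {Γ : ℝ → Mat n}
    (h : IsRegularPath T Γ) : ∃ m : ℝ → ℤ, ((m T - m 0 : ℤ) : ℝ) = 2 * crossingNumber T Γ ∧
      ∀ t ∈ Icc 0 T, ∀ τ, (chartMat τ (Γ t)).det ≠ 0 →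
        ∀ᶠ t' in 𝓝[Icc 0 T] t, m t' - chartSign τ (Γ t') = m t - chartSign τ (Γ t) := by
  classical
  set F := h.finite_crossings.toFinset with hF
  -- Each crossing makes the sum step from minus its signature through `0` to plus its signature.
  -- Over `[0, T]` an interior crossing adds twice its signature and an endpoint crossing adds it
  -- once, as `sign 0 = 0`: twice the Robbin-Salamon weights.
  refine ⟨fun t => ∑ c ∈ F, SignType.sign (t - c) * crossingSignature T Γ c, ?_, ?_⟩
  · rw [crossingNumber, finsum_mem_eq_finite_toFinset_sum _ h.finite_crossings, Finset.mul_sum]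
    push_cast
    rw [← Finset.sum_sub_distrib]
    refine Finset.sum_congr rfl fun c hc => ?_
    have hc' : c ∈ Icc 0 T := (h.finite_crossings.mem_toFinset.1 hc).1
    rw [← sub_mul, ← mul_assoc]
    congr 1
    rcases hc'.1.eq_or_lt with rfl | h0
    · simp [hT]
    · rcases hc'.2.eq_or_lt with rfl | h1
      · simp [hT]
      · rw [if_neg (by simp [h0.ne', h1.ne]), sign_pos (sub_pos.2 h1), sign_neg (by simpa using h0)]
        simp
        norm_num
  · intro t ht τ hτ
    have hother : ∀ᶠ t' in 𝓝[Icc 0 T] t, ∀ c ∈ F.erase t,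
        (SignType.sign (t' - c) : ℤ) = SignType.sign (t - c) := by
      refine (Filter.eventually_all_finset _).2 fun c hc => ?_
      refine Filter.Eventually.filter_mono nhdsWithin_le_nhds ?_
      rcases lt_or_gt_of_ne (Finset.ne_of_mem_erase hc) with h1 | h1
      · filter_upwards [lt_mem_nhds h1] with t' ht'
        rw [sign_pos (sub_pos.2 ht'), sign_pos (sub_pos.2 h1)]
      · filter_upwards [gt_mem_nhds h1] with t' ht'
        rw [sign_neg (sub_neg.2 ht'), sign_neg (sub_neg.2 h1)]
    by_cases hcr : t ∈ crossings T Γ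
    · have hder : HasMatDerivWithinAt Γ (velocity T Γ t) (Icc 0 T) t := fun i j =>
        (h.differentiable t hcr i j).hasDerivWithinAt
      filter_upwards [hother, eventually_chartSign_crossing ht h.symplectic hder
        (h.nondegenerate t hcr) hτ] with t' h1 h2
      have htF : t ∈ F := h.finite_crossings.mem_toFinset.2 hcr
      rw [← Finset.add_sum_erase F _ htF, ← Finset.add_sum_erase F _ htF,
        Finset.sum_congr rfl fun c hc => by rw [h1 c hc]]
      have h3 : chartSign τ (Γ t') = chartSign τ (Γ t) +
        SignType.sign (t' - t) * crossingSignature T Γ t := h2.2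
      rw [h3, sub_self, sign_zero, SignType.coe_zero]
      ring
    · have hdet : (Γ t - 1).det ≠ 0 := fun h0 => hcr ⟨ht, h0⟩
      have htF : t ∉ F := fun hh => hcr (h.finite_crossings.mem_toFinset.1 hh)
      rw [Finset.erase_eq_of_notMem htF] at hother
      filter_upwards [hother, eventually_chartSign_eq (h.continuousOn t ht) (h.symplectic t ht) hτ
        hdet] with t' h1 h2
      rw [Finset.sum_congr rfl fun c hc => by rw [h1 c hc], h2]

/-- On a subinterval with a single valid parameter `τ i`, the functions `m` and `chartSign` differ
by a constant, so the increments agree and telescope. The sum therefore does not depend on the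
parameters. -/
lemma IsRegularPath.sum_chartSign_eq {T : ℝ} {Γ : ℝ → Mat n} {m : ℝ → ℤ}
    (hm : ∀ t ∈ Icc 0 T, ∀ τ, (chartMat τ (Γ t)).det ≠ 0 →
        ∀ᶠ t' in 𝓝[Icc 0 T] t, m t' - chartSign τ (Γ t') = m t - chartSign τ (Γ t))
    {N : ℕ} {p : ℕ → ℝ} (hp : Monotone p) (h0 : ∀ i, p i ∈ Icc 0 T) {τ : ℕ → ℝ}
    (hτ : ∀ i < N, ∀ t ∈ Icc (p i) (p (i + 1)), (chartMat (τ i) (Γ t)).det ≠ 0) :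
    ∑ i ∈ Finset.range N, (chartSign (τ i) (Γ (p (i + 1))) - chartSign (τ i) (Γ (p i)))
      = m (p N) - m (p 0) := by
  rw [← Finset.sum_range_sub (fun i => m (p i))]
  refine Finset.sum_congr rfl fun i hi => ?_
  have hsub : Icc (p i) (p (i + 1)) ⊆ Icc 0 T := Icc_subset_Icc (h0 i).1 (h0 (i + 1)).2
  have hle : p i ≤ p (i + 1) := hp (Nat.le_succ i)
  have := IsPreconnected.eq_of_eventually_eq (isPreconnected_Icc (a := p i) (b := p (i + 1)))
    (g := fun t => m t - chartSign (τ i) (Γ t)) (fun t ht =>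
      (hm t (hsub ht) _ (hτ i (Finset.mem_range.1 hi) t ht)).filter_mono
        (nhdsWithin_mono _ hsub)) (left_mem_Icc.2 hle) (right_mem_Icc.2 hle)
  omega

/-- Regular paths that are homotopic with fixed endpoints have the same crossing number. -/
theorem crossingNumber_eq_of_homotopic {T : ℝ} (hT : 0 < T) {Γ₀ Γ₁ : ℝ → Mat n}
    (h₀ : IsRegularPath T Γ₀) (h₁ : IsRegularPath T Γ₁) (h : HomotopicRelEndpoints T Γ₀ Γ₁) :
    crossingNumber T Γ₀ = crossingNumber T Γ₁ := by
  obtain ⟨H, hH, hsymp, hH01, hHends⟩ := h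
  set R : Set (ℝ × ℝ) := Icc (0 : ℝ) 1 ×ˢ Icc 0 T with hR
  have hRc : IsCompact R := isCompact_Icc.prod isCompact_Icc
  -- a Lebesgue number of the cover of `R` by the preimages of the chart domains
  obtain ⟨δ, hδ, hleb⟩ : ∃ δ > 0, ∀ p ∈ R, ∃ τ : ℝ, ∀ q ∈ R, dist q p < δ →
      (chartMat τ (H q)).det ≠ 0 := by
    have hopen : ∀ τ : ℝ, ∃ U : Set (ℝ × ℝ), IsOpen U ∧
        {q | (chartMat τ (H q)).det ≠ 0} ∩ R = U ∩ R := by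
      intro τ
      exact continuousOn_iff'.1 ((continuous_chartMat τ).matrix_det.comp_continuousOn hH) {0}ᶜ
        isOpen_compl_singleton
    choose U hU hUR using hopen
    obtain ⟨δ, hδ, hh⟩ := lebesgue_number_lemma_of_metric hRc hU (fun p hp => by
      obtain ⟨τ, hτ⟩ := exists_chartMat_det_ne_zero (hsymp p hp)
      exact mem_iUnion.2 ⟨τ, ((hUR τ).subset ⟨hτ, hp⟩).1⟩)
    refine ⟨δ, hδ, fun p hp => ?_⟩
    obtain ⟨τ, hτ⟩ := hh p hp
    exact ⟨τ, fun q hq hd => ((hUR τ).superset ⟨hτ hd, hq⟩).1⟩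
  obtain ⟨N, hN0, hN⟩ : ∃ N : ℕ, 0 < N ∧ max 1 T / N < δ := by
    obtain ⟨N, hN⟩ := exists_nat_gt (max 1 T / δ)
    have hNpos : (0 : ℝ) < N := lt_of_le_of_lt (by positivity) hN
    refine ⟨N, by exact_mod_cast hNpos, ?_⟩
    rw [div_lt_iff₀ hδ] at hN
    rw [div_lt_iff₀ hNpos]
    linarith
  have hNR : (0 : ℝ) < N := by exact_mod_cast hN0
  set s : ℕ → ℝ := fun j => min (j / N) 1 with hs
  set p : ℕ → ℝ := fun i => min (i * T / N) T with hp
  have hs01 : ∀ j, s j ∈ Icc (0 : ℝ) 1 := fun j =>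
    ⟨le_min (by positivity) zero_le_one, min_le_right _ _⟩
  have hp01 : ∀ i, p i ∈ Icc 0 T := fun i => ⟨le_min (by positivity) hT.le, min_le_right _ _⟩
  have hsmono : Monotone s := fun a b hab =>
    min_le_min_right _ (by gcongr)
  have hpmono : Monotone p := fun a b hab =>
    min_le_min_right _ (by gcongr)
  have hsstep : ∀ j, s (j + 1) ≤ s j + max 1 T / N := by
    intro j
    have h1 : (1 : ℝ) / N ≤ max 1 T / N := by gcongr; exact le_max_left _ _
    simp only [hs]
    push_cast
    rw [add_div]
    refine le_trans ?_ (add_le_add_right h1 _)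
    rcases min_cases ((j : ℝ) / N) 1 with ⟨h, _⟩ | ⟨h, _⟩ <;> rw [h]
    · exact min_le_left _ _
    · exact (min_le_right _ _).trans (by have : (0:ℝ) ≤ 1 / N := by positivity
                                         linarith)
  have hpstep : ∀ j, p (j + 1) ≤ p j + max 1 T / N := by
    intro j
    have h1 : T / N ≤ max 1 T / N := by gcongr; exact le_max_right _ _
    simp only [hp]
    push_cast
    rw [add_mul, one_mul, add_div]
    refine le_trans ?_ (add_le_add_right h1 _)
    rcases min_cases ((j : ℝ) * T / N) T with ⟨h, _⟩ | ⟨h, _⟩ <;> rw [h]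
    · exact min_le_left _ _
    · exact (min_le_right _ _).trans (by have : (0:ℝ) ≤ T / N := by positivity
                                         linarith)
  have hs0 : s 0 = 0 := by simp [hs]
  have hp0 : p 0 = 0 := by simp [hp, hT.le]
  have hsN : s N = 1 := by simp [hs, hNR.ne']
  have hpN : p N = T := by simp only [hp]; rw [mul_div_cancel_left₀ _ hNR.ne', min_self]
  -- One parameter for each cell of the grid, valid on the whole cell because the mesh is below the
  -- Lebesgue number.
  choose! τ hτ using fun (ji : ℕ × ℕ) => hleb (s ji.1, p ji.2) ⟨hs01 _, hp01 _⟩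
  have hcell : ∀ j i, ∀ a ∈ Icc (s j) (s (j + 1)), ∀ b ∈ Icc (p i) (p (i + 1)),
      (chartMat (τ (j, i)) (H (a, b))).det ≠ 0 := by
    intro j i a ha b hb
    refine hτ (j, i) (a, b) ⟨⟨(hs01 j).1.trans ha.1, ha.2.trans (hs01 _).2⟩,
      ⟨(hp01 i).1.trans hb.1, hb.2.trans (hp01 _).2⟩⟩ (lt_of_le_of_lt ?_ hN)
    rw [Prod.dist_eq]
    refine max_le ?_ ?_
    · rw [Real.dist_eq, abs_of_nonneg (sub_nonneg.2 ha.1)]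
      linarith [ha.2, hsstep j]
    · rw [Real.dist_eq, abs_of_nonneg (sub_nonneg.2 hb.1)]
      linarith [hb.2, hpstep i]
  have hsj : ∀ j, s j ≤ s (j + 1) := fun j => hsmono (Nat.le_succ j)
  have hpj : ∀ j, p j ≤ p (j + 1) := fun j => hpmono (Nat.le_succ j)
  -- increments along a horizontal edge shared by two cells
  have hhor : ∀ j i, chartSign (τ (j, i)) (H (s (j + 1), p (i + 1)))
      - chartSign (τ (j, i)) (H (s (j + 1), p i)) =
      chartSign (τ (j + 1, i)) (H (s (j + 1), p (i + 1)))
      - chartSign (τ (j + 1, i)) (H (s (j + 1), p i)) := by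
    intro j i
    have hmem : ∀ t ∈ Icc (p i) (p (i + 1)), (s (j + 1), t) ∈ R := fun t ht =>
      ⟨hs01 _, ⟨(hp01 i).1.trans ht.1, ht.2.trans (hp01 _).2⟩⟩
    exact chartSign_sub_eq_of_isPreconnected (isPreconnected_Icc (a := p i) (b := p (i + 1)))
      (Γ := fun t => H (s (j + 1), t)) (hH.comp (by fun_prop) hmem)
      (fun t ht => hsymp _ (hmem t ht))
      (fun t ht => hcell j i _ ⟨hsj j, le_rfl⟩ t ht)
      (fun t ht => hcell (j + 1) i _ ⟨le_rfl, hsj (j + 1)⟩ t ht)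
      (left_mem_Icc.2 (hpj i)) (right_mem_Icc.2 (hpj i))
  -- The same along an edge shared by two cells that are neighbours in the time direction.
  have hver : ∀ j i, chartSign (τ (j, i)) (H (s (j + 1), p (i + 1)))
      - chartSign (τ (j, i)) (H (s j, p (i + 1))) =
      chartSign (τ (j, i + 1)) (H (s (j + 1), p (i + 1)))
      - chartSign (τ (j, i + 1)) (H (s j, p (i + 1))) := by
    intro j i
    have hmem : ∀ t ∈ Icc (s j) (s (j + 1)), (t, p (i + 1)) ∈ R := fun t ht =>
      ⟨⟨(hs01 j).1.trans ht.1, ht.2.trans (hs01 _).2⟩, hp01 _⟩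
    exact chartSign_sub_eq_of_isPreconnected (isPreconnected_Icc (a := s j) (b := s (j + 1)))
      (Γ := fun t => H (t, p (i + 1))) (hH.comp (by fun_prop) hmem)
      (fun t ht => hsymp _ (hmem t ht))
      (fun t ht => hcell j i t ht _ ⟨hpj i, le_rfl⟩)
      (fun t ht => hcell j (i + 1) t ht _ ⟨le_rfl, hpj (i + 1)⟩)
      (left_mem_Icc.2 (hsj j)) (right_mem_Icc.2 (hsj j))
  set lower : ℕ → ℤ := fun j => ∑ i ∈ Finset.range N,
    (chartSign (τ (j, i)) (H (s j, p (i + 1))) - chartSign (τ (j, i)) (H (s j, p i))) with hlower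
  set upper : ℕ → ℤ := fun j => ∑ i ∈ Finset.range N,
    (chartSign (τ (j, i)) (H (s (j + 1), p (i + 1)))
      - chartSign (τ (j, i)) (H (s (j + 1), p i))) with hupper
  -- The top of one row and the bottom of the next are the same edges, measured with the parameters
  -- of different cells.
  have hUL : ∀ j, upper j = lower (j + 1) := fun j =>
    Finset.sum_congr rfl fun i _ => hhor j i
  -- The increments around a cell, taken with its own parameter, cancel. Since those on inner
  -- vertical edges match between neighbours, the difference of top and bottom telescopes to the two
  -- outer vertical edges, where the homotopy is constant.
  have hLU : ∀ j, upper j = lower j := by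
    intro j
    rw [← sub_eq_zero, hlower, hupper]
    simp only
    rw [← Finset.sum_sub_distrib]
    obtain ⟨k, rfl⟩ : ∃ k, N = k + 1 := ⟨N - 1, by omega⟩
    have h1 : ∀ i, (chartSign (τ (j, i)) (H (s (j + 1), p (i + 1)))
      - chartSign (τ (j, i)) (H (s (j + 1), p i))) -
      (chartSign (τ (j, i)) (H (s j, p (i + 1))) - chartSign (τ (j, i)) (H (s j, p i))) =
      (chartSign (τ (j, i + 1)) (H (s (j + 1), p (i + 1)))
        - chartSign (τ (j, i + 1)) (H (s j, p (i + 1)))) -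
      (chartSign (τ (j, i)) (H (s (j + 1), p i)) - chartSign (τ (j, i)) (H (s j, p i))) := by
      intro i; have := hver j i; omega
    rw [Finset.sum_congr rfl fun i _ => h1 i, Finset.sum_range_sub
      (fun i => chartSign (τ (j, i)) (H (s (j + 1), p i)) - chartSign (τ (j, i)) (H (s j, p i)))]
    rw [hp0, hpN, (hHends _ (hs01 (j + 1))).1, (hHends _ (hs01 j)).1,
      (hHends _ (hs01 (j + 1))).2, (hHends _ (hs01 j)).2]
    ring
  have hall : ∀ j, lower j = lower 0 := by
    intro j
    induction j with
    | zero => rfl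
    | succ j ih => rw [← hUL, hLU, ih]
  obtain ⟨m₀, hm₀, hm₀'⟩ := h₀.exists_primitive hT
  obtain ⟨m₁, hm₁, hm₁'⟩ := h₁.exists_primitive hT
  have hIcc : ∀ i, ∀ t ∈ Icc (p i) (p (i + 1)), t ∈ Icc 0 T := fun i t ht =>
    ⟨(hp01 i).1.trans ht.1, ht.2.trans (hp01 _).2⟩
  have e0 : lower 0 = m₀ T - m₀ 0 := by
    have := IsRegularPath.sum_chartSign_eq hm₀' hpmono hp01 (N := N) (τ := fun i => τ (0, i))
      fun i _ t ht => by
        have := hcell 0 i _ ⟨le_rfl, hsj 0⟩ t ht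
        rwa [hs0, (hH01 t (hIcc i t ht)).1] at this
    rw [hp0, hpN] at this
    rw [← this, hlower]
    refine Finset.sum_congr rfl fun i _ => ?_
    rw [hs0, (hH01 _ (hp01 _)).1, (hH01 _ (hp01 _)).1]
  have e1 : lower N = m₁ T - m₁ 0 := by
    have := IsRegularPath.sum_chartSign_eq hm₁' hpmono hp01 (N := N) (τ := fun i => τ (N, i))
      fun i _ t ht => by
        have := hcell N i _ ⟨le_rfl, hsj N⟩ t ht
        rwa [hsN, (hH01 t (hIcc i t ht)).2] at this
    rw [hp0, hpN] at this
    rw [← this, hlower]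
    refine Finset.sum_congr rfl fun i _ => ?_
    rw [hsN, (hH01 _ (hp01 _)).2, (hH01 _ (hp01 _)).2]
  rw [← e0] at hm₀
  rw [← e1, hall N] at hm₁
  linarith

end CZ

/-! ### Homotopies and regular paths on intervals -/

namespace CZ

variable {n : ℕ}

/-- Homotopy with fixed endpoints through symplectic paths on `[a, b]`. -/
def HomotopicOn (a b : ℝ) (Γ₀ Γ₁ : ℝ → Mat n) : Prop :=
  ∃ H : ℝ × ℝ → Mat n,
    ContinuousOn H (Icc 0 1 ×ˢ Icc a b) ∧
    (∀ p ∈ Icc (0 : ℝ) 1 ×ˢ Icc a b, H p ∈ Matrix.symplecticGroup (Fin n) ℝ) ∧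
    (∀ t ∈ Icc a b, H (0, t) = Γ₀ t ∧ H (1, t) = Γ₁ t) ∧
    (∀ s ∈ Icc (0 : ℝ) 1, H (s, a) = Γ₀ a ∧ H (s, b) = Γ₀ b)

lemma HomotopicOn.left_eq {a b : ℝ} (hab : a ≤ b) {Γ₀ Γ₁ : ℝ → Mat n}
    (h : HomotopicOn a b Γ₀ Γ₁) : Γ₁ a = Γ₀ a := by
  obtain ⟨H, -, -, h1, h2⟩ := h
  rw [← (h1 a (left_mem_Icc.2 hab)).2, (h2 1 (by simp)).1]

lemma HomotopicOn.right_eq {a b : ℝ} (hab : a ≤ b) {Γ₀ Γ₁ : ℝ → Mat n}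
    (h : HomotopicOn a b Γ₀ Γ₁) : Γ₁ b = Γ₀ b := by
  obtain ⟨H, -, -, h1, h2⟩ := h
  rw [← (h1 b (right_mem_Icc.2 hab)).2, (h2 1 (by simp)).2]

lemma HomotopicOn.congr {a b : ℝ} (hab : a ≤ b) {Γ₀ Γ₁ Γ₀' Γ₁' : ℝ → Mat n}
    (h : HomotopicOn a b Γ₀ Γ₁) (h₀ : ∀ t ∈ Icc a b, Γ₀' t = Γ₀ t)
    (h₁ : ∀ t ∈ Icc a b, Γ₁' t = Γ₁ t) : HomotopicOn a b Γ₀' Γ₁' := by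
  obtain ⟨H, hc, hs, h1, h2⟩ := h
  refine ⟨H, hc, hs, fun t ht => ?_, fun s hs => ?_⟩
  · rw [h₀ t ht, h₁ t ht]; exact h1 t ht
  · rw [h₀ a (left_mem_Icc.2 hab), h₀ b (right_mem_Icc.2 hab)]; exact h2 s hs

lemma HomotopicOn.symm {a b : ℝ} (hab : a ≤ b) {Γ₀ Γ₁ : ℝ → Mat n}
    (h : HomotopicOn a b Γ₀ Γ₁) : HomotopicOn a b Γ₁ Γ₀ := by
  have hl := h.left_eq hab
  have hr := h.right_eq hab
  obtain ⟨H, hc, hs, h1, h2⟩ := h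
  have hmaps : MapsTo (fun p : ℝ × ℝ => (1 - p.1, p.2)) (Icc 0 1 ×ˢ Icc a b)
      (Icc 0 1 ×ˢ Icc a b) := fun p hp =>
    ⟨⟨by linarith [hp.1.2], by linarith [hp.1.1]⟩, hp.2⟩
  refine ⟨fun p => H (1 - p.1, p.2), hc.comp (by fun_prop) hmaps, fun p hp => hs _ (hmaps hp),
    fun t ht => by simpa using (h1 t ht).symm, fun s hs => ?_⟩
  rw [hl, hr]
  exact h2 _ ⟨by linarith [hs.2], by linarith [hs.1]⟩

lemma HomotopicOn.trans {a b : ℝ} (hab : a ≤ b) {Γ₀ Γ₁ Γ₂ : ℝ → Mat n}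
    (h : HomotopicOn a b Γ₀ Γ₁) (h' : HomotopicOn a b Γ₁ Γ₂) : HomotopicOn a b Γ₀ Γ₂ := by
  have hl := h.left_eq hab
  have hr := h.right_eq hab
  obtain ⟨H, hc, hs, h1, h2⟩ := h
  obtain ⟨H', hc', hs', h1', h2'⟩ := h'
  have hm : MapsTo (fun p : ℝ × ℝ => (2 * p.1, p.2)) (Icc 0 (1 / 2) ×ˢ Icc a b)
      (Icc 0 1 ×ˢ Icc a b) := fun p hp =>
    ⟨⟨by linarith [hp.1.1], by linarith [hp.1.2]⟩, hp.2⟩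
  have hm' : MapsTo (fun p : ℝ × ℝ => (2 * p.1 - 1, p.2)) (Icc (1 / 2) 1 ×ˢ Icc a b)
      (Icc 0 1 ×ˢ Icc a b) := fun p hp =>
    ⟨⟨by linarith [hp.1.1], by linarith [hp.1.2]⟩, hp.2⟩
  have hunion : (Icc (0 : ℝ) 1 ×ˢ Icc a b) = (Icc 0 (1 / 2) ×ˢ Icc a b) ∪ (Icc (1 / 2) 1 ×ˢ Icc a b) := by
    rw [← union_prod, Icc_union_Icc_eq_Icc (by norm_num) (by norm_num)]
  set K : ℝ × ℝ → Mat n := fun p => if p.1 ≤ 1 / 2 then H (2 * p.1, p.2) else H' (2 * p.1 - 1, p.2)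
  have hK1 : ∀ p ∈ Icc (0 : ℝ) (1 / 2) ×ˢ Icc a b, K p = H (2 * p.1, p.2) := fun p hp =>
    if_pos hp.1.2
  have hK2 : ∀ p ∈ Icc (1 / 2 : ℝ) 1 ×ˢ Icc a b, K p = H' (2 * p.1 - 1, p.2) := by
    intro p hp
    by_cases h : p.1 ≤ 1 / 2
    · have h3 : p.1 = 1 / 2 := le_antisymm h hp.1.1
      simp only [K, if_pos h, h3]
      norm_num
      rw [(h1 _ hp.2).2, (h1' _ hp.2).1]
    · exact if_neg h
  refine ⟨K, ?_, ?_, fun t ht => ⟨?_, ?_⟩, fun s hs => ?_⟩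
  · rw [hunion]
    exact ContinuousOn.union_of_isClosed ((hc.comp (by fun_prop) hm).congr hK1)
      ((hc'.comp (by fun_prop) hm').congr hK2) (isClosed_Icc.prod isClosed_Icc)
      (isClosed_Icc.prod isClosed_Icc)
  · rw [hunion]
    rintro p (hp | hp)
    · rw [hK1 p hp]; exact hs _ (hm hp)
    · rw [hK2 p hp]; exact hs' _ (hm' hp)
  · rw [hK1 (0, t) ⟨by simp, ht⟩]; simpa using (h1 t ht).1
  · rw [hK2 (1, t) ⟨by norm_num, ht⟩]
    have := (h1' t ht).2
    norm_num
    exact this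
  · rcases le_total s (1 / 2) with h | h
    · rw [hK1 (s, a) ⟨⟨hs.1, h⟩, left_mem_Icc.2 hab⟩, hK1 (s, b) ⟨⟨hs.1, h⟩, right_mem_Icc.2 hab⟩]
      exact h2 _ ⟨by linarith [hs.1], by linarith⟩
    · rw [hK2 (s, a) ⟨⟨h, hs.2⟩, left_mem_Icc.2 hab⟩, hK2 (s, b) ⟨⟨h, hs.2⟩, right_mem_Icc.2 hab⟩,
        ← hl, ← hr]
      exact h2' _ ⟨by linarith, by linarith [hs.2]⟩

/-- Gluing of homotopies on adjacent intervals. -/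
lemma HomotopicOn.glue {a b c : ℝ} (hab : a ≤ b) (hbc : b ≤ c) {Γ Γ' Γ'' : ℝ → Mat n}
    (h : HomotopicOn a b Γ Γ') (h' : HomotopicOn b c Γ Γ'') :
    HomotopicOn a c Γ (fun t => if t ≤ b then Γ' t else Γ'' t) := by
  have hl := h'.left_eq hbc
  have hr := h.right_eq hab
  obtain ⟨H, hc, hs, h1, h2⟩ := h
  obtain ⟨H', hc', hs', h1', h2'⟩ := h'
  have hunion : (Icc (0 : ℝ) 1 ×ˢ Icc a c) = (Icc 0 1 ×ˢ Icc a b) ∪ (Icc 0 1 ×ˢ Icc b c) := by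
    rw [← prod_union, Icc_union_Icc_eq_Icc hab hbc]
  set K : ℝ × ℝ → Mat n := fun p => if p.2 ≤ b then H p else H' p
  have hK1 : ∀ p ∈ Icc (0 : ℝ) 1 ×ˢ Icc a b, K p = H p := fun p hp => if_pos hp.2.2
  have hK2 : ∀ p ∈ Icc (0 : ℝ) 1 ×ˢ Icc b c, K p = H' p := by
    rintro ⟨s, t⟩ hp
    by_cases h : t ≤ b
    · obtain rfl : t = b := le_antisymm h hp.2.1
      simp only [K, le_refl, if_true]
      rw [(h2 s hp.1).2, (h2' s hp.1).1]
    · exact if_neg h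
  refine ⟨K, ?_, ?_, fun t ht => ?_, fun s hs => ⟨?_, ?_⟩⟩
  · rw [hunion]
    exact ContinuousOn.union_of_isClosed (hc.congr hK1) (hc'.congr hK2)
      (isClosed_Icc.prod isClosed_Icc) (isClosed_Icc.prod isClosed_Icc)
  · rw [hunion]
    rintro p (hp | hp)
    · rw [hK1 p hp]; exact hs _ hp
    · rw [hK2 p hp]; exact hs' _ hp
  · by_cases h : t ≤ b
    · simp only [K, if_pos h]; exact h1 t ⟨ht.1, h⟩
    · simp only [K, if_neg h]; exact h1' t ⟨(not_le.1 h).le, ht.2⟩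
  · rw [hK1 _ ⟨hs, left_mem_Icc.2 hab⟩, (h2 s hs).1]
  · rw [hK2 _ ⟨hs, right_mem_Icc.2 hbc⟩, (h2' s hs).2]

/-- A symplectic path on `[a, b]` with regular crossings that is differentiable at its crossings
and at both endpoints. -/
structure IsGoodPath (a b : ℝ) (Γ : ℝ → Mat n) : Prop where
  continuousOn : ContinuousOn Γ (Icc a b)
  symplectic : ∀ t ∈ Icc a b, Γ t ∈ Matrix.symplecticGroup (Fin n) ℝ
  regular : ∀ t ∈ Icc a b, ((Γ t - 1).det = 0 ∨ t = a ∨ t = b) →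
    ∃ D, HasMatDerivWithinAt Γ D (Icc a b) t ∧ IsRegularVelocity (Γ t) D

/-- Off the Maslov cycle the form lives on the zero space, so nondegeneracy is vacuous. -/
lemma isRegularVelocity_of_det_ne_zero {A : Mat n} (hA : (A - 1).det ≠ 0) (D : Mat n) :
    IsRegularVelocity A D := by
  have h0 : Module.finrank ℝ (LinearMap.ker (Matrix.toLin' (A - 1))) = 0 := by
    rw [Submodule.finrank_eq_zero, LinearMap.ker_eq_bot']
    intro u hu
    by_contra h0
    exact hA (Matrix.exists_mulVec_eq_zero_iff.1 ⟨u, h0, by rwa [Matrix.toLin'_apply] at hu⟩)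
  have h1 := sigPos_le_finrank (velocityForm A D)
  have h2 := sigPos_le_finrank (-velocityForm A D)
  rw [sigPos_neg] at h2
  rw [IsRegularVelocity]
  omega

lemma IsGoodPath.congr {a b : ℝ} {Γ Γ' : ℝ → Mat n} (h : IsGoodPath a b Γ)
    (h' : ∀ t ∈ Icc a b, Γ' t = Γ t) : IsGoodPath a b Γ' where
  continuousOn := h.continuousOn.congr h'
  symplectic t ht := by rw [h' t ht]; exact h.symplectic t ht
  regular t ht hd := by
    rw [h' t ht] at hd ⊢
    obtain ⟨D, hD, hreg⟩ := h.regular t ht hd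
    exact ⟨D, fun i j => (hD i j).congr (fun s hs => by rw [h' s hs]) (by rw [h' t ht]), hreg⟩

/-- The one-sided velocities at `b` need not match. This is harmless because `b` is neither a
crossing nor an end of the glued path, and a good path is differentiable only where one of these
happens. -/
lemma IsGoodPath.glue {a b c : ℝ} (hab : a < b) (hbc : b < c) {Γ : ℝ → Mat n}
    (h : IsGoodPath a b Γ) (h' : IsGoodPath b c Γ) (hb : (Γ b - 1).det ≠ 0) :
    IsGoodPath a c Γ where
  continuousOn := by
    rw [← Icc_union_Icc_eq_Icc hab.le hbc.le]
    exact h.continuousOn.union_of_isClosed h'.continuousOn isClosed_Icc isClosed_Icc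
  symplectic := by
    rw [← Icc_union_Icc_eq_Icc hab.le hbc.le]
    rintro t (ht | ht)
    exacts [h.symplectic t ht, h'.symplectic t ht]
  regular t ht hd := by
    rcases lt_trichotomy t b with htb | rfl | htb
    · obtain ⟨D, hD, hreg⟩ := h.regular t ⟨ht.1, htb.le⟩ (by
        rcases hd with hd | hd | hd
        · exact Or.inl hd
        · exact Or.inr (Or.inl hd)
        · linarith)
      refine ⟨D, fun i j => (hD i j).mono_of_mem_nhdsWithin ?_, hreg⟩
      filter_upwards [self_mem_nhdsWithin, mem_nhdsWithin_of_mem_nhds (Iio_mem_nhds htb)]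
        with s hs1 hs2 using ⟨hs1.1, (mem_Iio.1 hs2).le⟩
    · rcases hd with hd | hd | hd
      · exact absurd hd hb
      · exact absurd hd hab.ne'
      · exact absurd hd hbc.ne
    · obtain ⟨D, hD, hreg⟩ := h'.regular t ⟨htb.le, ht.2⟩ (by
        rcases hd with hd | hd | hd
        · exact Or.inl hd
        · linarith
        · exact Or.inr (Or.inr hd))
      refine ⟨D, fun i j => (hD i j).mono_of_mem_nhdsWithin ?_, hreg⟩
      filter_upwards [self_mem_nhdsWithin, mem_nhdsWithin_of_mem_nhds (Ioi_mem_nhds htb)]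
        with s hs1 hs2 using ⟨(mem_Ioi.1 hs2).le, hs1.2⟩

/-- Regular crossings are isolated by `eventually_chartSign_crossing`, and being a non-crossing is
an open condition; compactness of the interval leaves finitely many. -/
lemma finite_crossings_of_regular {a b : ℝ} {Γ : ℝ → Mat n} (hc : ContinuousOn Γ (Icc a b))
    (hs : ∀ t ∈ Icc a b, Γ t ∈ Matrix.symplecticGroup (Fin n) ℝ)
    (hr : ∀ t ∈ Icc a b, (Γ t - 1).det = 0 →
      ∃ D, HasMatDerivWithinAt Γ D (Icc a b) t ∧ IsRegularVelocity (Γ t) D) :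
    {t | t ∈ Icc a b ∧ (Γ t - 1).det = 0}.Finite := by
  set C := {t | t ∈ Icc a b ∧ (Γ t - 1).det = 0}
  have key : ∀ t ∈ Icc a b, ∃ U ∈ 𝓝[Icc a b] t, (U ∩ C).Finite := by
    intro t ht
    have : ∀ᶠ t' in 𝓝[Icc a b] t, t' ≠ t → (Γ t' - 1).det ≠ 0 := by
      by_cases h0 : (Γ t - 1).det = 0
      · obtain ⟨D, hD, hreg⟩ := hr t ht h0
        obtain ⟨τ, hτ⟩ := exists_chartMat_det_ne_zero (hs t ht)
        exact (eventually_chartSign_crossing ht hs hD hreg hτ).mono fun t' h => h.1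
      · have hcont : Continuous fun A : Mat n => (A - 1).det := by fun_prop
        exact ((hcont.continuousAt.comp_continuousWithinAt (hc t ht)).eventually_ne h0).mono
          fun t' h _ => h
    refine ⟨_, this, (finite_singleton t).subset ?_⟩
    rintro t' ⟨h1, h2⟩
    by_contra hne
    exact h1 hne h2.2
  have := isCompact_Icc (a := a) (b := b) |>.induction_on (p := fun s => (s ∩ C).Finite) (by simp)
    (fun s t hst ht => ht.subset (inter_subset_inter_left _ hst))
    (fun s t hs ht => by rw [union_inter_distrib_right]; exact hs.union ht) key
  exact this.subset fun t ht => ⟨ht.1, ht⟩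

lemma IsGoodPath.finite_crossings {a b : ℝ} {Γ : ℝ → Mat n} (h : IsGoodPath a b Γ) :
    {t | t ∈ Icc a b ∧ (Γ t - 1).det = 0}.Finite :=
  finite_crossings_of_regular h.continuousOn h.symplectic fun t ht h0 => h.regular t ht (Or.inl h0)

lemma velocity_eq {T : ℝ} (hT : 0 < T) {Γ : ℝ → Mat n} {t : ℝ} (ht : t ∈ Icc 0 T) {D : Mat n}
    (hD : HasMatDerivWithinAt Γ D (Icc 0 T) t) : velocity T Γ t = D := by
  ext i j
  exact (hD i j).derivWithin (uniqueDiffOn_Icc hT t ht)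

lemma isRegularPath_of_regular {T : ℝ} (hT : 0 < T) {Γ : ℝ → Mat n}
    (hc : ContinuousOn Γ (Icc 0 T))
    (hs : ∀ t ∈ Icc 0 T, Γ t ∈ Matrix.symplecticGroup (Fin n) ℝ)
    (hr : ∀ t ∈ Icc 0 T, (Γ t - 1).det = 0 →
      ∃ D, HasMatDerivWithinAt Γ D (Icc 0 T) t ∧ IsRegularVelocity (Γ t) D) :
    IsRegularPath T Γ where
  continuousOn := hc
  symplectic := hs
  finite_crossings := finite_crossings_of_regular hc hs hr
  differentiable t ht i j := by
    obtain ⟨D, hD, -⟩ := hr t ht.1 ht.2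
    exact (hD i j).differentiableWithinAt
  nondegenerate t ht := by
    obtain ⟨D, hD, hreg⟩ := hr t ht.1 ht.2
    rw [← velocity_eq hT ht.1 hD] at hreg
    exact hreg

lemma IsGoodPath.isRegularPath {T : ℝ} (hT : 0 < T) {Γ : ℝ → Mat n} (h : IsGoodPath 0 T Γ) :
    IsRegularPath T Γ :=
  isRegularPath_of_regular hT h.continuousOn h.symplectic fun t ht h0 =>
    h.regular t ht (Or.inl h0)

/-- The index of a symplectic path is the crossing number of every homotopic regular path. -/
theorem index_eq_crossingNumber {T : ℝ} (hT : 0 < T) {Γ Γ' : ℝ → Mat n} (h' : IsRegularPath T Γ')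
    (h : HomotopicRelEndpoints T Γ Γ') : index T Γ = crossingNumber T Γ' := by
  obtain ⟨Γ'', h1, h2, h3⟩ := Classical.epsilon_spec (p := fun c : ℝ =>
    ∃ Γ' : ℝ → Mat n, IsRegularPath T Γ' ∧ HomotopicRelEndpoints T Γ Γ' ∧
      crossingNumber T Γ' = c) ⟨_, Γ', h', h, rfl⟩
  rw [index, ← h3]
  exact crossingNumber_eq_of_homotopic hT h1 h'
    (HomotopicOn.trans hT.le (HomotopicOn.symm hT.le h2) h)

end CZ

/-! ### Existence of homotopic regular paths -/

namespace CZ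

variable {n : ℕ}

/-- The Cayley transform. -/
def cay (Y : Mat n) : Mat n := (1 + Y) * (1 - Y)⁻¹

/-- `Y` lies in the Lie algebra of the symplectic group and the symmetric matrix `J Y` has
operator norm less than `ρ`. -/
structure IsSmallHam (ρ : ℝ) (Y : Mat n) : Prop where
  symm : (Matrix.J (Fin n) ℝ * Y)ᵀ = Matrix.J (Fin n) ℝ * Y
  bound : ∀ u : Fin n ⊕ Fin n → ℝ, u ≠ 0 →
    |matForm (Matrix.J (Fin n) ℝ * Y) u| < ρ * (u ⬝ᵥ u)

lemma dotProduct_self_pos {ι : Type*} [Fintype ι] {u : ι → ℝ} (hu : u ≠ 0) : 0 < u ⬝ᵥ u :=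
  lt_of_le_of_ne (Finset.sum_nonneg fun _ _ => mul_self_nonneg _)
    fun h => hu (dotProduct_self_eq_zero.1 h.symm)

lemma IsSmallHam.mono {ρ ρ' : ℝ} (h : ρ ≤ ρ') {Y : Mat n} (hY : IsSmallHam ρ Y) :
    IsSmallHam ρ' Y :=
  ⟨hY.symm, fun u hu => (hY.bound u hu).trans_le (by
    have := dotProduct_self_pos hu; gcongr)⟩

/-- The conditions bound the absolute value of an expression linear in `Y`, hence are convex.
Straight-line homotopies in a Cayley chart therefore stay inside it. -/
lemma IsSmallHam.combo {ρ : ℝ} {Y Z : Mat n} (hY : IsSmallHam ρ Y) (hZ : IsSmallHam ρ Z) {s : ℝ}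
    (hs : s ∈ Icc (0 : ℝ) 1) : IsSmallHam ρ ((1 - s) • Y + s • Z) := by
  refine ⟨?_, fun u hu => ?_⟩
  · rw [mul_add, Matrix.mul_smul, Matrix.mul_smul, Matrix.transpose_add, Matrix.transpose_smul,
      Matrix.transpose_smul, hY.symm, hZ.symm]
  · have e : matForm (Matrix.J (Fin n) ℝ * ((1 - s) • Y + s • Z)) u
        = (1 - s) * matForm (Matrix.J (Fin n) ℝ * Y) u
          + s * matForm (Matrix.J (Fin n) ℝ * Z) u := by
      simp only [matForm_apply, mul_add, Matrix.mul_smul, Matrix.add_mulVec, Matrix.smul_mulVec,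
        dotProduct_add, dotProduct_smul, smul_eq_mul]
    have h1 := hY.bound u hu
    have h2 := hZ.bound u hu
    rw [abs_lt] at h1 h2 ⊢
    rw [e]
    obtain ⟨hs0, hs1⟩ := hs
    rcases hs0.eq_or_lt with rfl | hs0
    · simpa using h1
    · have h3 : 0 ≤ 1 - s := by linarith
      constructor <;> nlinarith [mul_le_mul_of_nonneg_left h1.1.le h3,
        mul_le_mul_of_nonneg_left h1.2.le h3, mul_lt_mul_of_pos_left h2.1 hs0,
        mul_lt_mul_of_pos_left h2.2 hs0]

lemma J_transpose_mul_J : (Matrix.J (Fin n) ℝ)ᵀ * Matrix.J (Fin n) ℝ = 1 := by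
  rw [Matrix.J_transpose, neg_mul, Matrix.J_squared, neg_neg]

lemma J_mulVec_dotProduct (u v : Fin n ⊕ Fin n → ℝ) :
    (Matrix.J (Fin n) ℝ *ᵥ u) ⬝ᵥ (Matrix.J (Fin n) ℝ *ᵥ v) = u ⬝ᵥ v := by
  rw [Matrix.dotProduct_mulVec, ← Matrix.mulVec_transpose, Matrix.mulVec_mulVec, J_transpose_mul_J,
    Matrix.one_mulVec]

lemma dotProduct_J_mulVec_self (u : Fin n ⊕ Fin n → ℝ) :
    u ⬝ᵥ (Matrix.J (Fin n) ℝ *ᵥ u) = 0 := by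
  have h : u ⬝ᵥ (Matrix.J (Fin n) ℝ *ᵥ u) = -(u ⬝ᵥ (Matrix.J (Fin n) ℝ *ᵥ u)) := by
    conv_lhs => rw [Matrix.dotProduct_mulVec, ← Matrix.mulVec_transpose, Matrix.J_transpose,
      Matrix.neg_mulVec, neg_dotProduct, dotProduct_comm]
  linarith

/-- If `Y u = u`, the symmetric matrix `S = J Y` sends `u` to `v = J u`, which is orthogonal to `u`
and of the same length. The bound on `u + v` gives `2|u|² + ⟨v, S v⟩ < |u|²`, while the bound on `v`
gives `⟨v, S v⟩ > -|u|²/2`, a contradiction. -/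
lemma IsSmallHam.det_ne_zero {Y : Mat n} (hY : IsSmallHam (1 / 2) Y) : (1 - Y).det ≠ 0 := by
  intro h
  obtain ⟨u, hu, hu'⟩ := Matrix.exists_mulVec_eq_zero_iff.2 h
  set JJ := Matrix.J (Fin n) ℝ with hJJ
  have h1 : Y *ᵥ u = u := by
    rw [Matrix.sub_mulVec, Matrix.one_mulVec, sub_eq_zero] at hu'
    exact hu'.symm
  have h2 : (JJ * Y) *ᵥ u = JJ *ᵥ u := by rw [← Matrix.mulVec_mulVec, h1]
  set v := JJ *ᵥ u with hv
  have hvv : v ⬝ᵥ v = u ⬝ᵥ u := J_mulVec_dotProduct u u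
  have huv : u ⬝ᵥ v = 0 := dotProduct_J_mulVec_self u
  have hpos := dotProduct_self_pos hu
  have hv0 : v ≠ 0 := fun h0 => by rw [h0] at hvv; simp at hvv; linarith
  have hw0 : u + v ≠ 0 := fun h0 => by
    have : (u + v) ⬝ᵥ v = 0 := by rw [h0]; simp
    rw [add_dotProduct, huv, hvv] at this; linarith
  have hsym : u ⬝ᵥ (JJ * Y) *ᵥ v = v ⬝ᵥ (JJ * Y) *ᵥ u := by
    rw [Matrix.dotProduct_mulVec, ← Matrix.mulVec_transpose, hY.symm, dotProduct_comm]
  have b1 := (abs_lt.1 (hY.bound _ hw0)).2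
  have b2 := (abs_lt.1 (hY.bound _ hv0)).1
  simp only [matForm_apply, ← hJJ, Matrix.mulVec_add, add_dotProduct, dotProduct_add, hsym] at b1 b2
  rw [h2] at b1
  rw [dotProduct_comm v u, huv, hvv] at b1
  rw [hvv] at b2
  linarith

lemma J_mul_eq_neg {Y : Mat n} (hY : (Matrix.J (Fin n) ℝ * Y)ᵀ = Matrix.J (Fin n) ℝ * Y) :
    Matrix.J (Fin n) ℝ * Y = -(Yᵀ * Matrix.J (Fin n) ℝ) := by
  rw [← hY, Matrix.transpose_mul, Matrix.J_transpose, mul_neg]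

lemma cay_mem {Y : Mat n} (hY : (Matrix.J (Fin n) ℝ * Y)ᵀ = Matrix.J (Fin n) ℝ * Y)
    (hdet : (1 - Y).det ≠ 0) : cay Y ∈ Matrix.symplecticGroup (Fin n) ℝ := by
  rw [SymplecticGroup.mem_iff', cay]
  have hu : IsUnit (1 - Y).det := isUnit_iff_ne_zero.2 hdet
  have hJ := J_mul_eq_neg hY
  have h1 : (1 + Y)ᵀ * Matrix.J (Fin n) ℝ * (1 + Y) = (1 - Y)ᵀ * Matrix.J (Fin n) ℝ * (1 - Y) := by
    simp only [Matrix.transpose_add, Matrix.transpose_sub, Matrix.transpose_one, add_mul, sub_mul,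
      mul_add, mul_sub, one_mul, mul_one, hJ]
    abel
  calc ((1 + Y) * (1 - Y)⁻¹)ᵀ * Matrix.J (Fin n) ℝ * ((1 + Y) * (1 - Y)⁻¹)
      = ((1 - Y)⁻¹)ᵀ * ((1 + Y)ᵀ * Matrix.J (Fin n) ℝ * (1 + Y)) * (1 - Y)⁻¹ := by
        rw [Matrix.transpose_mul]; simp only [mul_assoc]
    _ = ((1 - Y) * (1 - Y)⁻¹)ᵀ * Matrix.J (Fin n) ℝ * ((1 - Y) * (1 - Y)⁻¹) := by
        rw [h1, Matrix.transpose_mul]; simp only [mul_assoc]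
    _ = _ := by rw [Matrix.mul_nonsing_inv _ hu]; simp

lemma IsSmallHam.cay_mem {Y : Mat n} (hY : IsSmallHam (1 / 2) Y) :
    cay Y ∈ Matrix.symplecticGroup (Fin n) ℝ := CZ.cay_mem hY.symm hY.det_ne_zero

lemma continuousAt_inv {ι : Type*} [Fintype ι] [DecidableEq ι] {A : Matrix ι ι ℝ}
    (hA : A.det ≠ 0) : ContinuousAt (fun B : Matrix ι ι ℝ => B⁻¹) A :=
  continuousAt_matrix_inv A (by rw [Ring.inverse_eq_inv']; exact continuousAt_inv₀ hA)

lemma continuousAt_cay {Y : Mat n} (hY : (1 - Y).det ≠ 0) : ContinuousAt (cay : Mat n → Mat n) Y := by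
  have h1 : ContinuousAt (fun Y : Mat n => (1 - Y)⁻¹) Y :=
    (continuousAt_inv hY).comp (f := fun Y : Mat n => 1 - Y) (by fun_prop)
  have h2 : ContinuousAt (fun Y : Mat n => 1 + Y) Y := by fun_prop
  exact h2.mul h1

/-- The inverse Cayley transform. -/
def cayInv (M : Mat n) : Mat n := (M - 1) * (M + 1)⁻¹

lemma cay_cayInv {M : Mat n} (hM : (M + 1).det ≠ 0) : cay (cayInv M) = M := by
  have hu : IsUnit (M + 1).det := isUnit_iff_ne_zero.2 hM
  have h1 : 1 - cayInv M = (2 : ℝ) • (M + 1)⁻¹ := by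
    have : (M + 1) * (M + 1)⁻¹ - (M - 1) * (M + 1)⁻¹ = (2 : ℝ) • (M + 1)⁻¹ := by
      rw [← sub_mul, two_smul]
      rw [show M + 1 - (M - 1) = 1 + 1 by abel, add_mul, one_mul]
    rwa [Matrix.mul_nonsing_inv _ hu] at this
  have h2 : 1 + cayInv M = (2 : ℝ) • (M * (M + 1)⁻¹) := by
    have : (M + 1) * (M + 1)⁻¹ + (M - 1) * (M + 1)⁻¹ = (2 : ℝ) • (M * (M + 1)⁻¹) := by
      rw [← add_mul, two_smul]
      rw [show M + 1 + (M - 1) = M + M by abel, add_mul]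
    rwa [Matrix.mul_nonsing_inv _ hu] at this
  have h3 : (1 - cayInv M)⁻¹ = (2⁻¹ : ℝ) • (M + 1) := by
    rw [h1]
    refine Matrix.inv_eq_right_inv ?_
    rw [Matrix.smul_mul, Matrix.mul_smul, Matrix.nonsing_inv_mul _ hu, smul_smul]
    norm_num
  rw [cay, h2, h3, Matrix.smul_mul, Matrix.mul_smul, mul_assoc, Matrix.nonsing_inv_mul _ hu,
    smul_smul]
  norm_num

lemma cayInv_symm {M : Mat n} (hM : M ∈ Matrix.symplecticGroup (Fin n) ℝ)
    (hdet : (M + 1).det ≠ 0) :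
    (Matrix.J (Fin n) ℝ * cayInv M)ᵀ = Matrix.J (Fin n) ℝ * cayInv M := by
  have hu : IsUnit (M + 1).det := isUnit_iff_ne_zero.2 hdet
  have hJ := transpose_mul_J_mul hM
  have h1 : ((M + 1)ᵀ * Matrix.J (Fin n) ℝ * (M - 1))ᵀ = (M + 1)ᵀ * Matrix.J (Fin n) ℝ * (M - 1) := by
    rw [mul_assoc] at hJ
    simp only [Matrix.transpose_mul, Matrix.transpose_add, Matrix.transpose_sub,
      Matrix.transpose_one, Matrix.transpose_transpose, Matrix.J_transpose, add_mul,
      mul_sub, one_mul, mul_one, neg_mul, mul_neg, mul_assoc, hJ]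
    abel
  have h2 : Matrix.J (Fin n) ℝ * cayInv M
      = ((M + 1)⁻¹)ᵀ * ((M + 1)ᵀ * Matrix.J (Fin n) ℝ * (M - 1)) * (M + 1)⁻¹ := by
    have : ((M + 1)⁻¹)ᵀ * (M + 1)ᵀ = 1 := by
      rw [← Matrix.transpose_mul, Matrix.mul_nonsing_inv _ hu, Matrix.transpose_one]
    rw [mul_assoc (M + 1)ᵀ, ← mul_assoc _ (M + 1)ᵀ, this, one_mul, cayInv, mul_assoc]
  rw [h2, Matrix.transpose_mul, Matrix.transpose_mul, Matrix.transpose_transpose, h1]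
  simp only [mul_assoc]

lemma sigPos_eq_finrank_of_posDef {V : Type*} [AddCommGroup V] [Module ℝ V] [FiniteDimensional ℝ V]
    {Q : QuadraticForm ℝ V} (hQ : ∀ u, u ≠ 0 → 0 < Q u) : sigPos Q = Module.finrank ℝ V := by
  refine le_antisymm (sigPos_le_finrank Q) ?_
  have := le_sigPos_of_posDef Q (V := ⊤) (by
    rintro ⟨u, hu⟩ h0
    exact hQ u (by simpa using h0))
  simpa using this

lemma sigNeg_eq_zero_of_posDef {V : Type*} [AddCommGroup V] [Module ℝ V] [FiniteDimensional ℝ V]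
    {Q : QuadraticForm ℝ V} (hQ : ∀ u, u ≠ 0 → 0 < Q u) : sigNeg Q = 0 := by
  have h1 := sigPos_eq_finrank_of_posDef hQ
  have h2 := QuadraticForm.sigPos_add_sigNeg_add_radical (Q := Q)
  omega

/-- Where it is defined, `cay Y = 2 (1 - Y)⁻¹ - 1`. The resolvent identity then gives the difference
quotient along a line in closed form, and only continuity of inversion is needed to pass to the
limit. -/
lemma hasMatDerivWithinAt_cay_line (Y₀ W A : Mat n) {S : Set ℝ} {t : ℝ}
    (hS : ∀ s ∈ S, (1 - (Y₀ + s • W)).det ≠ 0) (ht : t ∈ S) :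
    HasMatDerivWithinAt (fun s => cay (Y₀ + s • W) * A)
      ((2 : ℝ) • ((1 - (Y₀ + t • W))⁻¹ * W * (1 - (Y₀ + t • W))⁻¹ * A)) S t := by
  have hcay : ∀ Y : Mat n, (1 - Y).det ≠ 0 → cay Y = (2 : ℝ) • (1 - Y)⁻¹ - 1 := by
    intro Y hY
    have h1 : (1 - Y) * (1 - Y)⁻¹ = 1 := Matrix.mul_nonsing_inv _ (isUnit_iff_ne_zero.2 hY)
    rw [cay, show (1 + Y : Mat n) = (2 : ℝ) • 1 - (1 - Y) by rw [two_smul]; abel, sub_mul, h1,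
      Matrix.smul_mul, one_mul]
  have hslope : ∀ s ∈ S \ {t}, (s - t)⁻¹ • (cay (Y₀ + s • W) * A - cay (Y₀ + t • W) * A)
      = (2 : ℝ) • ((1 - (Y₀ + s • W))⁻¹ * W * (1 - (Y₀ + t • W))⁻¹ * A) := by
    rintro s ⟨hs, hst⟩
    have hst' : s - t ≠ 0 := sub_ne_zero.2 hst
    rw [hcay _ (hS s hs), hcay _ (hS t ht)]
    have h1 : (1 - (Y₀ + s • W))⁻¹ * (1 - (Y₀ + s • W)) = 1 :=
      Matrix.nonsing_inv_mul _ (isUnit_iff_ne_zero.2 (hS s hs))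
    have h2 : (1 - (Y₀ + t • W)) * (1 - (Y₀ + t • W))⁻¹ = 1 :=
      Matrix.mul_nonsing_inv _ (isUnit_iff_ne_zero.2 (hS t ht))
    set P := (1 - (Y₀ + s • W))⁻¹
    set R := (1 - (Y₀ + t • W))⁻¹
    have h3 : P - R = (s - t) • (P * W * R) := by
      have e : (1 - (Y₀ + t • W)) - (1 - (Y₀ + s • W)) = (s - t) • W := by rw [sub_smul]; abel
      calc P - R = P * ((1 - (Y₀ + t • W)) * R) - (P * (1 - (Y₀ + s • W))) * R := by
            rw [h1, h2, one_mul, mul_one]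
        _ = P * ((1 - (Y₀ + t • W)) - (1 - (Y₀ + s • W))) * R := by
            generalize 1 - (Y₀ + t • W) = X, 1 - (Y₀ + s • W) = Z
            rw [mul_sub P X Z, sub_mul, mul_assoc P X R]
        _ = _ := by rw [e, Matrix.mul_smul, Matrix.smul_mul]
    rw [← sub_mul, sub_sub_sub_cancel_right, ← smul_sub, h3, smul_smul, Matrix.smul_mul, smul_smul,
      show (s - t)⁻¹ * (2 * (s - t)) = 2 by field_simp]
  have hlim : Filter.Tendsto (fun s => (2 : ℝ) • ((1 - (Y₀ + s • W))⁻¹ * W * (1 - (Y₀ + t • W))⁻¹ * A))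
      (𝓝[S \ {t}] t) (𝓝 ((2 : ℝ) • ((1 - (Y₀ + t • W))⁻¹ * W * (1 - (Y₀ + t • W))⁻¹ * A))) := by
    have h1 : ContinuousAt (fun s : ℝ => (1 - (Y₀ + s • W))⁻¹) t :=
      (continuousAt_inv (hS t ht)).comp (f := fun s : ℝ => 1 - (Y₀ + s • W)) (by fun_prop)
    have h2 : ContinuousAt (fun s : ℝ => (2 : ℝ) • ((1 - (Y₀ + s • W))⁻¹ * W * (1 - (Y₀ + t • W))⁻¹ * A)) t :=
      ContinuousAt.comp (g := fun B : Mat n => (2 : ℝ) • (B * W * (1 - (Y₀ + t • W))⁻¹ * A))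
        (by fun_prop) h1
    exact h2.tendsto.mono_left nhdsWithin_le_nhds
  intro i j
  rw [hasDerivWithinAt_iff_tendsto_slope]
  have := tendsto_pi_nhds.1 (tendsto_pi_nhds.1 hlim i) j
  refine this.congr' ?_
  filter_upwards [self_mem_nhdsWithin] with s hs
  rw [← hslope s hs]
  rfl

/-- The crossing form of a path that is a straight line in the Cayley chart. -/
lemma velocityForm_cay_line {Y W A : Mat n}
    (hY : (Matrix.J (Fin n) ℝ * Y)ᵀ = Matrix.J (Fin n) ℝ * Y) (hdet : (1 - Y).det ≠ 0)
    (u : LinearMap.ker (Matrix.toLin' (cay Y * A - 1))) :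
    ∃ w : Fin n ⊕ Fin n → ℝ, (w = 0 → u = 0) ∧
      velocityForm (cay Y * A) ((2 : ℝ) • ((1 - Y)⁻¹ * W * (1 - Y)⁻¹ * A)) u
        = -(2 * matForm (Matrix.J (Fin n) ℝ * W) w) := by
  obtain ⟨u, hu⟩ := u
  rw [LinearMap.mem_ker, Matrix.toLin'_apply, Matrix.sub_mulVec, Matrix.one_mulVec,
    sub_eq_zero] at hu
  have hun : IsUnit (1 - Y).det := isUnit_iff_ne_zero.2 hdet
  set JJ := Matrix.J (Fin n) ℝ with hJJ
  set w := ((1 - Y)⁻¹ * A) *ᵥ u with hw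
  have huw : u = (1 + Y) *ᵥ w := by
    rw [hw, Matrix.mulVec_mulVec, ← mul_assoc]; exact hu.symm
  refine ⟨w, fun h0 => ?_, ?_⟩
  · have : u = 0 := by rw [huw, h0, Matrix.mulVec_zero]
    simpa using this
  · rw [velocityForm_apply]
    have h1 : ((1 - Y)⁻¹ * W * (1 - Y)⁻¹ * A) *ᵥ u = ((1 - Y)⁻¹ * W) *ᵥ w := by
      rw [hw, Matrix.mulVec_mulVec]; simp only [mul_assoc]
    have h2 : JJ *ᵥ u = ((1 - Y)ᵀ * JJ) *ᵥ w := by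
      have hJ := J_mul_eq_neg hY
      rw [huw, Matrix.mulVec_mulVec, Matrix.transpose_sub, Matrix.transpose_one, mul_add, sub_mul,
        mul_one, one_mul, hJJ, hJ, sub_eq_add_neg]
    change (JJᵀ * _) *ᵥ u ⬝ᵥ u = _
    rw [← Matrix.mulVec_mulVec, Matrix.mulVec_transpose, ← Matrix.dotProduct_mulVec, h2,
      Matrix.smul_mulVec, h1, smul_dotProduct, ← Matrix.mulVec_mulVec, ← Matrix.mulVec_mulVec,
      Matrix.dotProduct_mulVec, Matrix.vecMul_transpose, Matrix.mulVec_mulVec,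
      Matrix.mul_nonsing_inv _ hun, Matrix.one_mulVec, matForm_apply, ← Matrix.mulVec_mulVec,
      Matrix.dotProduct_mulVec w, ← Matrix.mulVec_transpose, Matrix.J_transpose, Matrix.neg_mulVec,
      neg_dotProduct, dotProduct_comm, smul_eq_mul, mul_neg, neg_neg, hJJ]

/-- The velocity form is `-2` times the form of `J W`, evaluated after an injective substitution `u
↦ w`. If `J W` is definite, so is the velocity form: whatever crossing the line meets is regular. -/
lemma isRegularVelocity_cay_line {Y W A : Mat n}
    (hY : (Matrix.J (Fin n) ℝ * Y)ᵀ = Matrix.J (Fin n) ℝ * Y) (hdet : (1 - Y).det ≠ 0)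
    (hW : (∀ w, w ≠ 0 → 0 < matForm (Matrix.J (Fin n) ℝ * W) w) ∨
      (∀ w, w ≠ 0 → matForm (Matrix.J (Fin n) ℝ * W) w < 0)) :
    IsRegularVelocity (cay Y * A) ((2 : ℝ) • ((1 - Y)⁻¹ * W * (1 - Y)⁻¹ * A)) := by
  set Q := velocityForm (cay Y * A) ((2 : ℝ) • ((1 - Y)⁻¹ * W * (1 - Y)⁻¹ * A)) with hQ
  change sigPos Q + sigNeg Q = _
  rcases hW with hW | hW
  · have hpos : ∀ u, u ≠ 0 → 0 < (-Q) u := by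
      intro u hu
      obtain ⟨w, hw, hf⟩ := velocityForm_cay_line (W := W) hY hdet u
      have := hW w (fun h => hu (hw h))
      rw [_root_.neg_apply, hQ, hf]
      linarith
    have h1 := sigPos_eq_finrank_of_posDef hpos
    have h2 := sigNeg_eq_zero_of_posDef hpos
    rw [sigPos_neg] at h1
    rw [sigNeg_neg] at h2
    omega
  · have hpos : ∀ u, u ≠ 0 → 0 < Q u := by
      intro u hu
      obtain ⟨w, hw, hf⟩ := velocityForm_cay_line (W := W) hY hdet u
      have := hW w (fun h => hu (hw h))
      rw [hQ, hf]
      linarith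
    have h1 := sigPos_eq_finrank_of_posDef hpos
    have h2 := sigNeg_eq_zero_of_posDef hpos
    omega

end CZ

/-! ### Lines in the Cayley chart and regularization of arbitrary paths. -/

namespace CZ

variable {n : ℕ}

lemma isGoodPath_cay_line {Y₀ W A : Mat n} {a b : ℝ}
    (hsmall : ∀ s ∈ Icc a b, IsSmallHam (1 / 2) (Y₀ + s • W))
    (hA : A ∈ Matrix.symplecticGroup (Fin n) ℝ)
    (hW : (∀ w, w ≠ 0 → 0 < matForm (Matrix.J (Fin n) ℝ * W) w) ∨
      (∀ w, w ≠ 0 → matForm (Matrix.J (Fin n) ℝ * W) w < 0)) :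
    IsGoodPath a b (fun s => cay (Y₀ + s • W) * A) where
  continuousOn s hs := by
    have h1 : ContinuousAt (fun s : ℝ => cay (Y₀ + s • W)) s :=
      (continuousAt_cay (hsmall s hs).det_ne_zero).comp (f := fun s : ℝ => Y₀ + s • W)
        (by fun_prop)
    exact (h1.mul continuousAt_const).continuousWithinAt
  symplectic s hs := mul_mem (hsmall s hs).cay_mem hA
  regular s hs _ := ⟨_, hasMatDerivWithinAt_cay_line Y₀ W A (fun s hs => (hsmall s hs).det_ne_zero) hs,
    isRegularVelocity_cay_line (hsmall s hs).symm (hsmall s hs).det_ne_zero hW⟩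

/-- Linear interpolation in the chart: convexity keeps it in the chart, and it is stationary at the
ends, where `Y` and `Z` agree. -/
lemma homotopicOn_cay {Y Z : ℝ → Mat n} {A : Mat n} {a b : ℝ} (hYc : ContinuousOn Y (Icc a b))
    (hZc : ContinuousOn Z (Icc a b)) (hY : ∀ t ∈ Icc a b, IsSmallHam (1 / 2) (Y t))
    (hZ : ∀ t ∈ Icc a b, IsSmallHam (1 / 2) (Z t)) (ha : Y a = Z a) (hb : Y b = Z b)
    (hA : A ∈ Matrix.symplecticGroup (Fin n) ℝ) :
    HomotopicOn a b (fun t => cay (Y t) * A) (fun t => cay (Z t) * A) := by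
  have hcomb : ∀ p ∈ Icc (0 : ℝ) 1 ×ˢ Icc a b,
      IsSmallHam (1 / 2) ((1 - p.1) • Y p.2 + p.1 • Z p.2) := fun p hp =>
    (hY _ hp.2).combo (hZ _ hp.2) hp.1
  refine ⟨fun p => cay ((1 - p.1) • Y p.2 + p.1 • Z p.2) * A, ?_, fun p hp =>
    mul_mem (hcomb p hp).cay_mem hA, fun t _ => by simp, fun s _ => ?_⟩
  · intro p hp
    have h1 : ContinuousWithinAt (fun p : ℝ × ℝ => Y p.2) (Icc (0 : ℝ) 1 ×ˢ Icc a b) p :=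
      (hYc p.2 hp.2).comp (by fun_prop) fun q hq => hq.2
    have h2 : ContinuousWithinAt (fun p : ℝ × ℝ => Z p.2) (Icc (0 : ℝ) 1 ×ˢ Icc a b) p :=
      (hZc p.2 hp.2).comp (by fun_prop) fun q hq => hq.2
    have h3 : ContinuousWithinAt (fun p : ℝ × ℝ => (1 - p.1) • Y p.2 + p.1 • Z p.2)
        (Icc (0 : ℝ) 1 ×ˢ Icc a b) p :=
      ((continuousWithinAt_const.sub continuous_fst.continuousWithinAt).smul h1).add
        (continuous_fst.continuousWithinAt.smul h2)
    have h4 := (continuousAt_cay (hcomb p hp).det_ne_zero).comp_continuousWithinAt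
      (f := fun p : ℝ × ℝ => (1 - p.1) • Y p.2 + p.1 • Z p.2) h3
    exact h4.mul continuousWithinAt_const
  · simp only [← ha, ← hb, ← add_smul, sub_add_cancel, one_smul, and_self]

lemma J_mul_smul_J (r : ℝ) :
    Matrix.J (Fin n) ℝ * (r • Matrix.J (Fin n) ℝ) = -(r • (1 : Mat n)) := by
  rw [Matrix.mul_smul, Matrix.J_squared, smul_neg]

lemma matForm_smul_one (r : ℝ) (u : Fin n ⊕ Fin n → ℝ) :
    matForm (r • (1 : Mat n)) u = r * (u ⬝ᵥ u) := by
  rw [matForm_apply, Matrix.smul_mulVec, Matrix.one_mulVec, dotProduct_smul, smul_eq_mul]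

lemma isSmallHam_smul_J {r ρ : ℝ} (hr : |r| < ρ) : IsSmallHam ρ (r • Matrix.J (Fin n) ℝ) := by
  refine ⟨by rw [J_mul_smul_J]; simp, fun u hu => ?_⟩
  have := dotProduct_self_pos hu
  rw [J_mul_smul_J, matForm_neg, _root_.neg_apply, matForm_smul_one, abs_neg, abs_mul,
    abs_of_pos this]
  gcongr

/-- The curve `r ↦ cay (r J)` is a line with direction `W = J`, and `J W = -1` is definite, so all
its crossings are regular. A generic rotation thus moves any given `A` off the Maslov cycle. -/
lemma finite_crossing_rotations {A : Mat n} (hA : A ∈ Matrix.symplecticGroup (Fin n) ℝ) :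
    {r : ℝ | r ∈ Icc 0 (3 / 8) ∧ (cay (r • Matrix.J (Fin n) ℝ) * A - 1).det = 0}.Finite := by
  have := (isGoodPath_cay_line (Y₀ := 0) (W := Matrix.J (Fin n) ℝ) (a := 0) (b := 3 / 8)
    (fun s hs => by
      rw [zero_add]
      exact isSmallHam_smul_J (by rw [abs_of_nonneg hs.1]; linarith [hs.2])) hA (Or.inr fun w hw => by
      have h1 := J_mul_smul_J (n := n) 1
      rw [one_smul] at h1
      have := dotProduct_self_pos hw
      rw [h1, matForm_neg, _root_.neg_apply, matForm_smul_one]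
      linarith)).finite_crossings
  simpa only [zero_add] using this

/-- A path inside one Cayley chart is homotopic to a regular path. -/
lemma exists_isGoodPath_cay {Y : ℝ → Mat n} {A : Mat n} {a b : ℝ} (hab : a < b)
    (hYc : ContinuousOn Y (Icc a b)) (hY : ∀ t ∈ Icc a b, IsSmallHam (1 / 4) (Y t))
    (hA : A ∈ Matrix.symplecticGroup (Fin n) ℝ) :
    ∃ Γ' : ℝ → Mat n, IsGoodPath a b Γ' ∧ HomotopicOn a b (fun t => cay (Y t) * A) Γ' := by
  set JJ := Matrix.J (Fin n) ℝ with hJJ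
  -- The replacement runs from `Y a` straight to `r J` and from there straight to `Y b`. As `r`
  -- exceeds the bound `1/4` on `Y`, both legs have definite directions; as `r < 1/2`, they stay in
  -- the chart; and a generic `r` makes the corner a non-crossing, so that the legs can be glued.
  obtain ⟨r, ⟨hr0, hr1⟩, hr⟩ : ∃ r ∈ Ioo (1 / 4 : ℝ) (3 / 8), (cay (r • JJ) * A - 1).det ≠ 0 := by
    obtain ⟨r, hr, hr'⟩ := ((Ioo_infinite (by norm_num : (1 / 4 : ℝ) < 3 / 8)).sdiff
      (finite_crossing_rotations hA)).nonempty
    exact ⟨r, hr, fun h => hr' ⟨⟨by linarith [hr.1], hr.2.le⟩, h⟩⟩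
  have hrs : IsSmallHam (1 / 2) (r • JJ) := isSmallHam_smul_J (by
    rw [abs_of_pos (by linarith)]; linarith)
  have hY' : ∀ t ∈ Icc a b, IsSmallHam (1 / 2) (Y t) := fun t ht => (hY t ht).mono (by norm_num)
  set c := (a + b) / 2 with hc
  have hac : a < c := by rw [hc]; linarith
  have hcb : c < b := by rw [hc]; linarith
  have ha_mem : a ∈ Icc a b := left_mem_Icc.2 hab.le
  have hb_mem : b ∈ Icc a b := right_mem_Icc.2 hab.le
  set W₁ := (c - a)⁻¹ • (r • JJ - Y a) with hW₁
  set W₂ := (b - c)⁻¹ • (Y b - r • JJ) with hW₂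
  have hca : c - a ≠ 0 := by linarith
  have hbc : b - c ≠ 0 := by linarith
  have e₁ : ∀ t, (Y a - a • W₁) + t • W₁
      = (1 - (t - a) / (c - a)) • Y a + ((t - a) / (c - a)) • (r • JJ) := by
    intro t; rw [hW₁, div_eq_mul_inv]; module
  have e₂ : ∀ t, (r • JJ - c • W₂) + t • W₂
      = (1 - (t - c) / (b - c)) • (r • JJ) + ((t - c) / (b - c)) • Y b := by
    intro t; rw [hW₂, div_eq_mul_inv]; module
  have s₁ : ∀ t ∈ Icc a c, IsSmallHam (1 / 2) ((Y a - a • W₁) + t • W₁) := by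
    intro t ht
    rw [e₁]
    exact (hY' a ha_mem).combo hrs ⟨div_nonneg (by linarith [ht.1]) (by linarith),
      (div_le_one (by linarith)).2 (by linarith [ht.2])⟩
  have s₂ : ∀ t ∈ Icc c b, IsSmallHam (1 / 2) ((r • JJ - c • W₂) + t • W₂) := by
    intro t ht
    rw [e₂]
    exact hrs.combo (hY' b hb_mem) ⟨div_nonneg (by linarith [ht.1]) (by linarith),
      (div_le_one (by linarith)).2 (by linarith [ht.2])⟩
  have hpos : ∀ t ∈ Icc a b, ∀ w, w ≠ 0 → 0 < matForm (JJ * (Y t - r • JJ)) w := by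
    intro t ht w hw
    have h1 := (abs_lt.1 ((hY t ht).bound w hw)).1
    have h2 := dotProduct_self_pos hw
    have h3 : matForm (JJ * (Y t - r • JJ)) w = matForm (JJ * Y t) w + r * (w ⬝ᵥ w) := by
      rw [mul_sub, hJJ, J_mul_smul_J, sub_neg_eq_add, matForm_apply, Matrix.add_mulVec,
        dotProduct_add, ← matForm_apply, ← matForm_apply, matForm_smul_one]
    rw [h3]
    nlinarith
  have hsm : ∀ (k : ℝ) (M : Mat n) w, matForm (JJ * (k • M)) w = k * matForm (JJ * M) w := by
    intro k M w
    simp only [matForm_apply, Matrix.mul_smul, Matrix.smul_mulVec, dotProduct_smul, smul_eq_mul]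
  have hg₁ := isGoodPath_cay_line s₁ hA (Or.inr fun w hw => by
    rw [← hJJ, hW₁, hsm, show r • JJ - Y a = -(Y a - r • JJ) by abel, mul_neg, matForm_neg,
      _root_.neg_apply]
    have h1 := hpos a ha_mem w hw
    have h2 : 0 < (c - a)⁻¹ := inv_pos.2 (by linarith)
    nlinarith [mul_pos h2 h1])
  have hg₂ := isGoodPath_cay_line s₂ hA (Or.inl fun w hw => by
    rw [← hJJ, hW₂, hsm]
    have h1 := hpos b hb_mem w hw
    have h2 : 0 < (b - c)⁻¹ := inv_pos.2 (by linarith)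
    exact mul_pos h2 h1)
  set Z : ℝ → Mat n := fun t =>
    if t ≤ c then (Y a - a • W₁) + t • W₁ else (r • JJ - c • W₂) + t • W₂ with hZdef
  have hZc : (Y a - a • W₁) + c • W₁ = r • JJ := by
    rw [e₁, div_self hca]; simp
  have hZc' : (r • JJ - c • W₂) + c • W₂ = r • JJ := by rw [e₂]; simp
  have hZ₁ : ∀ t ∈ Icc a c, Z t = (Y a - a • W₁) + t • W₁ := fun t ht => if_pos ht.2
  have hZ₂ : ∀ t ∈ Icc c b, Z t = (r • JJ - c • W₂) + t • W₂ := by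
    intro t ht
    by_cases h : t ≤ c
    · obtain rfl : t = c := le_antisymm h ht.1
      rw [hZdef]; simp only [le_refl, if_true]; rw [hZc, hZc']
    · exact if_neg h
  refine ⟨fun t => cay (Z t) * A, ?_, ?_⟩
  · refine IsGoodPath.glue hac hcb (hg₁.congr fun t ht => ?_) (hg₂.congr fun t ht => ?_) ?_
    · rw [hZ₁ t ht]
    · rw [hZ₂ t ht]
    · rwa [hZ₁ c ⟨hac.le, le_rfl⟩, hZc]
  · refine homotopicOn_cay hYc ?_ hY' ?_ ?_ ?_ hA
    · refine Continuous.continuousOn (Continuous.if_le (by fun_prop) (by fun_prop) continuous_id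
        continuous_const ?_)
      rintro t rfl
      exact hZc.trans hZc'.symm
    · intro t ht
      rcases le_total t c with h | h
      · rw [hZ₁ t ⟨ht.1, h⟩]; exact s₁ t ⟨ht.1, h⟩
      · rw [hZ₂ t ⟨h, ht.2⟩]; exact s₂ t ⟨h, ht.2⟩
    · rw [hZ₁ a ⟨le_rfl, hac.le⟩, sub_add_cancel]
    · rw [hZ₂ b ⟨hcb.le, le_rfl⟩, e₂, div_self hbc]; simp

/-- Smallness means that `ρ + J Y` and `ρ - J Y` are both positive definite, an open condition that
holds at `Y = 0`. -/
lemma eventually_isSmallHam {α : Type*} {l : Filter α} {Y : α → Mat n}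
    (hY : Filter.Tendsto Y l (𝓝 0)) {ρ : ℝ} (hρ : 0 < ρ)
    (hsymm : ∀ᶠ a in l, (Matrix.J (Fin n) ℝ * Y a)ᵀ = Matrix.J (Fin n) ℝ * Y a) :
    ∀ᶠ a in l, IsSmallHam ρ (Y a) := by
  have hform : ∀ (M : Mat n) u, matForm (ρ • (1 : Mat n) + M) u = ρ * (u ⬝ᵥ u) + matForm M u := by
    intro M u
    rw [matForm_apply, Matrix.add_mulVec, dotProduct_add, ← matForm_apply, ← matForm_apply,
      matForm_smul_one]
  have hpd : ((matForm (ρ • (1 : Mat n))).restrict ⊤).PosDef := by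
    rintro ⟨u, hu⟩ h0
    rw [QuadraticMap.restrict_apply, matForm_smul_one]
    exact mul_pos hρ (dotProduct_self_pos (by simpa using h0))
  have hl : Filter.Tendsto (fun a => Matrix.J (Fin n) ℝ * Y a) l (𝓝 0) := by
    have : Continuous fun M : Mat n => Matrix.J (Fin n) ℝ * M := by fun_prop
    simpa [Function.comp_def] using (this.tendsto 0).comp hY
  have h1 := eventually_posDef_of_tendsto ⊤ (A := fun a => ρ • (1 : Mat n) + Matrix.J (Fin n) ℝ * Y a)
    (A₀ := ρ • (1 : Mat n)) (by simpa using tendsto_const_nhds.add hl) hpd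
  have h2 := eventually_posDef_of_tendsto ⊤
    (A := fun a => ρ • (1 : Mat n) + -(Matrix.J (Fin n) ℝ * Y a))
    (A₀ := ρ • (1 : Mat n)) (by simpa using tendsto_const_nhds.add hl.neg) hpd
  filter_upwards [h1, h2, hsymm] with a h1 h2 h3
  refine ⟨h3, fun u hu => ?_⟩
  have h4 := h1 ⟨u, Submodule.mem_top⟩ fun h => hu (congrArg Subtype.val h)
  have h5 := h2 ⟨u, Submodule.mem_top⟩ fun h => hu (congrArg Subtype.val h)
  rw [QuadraticMap.restrict_apply, hform] at h4 h5
  rw [matForm_neg, _root_.neg_apply] at h5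
  rw [abs_lt]
  constructor <;> linarith

lemma det_one_sub_smul_J (r : ℝ) : (1 - r • Matrix.J (Fin n) ℝ).det ≠ 0 := by
  intro h
  obtain ⟨u, hu, hu'⟩ := Matrix.exists_mulVec_eq_zero_iff.2 h
  rw [Matrix.sub_mulVec, Matrix.one_mulVec, sub_eq_zero, Matrix.smul_mulVec] at hu'
  have h1 : u ⬝ᵥ u = 0 := by
    have := congrArg (u ⬝ᵥ ·) hu'
    simpa only [dotProduct_smul, dotProduct_J_mulVec_self, smul_zero] using this
  exact hu (dotProduct_self_eq_zero.1 h1)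

lemma cay_smul_J_mem (r : ℝ) : cay (r • Matrix.J (Fin n) ℝ) ∈ Matrix.symplecticGroup (Fin n) ℝ :=
  cay_mem (by rw [J_mul_smul_J]; simp) (det_one_sub_smul_J r)

lemma continuous_cay_smul_J {X : Type*} [TopologicalSpace X] {r : X → ℝ} (hr : Continuous r) :
    Continuous fun x => cay (r x • Matrix.J (Fin n) ℝ) :=
  continuous_iff_continuousAt.2 fun x =>
    (continuousAt_cay (det_one_sub_smul_J (r x))).comp (f := fun x => r x • Matrix.J (Fin n) ℝ)
      (by fun_prop)

lemma cay_zero : cay (0 : Mat n) = 1 := by simp [cay]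

/-- Every continuous path of symplectic matrices is homotopic with fixed endpoints to a regular
one. -/
theorem exists_isGoodPath_homotopic {T : ℝ} (hT : 0 < T) {Γ : ℝ → Mat n} (hc : Continuous Γ)
    (hs : ∀ t, Γ t ∈ Matrix.symplecticGroup (Fin n) ℝ) :
    ∃ Γ', IsGoodPath 0 T Γ' ∧ HomotopicOn 0 T Γ Γ' := by
  set JJ := Matrix.J (Fin n) ℝ with hJJ
  -- A rotation with parameter `s t (T - t)` leaves the ends of the path fixed. A generic small `s`
  -- will remove the crossings at the interior subdivision points, where pieces are glued.
  set G : ℝ × ℝ → Mat n := fun q => cay ((q.1 * (q.2 * (T - q.2))) • JJ) * Γ q.2 with hG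
  have hGc : Continuous G := (continuous_cay_smul_J (by fun_prop)).mul (by fun_prop)
  have hGs : ∀ q, G q ∈ Matrix.symplecticGroup (Fin n) ℝ := fun q =>
    mul_mem (cay_smul_J_mem _) (hs _)
  have hG0 : ∀ t, G (0, t) = Γ t := fun t => by simp [hG, cay_zero]
  have hinv : ∀ t, Γ t * (Γ t)⁻¹ = 1 := fun t =>
    Matrix.mul_nonsing_inv _ (SymplecticGroup.symplectic_det (hs t))
  have hinvs : ∀ t, (Γ t)⁻¹ ∈ Matrix.symplecticGroup (Fin n) ℝ := fun t => by
    rw [← SymplecticGroup.coe_inv' ⟨Γ t, hs t⟩]; exact Subtype.mem _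
  -- `P t₀ q` expresses that `G q` lies in the small Cayley chart centred at `Γ t₀`.
  set P : ℝ → ℝ × ℝ → Prop := fun t₀ q => (G q * (Γ t₀)⁻¹ + 1).det ≠ 0 ∧
    IsSmallHam (1 / 4) (cayInv (G q * (Γ t₀)⁻¹)) with hP
  have hPev : ∀ t₀, ∀ᶠ q in 𝓝 ((0 : ℝ), t₀), P t₀ q := by
    intro t₀
    have h1 : G (0, t₀) * (Γ t₀)⁻¹ = 1 := by rw [hG0, hinv]
    have hc1 : Continuous fun q => G q * (Γ t₀)⁻¹ := by fun_prop
    have hdet1 : ((1 : Mat n) + 1).det ≠ 0 := by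
      have : (1 + 1 : Mat n) = (2 : ℝ) • 1 := by rw [two_smul]
      rw [this, Matrix.det_smul, Matrix.det_one, mul_one]
      positivity
    have hdet : ∀ᶠ q in 𝓝 ((0 : ℝ), t₀), (G q * (Γ t₀)⁻¹ + 1).det ≠ 0 := by
      have hc2 : Continuous fun q => (G q * (Γ t₀)⁻¹ + 1).det := by fun_prop
      exact hc2.continuousAt.eventually_ne (by rw [h1]; exact hdet1)
    have hlim : Filter.Tendsto (fun q => cayInv (G q * (Γ t₀)⁻¹)) (𝓝 ((0 : ℝ), t₀)) (𝓝 0) := by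
      have h2 : ContinuousAt (cayInv : Mat n → Mat n) 1 := by
        have h3 : ContinuousAt (fun M : Mat n => (M + 1)⁻¹) 1 :=
          (continuousAt_inv hdet1).comp (f := fun M : Mat n => M + 1) (by fun_prop)
        have h4 : ContinuousAt (fun M : Mat n => M - 1) 1 := by fun_prop
        exact h4.mul h3
      have h5 := (ContinuousAt.comp (x := ((0 : ℝ), t₀)) (g := cayInv)
        (f := fun q => G q * (Γ t₀)⁻¹) (by rw [h1]; exact h2) hc1.continuousAt).tendsto
      simp only [Function.comp_def, h1] at h5
      simpa [cayInv] using h5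
    have := eventually_isSmallHam hlim (ρ := 1 / 4) (by norm_num)
      (hdet.mono fun q hq => cayInv_symm (mul_mem (hGs q) (hinvs t₀)) hq)
    exact hdet.and this
  -- A Lebesgue number along `{0} × [0, T]` bounds both the mesh of the subdivision and the size of
  -- the perturbation.
  obtain ⟨δ, hδ, hleb⟩ := lebesgue_number_lemma_of_metric
    (s := (fun t : ℝ => ((0 : ℝ), t)) '' Icc 0 T) (c := fun t₀ : ℝ => interior {q | P t₀ q})
    (isCompact_Icc.image (by fun_prop)) (fun _ => isOpen_interior) (by
      rintro _ ⟨t, ht, rfl⟩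
      exact mem_iUnion.2 ⟨t, mem_interior_iff_mem_nhds.2 (hPev t)⟩)
  obtain ⟨N, hN0, hN⟩ : ∃ N : ℕ, 0 < N ∧ T / N < δ := by
    obtain ⟨N, hN⟩ := exists_nat_gt (T / δ)
    have hNpos : (0 : ℝ) < N := lt_of_le_of_lt (by positivity) hN
    refine ⟨N, by exact_mod_cast hNpos, ?_⟩
    rw [div_lt_iff₀ hδ] at hN
    rw [div_lt_iff₀ hNpos]
    linarith
  have hNR : (0 : ℝ) < N := by exact_mod_cast hN0
  set p : ℕ → ℝ := fun i => i * (T / N) with hp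
  have hTN : 0 < T / N := by positivity
  have hpN : p N = T := by simp only [hp]; field_simp
  have hpstep : ∀ i, p (i + 1) = p i + T / N := fun i => by simp only [hp]; push_cast; ring
  have hpmono : StrictMono p := strictMono_nat_of_lt_succ fun i => by rw [hpstep]; linarith
  have hp0 : p 0 = 0 := by simp [hp]
  -- a generic size of the perturbation
  obtain ⟨a, ⟨ha0, haδ⟩, hagen⟩ : ∃ a ∈ Ioo 0 (min δ (3 / 8 / T ^ 2)), ∀ i ∈ Finset.Ioo 0 N,
      (G (a, p i) - 1).det ≠ 0 := by
    -- At an interior subdivision point the rotation parameter is a nonzero multiple of `a`, so only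
    -- finitely many `a` give a crossing. The bound `3/8 / T²` on `a` keeps the parameter in the
    -- range covered by `finite_crossing_rotations`.
    have hfin : (⋃ i ∈ Finset.Ioo 0 N, (fun a => a * (p i * (T - p i))) ⁻¹'
        {r : ℝ | r ∈ Icc 0 (3 / 8) ∧ (cay (r • JJ) * Γ (p i) - 1).det = 0}).Finite := by
      refine Set.Finite.biUnion (Finset.finite_toSet _) fun i hi => ?_
      refine Set.Finite.preimage (Function.Injective.injOn ?_) (finite_crossing_rotations (hs _))
      have hi' := Finset.mem_Ioo.1 hi
      have h1 : 0 < p i := by rw [← hp0]; exact hpmono hi'.1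
      have h2 : 0 < T - p i := by rw [← hpN, sub_pos]; exact hpmono hi'.2
      exact mul_left_injective₀ (by positivity)
    obtain ⟨a, ha, ha'⟩ := ((Ioo_infinite (lt_min hδ (by positivity) :
      (0 : ℝ) < min δ (3 / 8 / T ^ 2))).sdiff hfin).nonempty
    refine ⟨a, ha, fun i hi h0 => ha' (mem_biUnion (Finset.mem_coe.2 hi) ⟨⟨?_, ?_⟩, h0⟩)⟩
    all_goals
      have hi' := Finset.mem_Ioo.1 hi
      have h1 : 0 < p i := by rw [← hp0]; exact hpmono hi'.1
      have h2 : p i < T := by rw [← hpN]; exact hpmono hi'.2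
    · have := ha.1
      have : 0 < T - p i := by linarith
      positivity
    · have h3 : a * T ^ 2 < 3 / 8 := by
        rw [← lt_div_iff₀ (by positivity)]
        exact ha.2.trans_le (min_le_right _ _)
      have h4 : p i * (T - p i) ≤ T ^ 2 := by nlinarith
      have := mul_le_mul_of_nonneg_left h4 ha.1.le
      linarith
  have haδ' : a < δ := haδ.trans_le (min_le_left _ _)
  -- pieces
  have hpiece : ∀ i < N, ∃ Γ', IsGoodPath (p i) (p (i + 1)) Γ' ∧
      HomotopicOn (p i) (p (i + 1)) (fun t => G (a, t)) Γ' := by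
    intro i hi
    have hpi : p i ∈ Icc 0 T := ⟨by rw [← hp0]; exact hpmono.monotone (Nat.zero_le _), by
      rw [← hpN]; exact hpmono.monotone hi.le⟩
    obtain ⟨t₀, ht₀⟩ := hleb (0, p i) ⟨p i, hpi, rfl⟩
    have hPt : ∀ t ∈ Icc (p i) (p (i + 1)), P t₀ (a, t) := by
      intro t ht
      have : (a, t) ∈ Metric.ball ((0 : ℝ), p i) δ := by
        rw [Metric.mem_ball, Prod.dist_eq, max_lt_iff, Real.dist_eq, Real.dist_eq]
        rw [hpstep] at ht
        simp only [sub_zero]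
        exact ⟨by rwa [abs_of_pos ha0], by
          rw [abs_of_nonneg (by linarith [ht.1])]; linarith [ht.2]⟩
      have hmem := interior_subset (ht₀ this)
      exact hmem
    have hcont : ContinuousOn (fun t => cayInv (G (a, t) * (Γ t₀)⁻¹)) (Icc (p i) (p (i + 1))) := by
      intro t ht
      have h3 : ContinuousAt (fun t => (G (a, t) * (Γ t₀)⁻¹ + 1)⁻¹) t :=
        (continuousAt_inv (hPt t ht).1).comp (f := fun t => G (a, t) * (Γ t₀)⁻¹ + 1) (by fun_prop)
      have h4 : ContinuousAt (fun t => G (a, t) * (Γ t₀)⁻¹ - 1) t := by fun_prop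
      exact (h4.mul h3).continuousWithinAt
    obtain ⟨Γ', h1, h2⟩ := exists_isGoodPath_cay (hpmono (Nat.lt_succ_self i)) hcont
      (fun t ht => (hPt t ht).2) (hs t₀)
    refine ⟨Γ', h1, h2.congr (hpmono.monotone (Nat.le_succ i)) (fun t ht => ?_) fun _ _ => rfl⟩
    rw [cay_cayInv (hPt t ht).1, mul_assoc, Matrix.nonsing_inv_mul _
      (SymplecticGroup.symplectic_det (hs t₀)), mul_one]
  have hind : ∀ k, 1 ≤ k → k ≤ N → ∃ Γ', IsGoodPath (p 0) (p k) Γ' ∧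
      HomotopicOn (p 0) (p k) (fun t => G (a, t)) Γ' := by
    intro k hk
    induction k, hk using Nat.le_induction with
    | base => exact fun h => hpiece 0 hN0
    | succ k hk ih =>
      intro hkN
      obtain ⟨Γ₁, hg₁, hh₁⟩ := ih (by omega)
      obtain ⟨Γ₂, hg₂, hh₂⟩ := hpiece k (by omega)
      have hk0 : p 0 < p k := hpmono (by omega)
      have hk1 : p k < p (k + 1) := hpmono (by omega)
      refine ⟨_, ?_, hh₁.glue hk0.le hk1.le hh₂⟩
      refine IsGoodPath.glue hk0 hk1 (hg₁.congr fun t ht => if_pos ht.2)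
        (hg₂.congr fun t ht => ?_) ?_
      · by_cases h : t ≤ p k
        · obtain rfl : t = p k := le_antisymm h ht.1
          rw [if_pos le_rfl, hh₁.right_eq hk0.le, hh₂.left_eq hk1.le]
        · exact if_neg h
      · rw [if_pos le_rfl, hh₁.right_eq hk0.le]
        exact hagen k (Finset.mem_Ioo.2 ⟨by omega, by omega⟩)
  obtain ⟨Γ', h1, h2⟩ := hind N hN0 le_rfl
  rw [hp0, hpN] at h1 h2
  refine ⟨Γ', h1, HomotopicOn.trans hT.le ?_ h2⟩
  -- The perturbation is switched on gradually, with fixed ends thanks to the factor `t (T - t)`.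
  refine ⟨fun q => G (q.1 * a, q.2), by fun_prop, fun q _ => hGs _, fun t _ => ?_, fun s _ => ?_⟩
  · simp [hG0]
  · simp [hG, cay_zero]

end CZ

/-! ### Block sums and the index of a stabilized loop of trivializations -/

namespace CZ

variable {n : ℕ}

/-- The identification of the coordinates of `ℝ²ⁿ ⊕ ℝ²` with those of `ℝ²ⁿ⁺²`. -/
def blockEquiv (n : ℕ) : (Fin n ⊕ Fin n) ⊕ (Fin 1 ⊕ Fin 1) ≃ Fin (n + 1) ⊕ Fin (n + 1) :=
  (Equiv.sumSumSumComm (Fin n) (Fin n) (Fin 1) (Fin 1)).trans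
    (Equiv.sumCongr finSumFinEquiv finSumFinEquiv)

/-- The block sum of matrices. -/
def blockSum (A : Mat n) (B : Mat 1) : Mat (n + 1) :=
  (Matrix.fromBlocks A 0 0 B).submatrix (blockEquiv n).symm (blockEquiv n).symm

/-- The sum of vectors. -/
def blockVec (x : Fin n ⊕ Fin n → ℝ) (y : Fin 1 ⊕ Fin 1 → ℝ) : Fin (n + 1) ⊕ Fin (n + 1) → ℝ :=
  Sum.elim x y ∘ (blockEquiv n).symm

lemma blockSum_mul (A A' : Mat n) (B B' : Mat 1) :
    blockSum A B * blockSum A' B' = blockSum (A * A') (B * B') := by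
  rw [blockSum, blockSum, Matrix.submatrix_mul_equiv, Matrix.fromBlocks_multiply, blockSum]
  simp

lemma blockSum_one : blockSum (1 : Mat n) 1 = 1 := by
  rw [blockSum, Matrix.fromBlocks_one, Matrix.submatrix_one_equiv]

lemma blockSum_sub (A A' : Mat n) (B B' : Mat 1) :
    blockSum A B - blockSum A' B' = blockSum (A - A') (B - B') := by
  have h : Matrix.fromBlocks A 0 0 B - Matrix.fromBlocks A' 0 0 B'
      = Matrix.fromBlocks (A - A') 0 0 (B - B') := by
    ext (i | i) (j | j) <;> simp
  rw [blockSum, blockSum, blockSum, ← h]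
  rfl

lemma blockSum_transpose (A : Mat n) (B : Mat 1) : (blockSum A B)ᵀ = blockSum Aᵀ Bᵀ := by
  rw [blockSum, Matrix.transpose_submatrix, Matrix.fromBlocks_transpose, blockSum]; simp

lemma blockSum_J :
    blockSum (Matrix.J (Fin n) ℝ) (Matrix.J (Fin 1) ℝ) = Matrix.J (Fin (n + 1)) ℝ := by
  rw [blockSum]
  have h : Matrix.fromBlocks (Matrix.J (Fin n) ℝ) 0 0 (Matrix.J (Fin 1) ℝ)
      = (Matrix.J (Fin (n + 1)) ℝ).submatrix (blockEquiv n) (blockEquiv n) := by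
    have hne : ∀ (a : Fin n) (b : Fin 1), Fin.castAdd 1 a ≠ Fin.natAdd n b := fun a b h => by
      have := congrArg Fin.val h
      simp at this
      omega
    ext i j
    rcases i with (i | i) | (i | i) <;> rcases j with (j | j) | (j | j) <;>
      simp [blockEquiv, Matrix.J, Matrix.one_apply, hne, (hne _ _).symm]
  rw [h, Matrix.submatrix_submatrix]
  simp

lemma blockSum_mulVec (A : Mat n) (B : Mat 1) (x : Fin n ⊕ Fin n → ℝ) (y : Fin 1 ⊕ Fin 1 → ℝ) :
    blockSum A B *ᵥ blockVec x y = blockVec (A *ᵥ x) (B *ᵥ y) := by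
  rw [blockSum, blockVec, Matrix.submatrix_mulVec_equiv, Matrix.fromBlocks_mulVec, blockVec]
  simp [Function.comp_def]

lemma blockVec_dotProduct (x x' : Fin n ⊕ Fin n → ℝ) (y y' : Fin 1 ⊕ Fin 1 → ℝ) :
    blockVec x y ⬝ᵥ blockVec x' y' = x ⬝ᵥ x' + y ⬝ᵥ y' := by
  rw [blockVec, blockVec, comp_equiv_dotProduct_comp_equiv]
  simp [dotProduct, Fintype.sum_sum_type]

lemma blockVec_add (x x' : Fin n ⊕ Fin n → ℝ) (y y' : Fin 1 ⊕ Fin 1 → ℝ) :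
    blockVec (x + x') (y + y') = blockVec x y + blockVec x' y' := by
  ext i; simp only [blockVec, Function.comp, Pi.add_apply]; cases (blockEquiv n).symm i <;> simp

lemma blockVec_smul (r : ℝ) (x : Fin n ⊕ Fin n → ℝ) (y : Fin 1 ⊕ Fin 1 → ℝ) :
    blockVec (r • x) (r • y) = r • blockVec x y := by
  ext i; simp only [blockVec, Function.comp, Pi.smul_apply]; cases (blockEquiv n).symm i <;> simp

lemma blockVec_injective {x x' : Fin n ⊕ Fin n → ℝ} {y y' : Fin 1 ⊕ Fin 1 → ℝ}
    (h : blockVec x y = blockVec x' y') : x = x' ∧ y = y' := by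
  have h' : ∀ i, Sum.elim x y i = Sum.elim x' y' i := fun i => by
    have := congrFun h (blockEquiv n i)
    simpa [blockVec] using this
  exact ⟨funext fun i => h' (Sum.inl i), funext fun i => h' (Sum.inr i)⟩

lemma exists_blockVec (u : Fin (n + 1) ⊕ Fin (n + 1) → ℝ) : ∃ x y, u = blockVec x y := by
  refine ⟨fun i => u (blockEquiv n (Sum.inl i)), fun i => u (blockEquiv n (Sum.inr i)), ?_⟩
  ext i
  obtain ⟨j, rfl⟩ := (blockEquiv n).surjective i
  cases j <;> simp [blockVec]

lemma blockSum_mem {A : Mat n} {B : Mat 1} (hA : A ∈ Matrix.symplecticGroup (Fin n) ℝ)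
    (hB : B ∈ Matrix.symplecticGroup (Fin 1) ℝ) :
    blockSum A B ∈ Matrix.symplecticGroup (Fin (n + 1)) ℝ := by
  rw [SymplecticGroup.mem_iff', ← blockSum_J, blockSum_transpose, blockSum_mul, blockSum_mul,
    transpose_mul_J_mul hA, transpose_mul_J_mul hB]

lemma continuous_blockSum : Continuous fun p : Mat n × Mat 1 => blockSum p.1 p.2 :=
  Continuous.matrix_submatrix (Continuous.matrix_fromBlocks continuous_fst continuous_const
    continuous_const continuous_snd) _ _

lemma hasMatDerivWithinAt_blockSum {Γ : ℝ → Mat n} {ρ : ℝ → Mat 1} {D : Mat n} {E : Mat 1}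
    {S : Set ℝ} {t : ℝ} (hΓ : HasMatDerivWithinAt Γ D S t) (hρ : HasMatDerivWithinAt ρ E S t) :
    HasMatDerivWithinAt (fun t => blockSum (Γ t) (ρ t)) (blockSum D E) S t := by
  intro i j
  simp only [blockSum, Matrix.submatrix_apply]
  rcases (blockEquiv n).symm i with a | a <;> rcases (blockEquiv n).symm j with b | b
  · exact hΓ a b
  · exact hasDerivWithinAt_const _ _ _
  · exact hasDerivWithinAt_const _ _ _
  · exact hρ a b

lemma hasMatDerivWithinAt_conj {Γ : ℝ → Mat n} {D P R : Mat n} {S : Set ℝ} {t : ℝ}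
    (hΓ : HasMatDerivWithinAt Γ D S t) :
    HasMatDerivWithinAt (fun t => P * Γ t * R) (P * D * R) S t := by
  intro i j
  simp only [Matrix.mul_apply]
  refine HasDerivWithinAt.fun_sum fun k _ => HasDerivWithinAt.mul_const ?_ _
  exact HasDerivWithinAt.fun_sum fun l _ => (hΓ l k).const_mul _

/-- A sum of positive subspaces is positive. Superadditivity is enough: applied to forms and their
negatives, it determines both indices when the summands are nondegenerate. -/
lemma sigPos_add_sigPos_le {V V₁ V₂ : Type*} [AddCommGroup V] [Module ℝ V] [FiniteDimensional ℝ V]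
    [AddCommGroup V₁] [Module ℝ V₁] [FiniteDimensional ℝ V₁] [AddCommGroup V₂] [Module ℝ V₂]
    [FiniteDimensional ℝ V₂] {Q : QuadraticForm ℝ V} {Q₁ : QuadraticForm ℝ V₁}
    {Q₂ : QuadraticForm ℝ V₂} (f : (V₁ × V₂) ≃ₗ[ℝ] V) (hf : ∀ x y, Q (f (x, y)) = Q₁ x + Q₂ y) :
    sigPos Q₁ + sigPos Q₂ ≤ sigPos Q := by
  obtain ⟨P₁, hP₁, hP₁'⟩ := exists_finrank_eq_sigPos_and_posDef Q₁
  obtain ⟨P₂, hP₂, hP₂'⟩ := exists_finrank_eq_sigPos_and_posDef Q₂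
  set g : (P₁ × P₂) →ₗ[ℝ] V := f.toLinearMap ∘ₗ (P₁.subtype.prodMap P₂.subtype) with hg
  have hginj : Function.Injective g :=
    f.injective.comp (P₁.injective_subtype.prodMap P₂.injective_subtype)
  have hdim := LinearMap.finrank_range_of_inj hginj
  rw [Module.finrank_prod, hP₁, hP₂] at hdim
  rw [← hdim]
  refine le_sigPos_of_posDef Q ?_
  rintro ⟨_, ⟨⟨x, y⟩, rfl⟩⟩ h0
  rw [QuadraticMap.restrict_apply]
  change 0 < Q (f ((x : V₁), (y : V₂)))
  rw [hf]
  have hx : x ≠ 0 ∨ y ≠ 0 := by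
    by_contra! h
    apply h0
    rw [h.1, h.2]
    exact Subtype.ext (map_zero g)
  have h1 : 0 ≤ Q₁ x := by
    by_cases h : x = 0
    · simp [h]
    · exact (hP₁' x h).le
  have h2 : 0 ≤ Q₂ y := by
    by_cases h : y = 0
    · simp [h]
    · exact (hP₂' y h).le
  rcases hx with h | h
  · have := hP₁' x h
    rw [QuadraticMap.restrict_apply] at this
    linarith
  · have := hP₂' y h
    rw [QuadraticMap.restrict_apply] at this
    linarith

/-- Additivity of the crossing form, up to conjugation. -/
lemma velocityForm_conj_blockSum {A D : Mat n} {B E : Mat 1} {C : Mat (n + 1)}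
    (hC : C ∈ Matrix.symplecticGroup (Fin (n + 1)) ℝ) (hA : IsRegularVelocity A D)
    (hB : IsRegularVelocity B E) :
    IsRegularVelocity (C⁻¹ * blockSum A B * C) (C⁻¹ * blockSum D E * C) ∧
      sigPos (velocityForm (C⁻¹ * blockSum A B * C) (C⁻¹ * blockSum D E * C))
        = sigPos (velocityForm A D) + sigPos (velocityForm B E) ∧
      sigNeg (velocityForm (C⁻¹ * blockSum A B * C) (C⁻¹ * blockSum D E * C))
        = sigNeg (velocityForm A D) + sigNeg (velocityForm B E) := by
  have hu : IsUnit C.det := SymplecticGroup.symplectic_det hC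
  have hCC : C * C⁻¹ = 1 := Matrix.mul_nonsing_inv _ hu
  have hCC' : C⁻¹ * C = 1 := Matrix.nonsing_inv_mul _ hu
  have hmem : ∀ (x : Fin n ⊕ Fin n → ℝ) (y : Fin 1 ⊕ Fin 1 → ℝ),
      (C⁻¹ * blockSum A B * C - 1) *ᵥ (C⁻¹ *ᵥ blockVec x y)
        = C⁻¹ *ᵥ blockVec ((A - 1) *ᵥ x) ((B - 1) *ᵥ y) := by
    intro x y
    have e : C⁻¹ * blockSum A B * C - 1 = C⁻¹ * (blockSum (A - 1) (B - 1)) * C := by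
      rw [← blockSum_sub, blockSum_one, mul_sub, sub_mul, mul_one, hCC']
    rw [e, Matrix.mulVec_mulVec, mul_assoc, hCC, mul_one, ← Matrix.mulVec_mulVec, blockSum_mulVec]
  have hinj : ∀ v w : Fin (n + 1) ⊕ Fin (n + 1) → ℝ, C⁻¹ *ᵥ v = C⁻¹ *ᵥ w → v = w := by
    intro v w h
    have := congrArg (C *ᵥ ·) h
    simpa [Matrix.mulVec_mulVec, hCC] using this
  have hzero : blockVec (0 : Fin n ⊕ Fin n → ℝ) 0 = 0 := by
    have := blockVec_smul (0 : ℝ) (0 : Fin n ⊕ Fin n → ℝ) 0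
    simpa using this
  let g : (LinearMap.ker (Matrix.toLin' (A - 1)) × LinearMap.ker (Matrix.toLin' (B - 1))) →ₗ[ℝ]
      LinearMap.ker (Matrix.toLin' (C⁻¹ * blockSum A B * C - 1)) :=
    { toFun := fun p => ⟨C⁻¹ *ᵥ blockVec p.1 p.2, by
        have h1 := p.1.2
        have h2 := p.2.2
        rw [LinearMap.mem_ker, Matrix.toLin'_apply] at h1 h2 ⊢
        rw [hmem, h1, h2, hzero, Matrix.mulVec_zero]⟩
      map_add' := fun p q => Subtype.ext (by
        change C⁻¹ *ᵥ blockVec ((p.1 : Fin n ⊕ Fin n → ℝ) + q.1)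
          ((p.2 : Fin 1 ⊕ Fin 1 → ℝ) + q.2) = _
        rw [blockVec_add, Matrix.mulVec_add]; rfl)
      map_smul' := fun r p => Subtype.ext (by
        change C⁻¹ *ᵥ blockVec (r • (p.1 : Fin n ⊕ Fin n → ℝ)) (r • (p.2 : Fin 1 ⊕ Fin 1 → ℝ)) = _
        rw [blockVec_smul, Matrix.mulVec_smul]; rfl) }
  have hg : ∀ p, (g p : Fin (n + 1) ⊕ Fin (n + 1) → ℝ) = C⁻¹ *ᵥ blockVec p.1 p.2 := fun _ => rfl
  have hgb : Function.Bijective g := by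
    constructor
    · rintro ⟨x, y⟩ ⟨x', y'⟩ h
      have h1 := hinj _ _ (congrArg Subtype.val h)
      obtain ⟨h2, h3⟩ := blockVec_injective h1
      exact Prod.ext (Subtype.ext h2) (Subtype.ext h3)
    · rintro ⟨u, hu'⟩
      obtain ⟨x, y, hxy⟩ := exists_blockVec (C *ᵥ u)
      have hu2 : u = C⁻¹ *ᵥ blockVec x y := by
        rw [← hxy, Matrix.mulVec_mulVec, hCC', Matrix.one_mulVec]
      rw [LinearMap.mem_ker, Matrix.toLin'_apply, hu2, hmem] at hu'
      rw [← Matrix.mulVec_zero C⁻¹, ← hzero] at hu'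
      obtain ⟨h2, h3⟩ := blockVec_injective (hinj _ _ hu')
      exact ⟨(⟨x, by simpa only [LinearMap.mem_ker, Matrix.toLin'_apply] using h2⟩,
        ⟨y, by simpa only [LinearMap.mem_ker, Matrix.toLin'_apply] using h3⟩), Subtype.ext hu2.symm⟩
  let f := LinearEquiv.ofBijective g hgb
  have hf : ∀ x y, velocityForm (C⁻¹ * blockSum A B * C) (C⁻¹ * blockSum D E * C) (f (x, y))
      = velocityForm A D x + velocityForm B E y := by
    intro x y
    rw [velocityForm_apply, velocityForm_apply, velocityForm_apply]
    change _ *ᵥ (g (x, y) : Fin (n + 1) ⊕ Fin (n + 1) → ℝ) ⬝ᵥ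
      (g (x, y) : Fin (n + 1) ⊕ Fin (n + 1) → ℝ) = _
    rw [hg]
    set JJ := Matrix.J (Fin (n + 1)) ℝ with hJJ
    -- The matrix `C⁻¹` is symplectic as well, so the conjugation drops out of the velocity form.
    have hJC : (C⁻¹)ᵀ * JJᵀ * C⁻¹ = JJᵀ := by
      have := transpose_mul_J_mul hC
      rw [hJJ, Matrix.J_transpose, ← this, ← hJJ]
      rw [mul_neg, neg_mul, ← mul_assoc, ← mul_assoc, ← Matrix.transpose_mul, hCC,
        Matrix.transpose_one, one_mul, mul_assoc, hCC, mul_one, this]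
    rw [Matrix.dotProduct_mulVec, ← Matrix.mulVec_transpose, Matrix.mulVec_mulVec,
      Matrix.mulVec_mulVec, ← mul_assoc]
    have e : (C⁻¹)ᵀ * (JJᵀ * (C⁻¹ * blockSum D E * C) * C⁻¹)
        = blockSum ((Matrix.J (Fin n) ℝ)ᵀ * D) ((Matrix.J (Fin 1) ℝ)ᵀ * E) := by
      calc (C⁻¹)ᵀ * (JJᵀ * (C⁻¹ * blockSum D E * C) * C⁻¹)
          = ((C⁻¹)ᵀ * JJᵀ * C⁻¹) * blockSum D E * (C * C⁻¹) := by simp only [mul_assoc]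
        _ = _ := by
          rw [hJC, hCC, mul_one, hJJ, ← blockSum_J, blockSum_transpose, blockSum_mul]
    rw [← mul_assoc, ← mul_assoc] at e
    rw [e, blockSum_mulVec, blockVec_dotProduct]
  have hneg : ∀ x y, (-velocityForm (C⁻¹ * blockSum A B * C) (C⁻¹ * blockSum D E * C)) (f (x, y))
      = (-velocityForm A D) x + (-velocityForm B E) y := by
    intro x y
    rw [_root_.neg_apply, hf, neg_add, _root_.neg_apply, _root_.neg_apply]
  -- The lower bounds for the positive and negative indices already add up to the full dimension, so
  -- both are equalities.
  have h1 := sigPos_add_sigPos_le f hf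
  have h2 := sigPos_add_sigPos_le f hneg
  simp only [sigPos_neg] at h2
  have h3 := f.finrank_eq
  rw [Module.finrank_prod, ← hA, ← hB] at h3
  have h4 := QuadraticForm.sigPos_add_sigNeg_add_radical
    (Q := velocityForm (C⁻¹ * blockSum A B * C) (C⁻¹ * blockSum D E * C))
  rw [← h3] at h4
  rw [IsRegularVelocity, ← h3]
  omega

end CZ

/-! ### Stabilization by a small rotation loop, and frames over the disk. -/

namespace CZ

variable {n : ℕ}

/-- The rotation by the angle `θ`. -/
def rot (θ : ℝ) : Mat n := Real.cos θ • 1 + Real.sin θ • Matrix.J (Fin n) ℝ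

lemma rot_mem (θ : ℝ) : (rot θ : Mat n) ∈ Matrix.symplecticGroup (Fin n) ℝ := by
  rw [SymplecticGroup.mem_iff', rot]
  simp only [Matrix.transpose_add, Matrix.transpose_smul, Matrix.transpose_one, Matrix.J_transpose,
    add_mul, mul_add, Matrix.smul_mul, Matrix.mul_smul, one_mul, mul_one, neg_mul,
    Matrix.J_squared, smul_neg, neg_neg]
  have h := Real.cos_sq_add_sin_sq θ
  calc _ = (Real.cos θ ^ 2 + Real.sin θ ^ 2) • Matrix.J (Fin n) ℝ := by module
    _ = _ := by rw [h, one_smul]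

lemma continuous_rot : Continuous (rot : ℝ → Mat n) := by
  unfold rot; fun_prop

lemma rot_zero : (rot 0 : Mat n) = 1 := by simp [rot]

/-- Pairing `(rot θ - 1) u = 0` with `u` kills the `J` term and leaves `(cos θ - 1)|u|² = 0`, which
is impossible for such `θ` and `u ≠ 0`. -/
lemma det_rot_sub_one_ne_zero {θ : ℝ} (h0 : 0 < θ) (h1 : θ < 1) :
    ((rot θ : Mat n) - 1).det ≠ 0 := by
  intro h
  obtain ⟨u, hu, hu'⟩ := Matrix.exists_mulVec_eq_zero_iff.2 h
  have h2 := congrArg (u ⬝ᵥ ·) hu'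
  simp only [rot, Matrix.sub_mulVec, Matrix.add_mulVec, Matrix.smul_mulVec, Matrix.one_mulVec,
    dotProduct_sub, dotProduct_add, dotProduct_smul, dotProduct_J_mulVec_self, dotProduct_zero,
    smul_eq_mul, mul_zero, add_zero] at h2
  have h3 : (Real.cos θ - 1) * (u ⬝ᵥ u) = 0 := by linarith
  have h4 : Real.cos θ = 1 := by
    have := (mul_eq_zero.1 h3).resolve_right (dotProduct_self_pos hu).ne'
    linarith
  have := (Real.cos_eq_one_iff_of_lt_of_lt (by linarith [Real.pi_gt_three])
    (by linarith [Real.pi_gt_three])).1 h4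
  linarith

lemma hasMatDerivWithinAt_rot {θ : ℝ → ℝ} {θ' : ℝ} {S : Set ℝ} {t : ℝ}
    (h : HasDerivWithinAt θ θ' S t) :
    HasMatDerivWithinAt (fun t => (rot (θ t) : Mat n))
      ((-Real.sin (θ t) * θ') • 1 + (Real.cos (θ t) * θ') • Matrix.J (Fin n) ℝ) S t := by
  intro i j
  simp only [rot, Matrix.add_apply, Matrix.smul_apply, smul_eq_mul]
  exact ((h.cos).mul_const _).add ((h.sin).mul_const _)

lemma velocityForm_one_smul_J (κ : ℝ) (u : LinearMap.ker (Matrix.toLin' (1 - 1 : Mat n))) :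
    velocityForm (1 : Mat n) (κ • Matrix.J (Fin n) ℝ) u
      = κ * ((u : Fin n ⊕ Fin n → ℝ) ⬝ᵥ (u : Fin n ⊕ Fin n → ℝ)) := by
  rw [velocityForm_apply, Matrix.mul_smul, J_transpose_mul_J, Matrix.smul_mulVec, Matrix.one_mulVec,
    smul_dotProduct, smul_eq_mul]

lemma finrank_ker_zero : Module.finrank ℝ (LinearMap.ker (Matrix.toLin' (1 - 1 : Mat n)))
    = Fintype.card (Fin n ⊕ Fin n) := by
  have : LinearMap.ker (Matrix.toLin' (1 - 1 : Mat n)) = ⊤ := by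
    rw [sub_self, map_zero, LinearMap.ker_zero]
  rw [this, finrank_top, Module.finrank_fintype_fun_eq_card]

lemma velocityForm_one_of_pos {κ : ℝ} (hκ : 0 < κ) :
    sigPos (velocityForm (1 : Mat n) (κ • Matrix.J (Fin n) ℝ)) = Fintype.card (Fin n ⊕ Fin n) ∧
      sigNeg (velocityForm (1 : Mat n) (κ • Matrix.J (Fin n) ℝ)) = 0 := by
  have hpos : ∀ u, u ≠ 0 → 0 < velocityForm (1 : Mat n) (κ • Matrix.J (Fin n) ℝ) u := by
    intro u hu
    rw [velocityForm_one_smul_J]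
    exact mul_pos hκ (dotProduct_self_pos fun h => hu (Subtype.ext h))
  rw [sigPos_eq_finrank_of_posDef hpos, finrank_ker_zero]
  exact ⟨rfl, sigNeg_eq_zero_of_posDef hpos⟩

lemma crossingSignature_eq {T : ℝ} (hT : 0 < T) {Γ : ℝ → Mat n} {D : Mat n} {t : ℝ}
    (ht : t ∈ Icc 0 T) (hD : HasMatDerivWithinAt Γ D (Icc 0 T) t) :
    crossingSignature T Γ t
      = (sigPos (velocityForm (Γ t) D) : ℤ) - (sigNeg (velocityForm (Γ t) D) : ℤ) := by
  rw [← velocity_eq hT ht hD]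
  rfl

lemma velocityForm_one_of_neg {κ : ℝ} (hκ : κ < 0) :
    sigPos (velocityForm (1 : Mat n) (κ • Matrix.J (Fin n) ℝ)) = 0 ∧
      sigNeg (velocityForm (1 : Mat n) (κ • Matrix.J (Fin n) ℝ)) = Fintype.card (Fin n ⊕ Fin n) := by
  have := velocityForm_one_of_pos (n := n) (neg_pos.2 hκ)
  rw [neg_smul, velocityForm_neg, sigPos_neg, sigNeg_neg] at this
  exact this.symm

lemma sig_velocityForm_of_eq_smul_J {κ : ℝ} (hκ : 0 < κ) {A D : Mat n} (hA : A = 1)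
    (hD : D = κ • Matrix.J (Fin n) ℝ) :
    IsRegularVelocity A D ∧ sigPos (velocityForm A D) = Fintype.card (Fin n ⊕ Fin n) ∧
      sigNeg (velocityForm A D) = 0 := by
  subst hA hD
  have h := velocityForm_one_of_pos (n := n) hκ
  exact ⟨by rw [IsRegularVelocity, h.1, h.2, finrank_ker_zero, add_zero], h⟩

lemma sig_velocityForm_of_eq_neg_smul_J {κ : ℝ} (hκ : 0 < κ) {A D : Mat n} (hA : A = 1)
    (hD : D = -κ • Matrix.J (Fin n) ℝ) :
    IsRegularVelocity A D ∧ sigPos (velocityForm A D) = 0 ∧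
      sigNeg (velocityForm A D) = Fintype.card (Fin n ⊕ Fin n) := by
  subst hA hD
  have h := velocityForm_one_of_neg (n := n) (neg_lt_zero.2 hκ)
  exact ⟨by rw [IsRegularVelocity, h.1, h.2, finrank_ker_zero, zero_add], h⟩

lemma sig_velocityForm_eq_zero {A : Mat n} (hA : (A - 1).det ≠ 0) (D : Mat n) :
    sigPos (velocityForm A D) = 0 ∧ sigNeg (velocityForm A D) = 0 := by
  have h := isRegularVelocity_of_det_ne_zero hA D
  rw [IsRegularVelocity] at h
  have h0 : Module.finrank ℝ (LinearMap.ker (Matrix.toLin' (A - 1))) = 0 := by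
    rw [Submodule.finrank_eq_zero, LinearMap.ker_eq_bot']
    intro u hu
    by_contra h0
    exact hA (Matrix.exists_mulVec_eq_zero_iff.1 ⟨u, h0, by rwa [Matrix.toLin'_apply] at hu⟩)
  omega

lemma det_conj_blockSum_sub_one {A : Mat n} {B : Mat 1} {C : Mat (n + 1)}
    (hC : C ∈ Matrix.symplecticGroup (Fin (n + 1)) ℝ) :
    (C⁻¹ * blockSum A B * C - 1).det = (A - 1).det * (B - 1).det := by
  have hu : IsUnit C.det := SymplecticGroup.symplectic_det hC
  have hCC' : C⁻¹ * C = 1 := Matrix.nonsing_inv_mul _ hu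
  have e : C⁻¹ * blockSum A B * C - 1 = C⁻¹ * (blockSum (A - 1) (B - 1)) * C := by
    rw [← blockSum_sub, blockSum_one, mul_sub, sub_mul, mul_one, hCC']
  rw [e, Matrix.det_mul, Matrix.det_mul, mul_right_comm, ← Matrix.det_mul, hCC', Matrix.det_one,
    one_mul, blockSum, Matrix.det_submatrix_equiv_self, Matrix.det_fromBlocks_zero₂₁]

lemma inv_mem {C : Mat n} (hC : C ∈ Matrix.symplecticGroup (Fin n) ℝ) :
    C⁻¹ ∈ Matrix.symplecticGroup (Fin n) ℝ := by
  rw [← SymplecticGroup.coe_inv' ⟨C, hC⟩]; exact Subtype.mem _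

/-- The angle of a rotation path that starts and ends at the identity. -/
def bump (T t : ℝ) : ℝ := t / T * (1 - t / T)

lemma bump_mem {T t : ℝ} (ht : t ∈ Ioo 0 T) : 0 < bump T t ∧ bump T t < 1 := by
  have hT : 0 < T := ht.1.trans ht.2
  have h1 : 0 < t / T := div_pos ht.1 hT
  have h2 : t / T < 1 := (div_lt_one hT).2 ht.2
  unfold bump
  constructor <;> nlinarith

lemma continuous_bump (T : ℝ) : Continuous (bump T) := by unfold bump; fun_prop

lemma hasDerivAt_bump (T t : ℝ) : HasDerivAt (bump T) (1 / T * (1 - t / T) + t / T * -(1 / T)) t := by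
  have h1 : HasDerivAt (fun t : ℝ => t / T) (1 / T) t := (hasDerivAt_id t).div_const T
  exact h1.mul (h1.const_sub 1)

/-- Adding a contractible loop of rotations to a regular path changes neither regularity nor the
crossing number. -/
lemma crossingNumber_conj_blockSum_rot {T : ℝ} (hT : 0 < T) {Γ : ℝ → Mat n}
    (h : IsGoodPath 0 T Γ) {C : Mat (n + 1)}
    (hC : C ∈ Matrix.symplecticGroup (Fin (n + 1)) ℝ) :
    IsRegularPath T (fun t => C⁻¹ * blockSum (Γ t) (rot (bump T t)) * C) ∧
      crossingNumber T (fun t => C⁻¹ * blockSum (Γ t) (rot (bump T t)) * C)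
        = crossingNumber T Γ := by
  classical
  set Γ' : ℝ → Mat (n + 1) := fun t => C⁻¹ * blockSum (Γ t) (rot (bump T t)) * C with hΓ'
  have hb0 : bump T 0 = 0 := by simp [bump]
  have hbT : bump T T = 0 := by simp [bump, hT.ne']
  -- Signatures contributed by the rotations: the loop leaves the identity of `Sp(2)` with velocity
  -- `J / T` and returns with velocity `-J / T`, giving `2` and `-2`, each with weight one half. In
  -- between the angle lies in `(0, 1)` and nothing is contributed.
  set σ : ℝ → ℤ := fun t => if t = 0 then 2 else if t = T then -2 else 0 with hσ
  have hrot : ∀ t ∈ Icc 0 T, ∃ E : Mat 1, HasMatDerivWithinAt (fun t => (rot (bump T t) : Mat 1)) E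
      (Icc 0 T) t ∧ IsRegularVelocity (rot (bump T t)) E ∧
      (sigPos (velocityForm (rot (bump T t) : Mat 1) E) : ℤ)
        - sigNeg (velocityForm (rot (bump T t) : Mat 1) E) = σ t := by
    intro t ht
    refine ⟨_, hasMatDerivWithinAt_rot (hasDerivAt_bump T t).hasDerivWithinAt, ?_⟩
    rcases ht.1.eq_or_lt with rfl | h0
    · have h := sig_velocityForm_of_eq_smul_J (A := rot (bump T 0)) (one_div_pos.2 hT)
        (by rw [hb0, rot_zero]) (D := (-Real.sin (bump T 0) * (1 / T * (1 - 0 / T) + 0 / T * -(1 / T)))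
          • 1 + (Real.cos (bump T 0) * (1 / T * (1 - 0 / T) + 0 / T * -(1 / T)))
            • Matrix.J (Fin 1) ℝ) (by simp [hb0])
      exact ⟨h.1, by rw [h.2.1, h.2.2, hσ]; simp⟩
    · rcases ht.2.eq_or_lt with rfl | h1
      · have h := sig_velocityForm_of_eq_neg_smul_J (A := rot (bump t t)) (one_div_pos.2 hT)
          (by rw [hbT, rot_zero]) (D := (-Real.sin (bump t t) * (1 / t * (1 - t / t) + t / t * -(1 / t)))
            • 1 + (Real.cos (bump t t) * (1 / t * (1 - t / t) + t / t * -(1 / t)))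
              • Matrix.J (Fin 1) ℝ) (by simp [hbT, hT.ne'])
        exact ⟨h.1, by rw [h.2.1, h.2.2, hσ]; simp [hT.ne']⟩
      · have hb := bump_mem ⟨h0, h1⟩
        have hdet := det_rot_sub_one_ne_zero (n := 1) hb.1 hb.2
        refine ⟨isRegularVelocity_of_det_ne_zero hdet _, ?_⟩
        have := sig_velocityForm_eq_zero hdet
        rw [(this _).1, (this _).2, hσ]
        simp [h0.ne', h1.ne]
  have hcross : ∀ t ∈ Icc 0 T, (Γ' t - 1).det = 0 → (Γ t - 1).det = 0 ∨ t = 0 ∨ t = T := by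
    intro t ht hdet
    rw [hΓ', det_conj_blockSum_sub_one hC] at hdet
    by_contra! hcon
    have hb := bump_mem ⟨lt_of_le_of_ne ht.1 hcon.2.1.symm, lt_of_le_of_ne ht.2 hcon.2.2⟩
    exact mul_ne_zero hcon.1 (det_rot_sub_one_ne_zero hb.1 hb.2) hdet
  -- Both ends are crossings of the stabilized path even if they are none of `Γ`; this is why good
  -- paths are differentiable at their ends.
  have hcross' : ∀ t ∈ Icc 0 T, ((Γ t - 1).det = 0 ∨ t = 0 ∨ t = T) → (Γ' t - 1).det = 0 := by
    intro t ht hdet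
    rw [hΓ', det_conj_blockSum_sub_one hC]
    rcases hdet with h1 | rfl | rfl
    · rw [h1, zero_mul]
    · rw [hb0, rot_zero]; simp
    · rw [hbT, rot_zero]; simp
  have hreg : ∀ t ∈ Icc 0 T, (Γ' t - 1).det = 0 → ∃ D, HasMatDerivWithinAt Γ' D (Icc 0 T) t ∧
      IsRegularVelocity (Γ' t) D ∧ (sigPos (velocityForm (Γ' t) D) : ℤ)
        - sigNeg (velocityForm (Γ' t) D) = crossingSignature T Γ t + σ t := by
    intro t ht hdet
    obtain ⟨D, hD, hDr⟩ := h.regular t ht (hcross t ht hdet)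
    obtain ⟨E, hE, hEr, hEs⟩ := hrot t ht
    obtain ⟨h1, h2, h3⟩ := velocityForm_conj_blockSum hC hDr hEr
    refine ⟨_, hasMatDerivWithinAt_conj (hasMatDerivWithinAt_blockSum hD hE), h1, ?_⟩
    rw [h2, h3, ← hEs, crossingSignature_eq hT ht hD]
    push_cast
    ring
  have hcont : ContinuousOn Γ' (Icc 0 T) := by
    have h1 : ContinuousOn (fun t => blockSum (Γ t) (rot (bump T t) : Mat 1)) (Icc 0 T) :=
      continuous_blockSum.comp_continuousOn (h.continuousOn.prodMk
        (continuous_rot.comp (continuous_bump T)).continuousOn)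
    exact (continuousOn_const.mul h1).mul continuousOn_const
  have hsymp : ∀ t ∈ Icc 0 T, Γ' t ∈ Matrix.symplecticGroup (Fin (n + 1)) ℝ := fun t ht =>
    mul_mem (mul_mem (inv_mem hC) (blockSum_mem (h.symplectic t ht) (rot_mem _))) hC
  have hΓ'reg : IsRegularPath T Γ' := isRegularPath_of_regular hT hcont hsymp fun t ht hdet => by
    obtain ⟨D, hD, hDr, -⟩ := hreg t ht hdet
    exact ⟨D, hD, hDr⟩
  refine ⟨hΓ'reg, ?_⟩
  have hΓreg := h.isRegularPath hT
  have hmem0 : (0 : ℝ) ∈ Icc 0 T := left_mem_Icc.2 hT.le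
  have hmemT : T ∈ Icc 0 T := right_mem_Icc.2 hT.le
  rw [crossingNumber, crossingNumber, finsum_mem_eq_finite_toFinset_sum _ hΓ'reg.finite_crossings,
    finsum_mem_eq_finite_toFinset_sum _ hΓreg.finite_crossings]
  set F' := hΓ'reg.finite_crossings.toFinset with hF'
  set F := hΓreg.finite_crossings.toFinset with hF
  have hsig : ∀ t ∈ F', crossingSignature T Γ' t = crossingSignature T Γ t + σ t := by
    intro t ht
    obtain ⟨ht1, ht2⟩ := hΓ'reg.finite_crossings.mem_toFinset.1 ht
    obtain ⟨D, hD, -, hs⟩ := hreg t ht1 ht2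
    rw [← hs, crossingSignature_eq hT ht1 hD]
  have hFF' : F ⊆ F' := fun t ht => by
    obtain ⟨ht1, ht2⟩ := hΓreg.finite_crossings.mem_toFinset.1 ht
    exact hΓ'reg.finite_crossings.mem_toFinset.2 ⟨ht1, hcross' t ht1 (Or.inl ht2)⟩
  have hEF' : ({0, T} : Finset ℝ) ⊆ F' := by
    intro t ht
    rw [Finset.mem_insert, Finset.mem_singleton] at ht
    have ht1 : t ∈ Icc 0 T := by rcases ht with rfl | rfl <;> assumption
    exact hΓ'reg.finite_crossings.mem_toFinset.2 ⟨ht1, hcross' t ht1 (Or.inr ht)⟩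
  rw [Finset.sum_congr rfl fun t ht => by rw [hsig t ht, Int.cast_add, mul_add],
    Finset.sum_add_distrib]
  rw [← Finset.sum_subset hFF' (f := fun t =>
      (if t = 0 ∨ t = T then (1 / 2 : ℝ) else 1) * (crossingSignature T Γ t : ℝ)) ?_,
    ← Finset.sum_subset hEF' (f := fun t =>
      (if t = 0 ∨ t = T then (1 / 2 : ℝ) else 1) * (σ t : ℝ)) ?_, Finset.sum_pair hT.ne]
  · simp [hσ, hT.ne']
  · intro t _ ht
    rw [Finset.mem_insert, Finset.mem_singleton, not_or] at ht
    simp [hσ, ht.1, ht.2]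
  · intro t ht ht'
    obtain ⟨ht1, -⟩ := hΓ'reg.finite_crossings.mem_toFinset.1 ht
    have hdet : (Γ t - 1).det ≠ 0 := fun h0 =>
      ht' (hΓreg.finite_crossings.mem_toFinset.2 ⟨ht1, h0⟩)
    have : crossingSignature T Γ t = 0 := by
      have := sig_velocityForm_eq_zero hdet (velocity T Γ t)
      change (sigPos (velocityForm (Γ t) (velocity T Γ t)) : ℤ)
        - (sigNeg (velocityForm (Γ t) (velocity T Γ t)) : ℤ) = 0
      rw [this.1, this.2]
      rfl
    rw [this, Int.cast_zero, mul_zero]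

/-- Scaling of the disk. -/
def scaleDisk (r : unitInterval) (p : Disk) : Disk :=
  ⟨(r : ℝ) • (p : ℂ), by
    have h := mem_closedBall_zero_iff.1 p.2
    rw [mem_closedBall_zero_iff, norm_smul, Real.norm_of_nonneg r.2.1]
    exact mul_le_one₀ r.2.2 (norm_nonneg _) h⟩

lemma continuous_scaleDisk : Continuous fun q : unitInterval × Disk => scaleDisk q.1 q.2 := by
  unfold scaleDisk
  refine Continuous.subtype_mk ?_ _
  fun_prop

lemma scaleDisk_one (p : Disk) : scaleDisk 1 p = p := Subtype.ext (by simp [scaleDisk])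

lemma scaleDisk_zero (p q : Disk) : scaleDisk 0 p = scaleDisk 0 q :=
  Subtype.ext (by simp [scaleDisk])

lemma boundaryPoint_one : boundaryPoint 1 = boundaryPoint 0 :=
  Subtype.ext (by simp [boundaryPoint])

lemma continuous_boundaryPoint : Continuous boundaryPoint := by
  unfold boundaryPoint
  refine Continuous.subtype_mk ?_ _
  fun_prop

/-- The index is invariant under stabilization by a constant path and under changes of coordinates
along the boundary that extend over the disk. -/
theorem index_eq_of_conj_blockSum {T : ℝ} (hT : 0 < T) {Γ : ℝ → Mat n}
    (hΓc : ContinuousOn Γ (Icc 0 T))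
    (hΓs : ∀ t ∈ Icc 0 T, Γ t ∈ Matrix.symplecticGroup (Fin n) ℝ) {C : Disk → Mat (n + 1)}
    (hCc : Continuous C) (hCs : ∀ p, C p ∈ Matrix.symplecticGroup (Fin (n + 1)) ℝ)
    {Γ₂ : ℝ → Mat (n + 1)}
    (h : ∀ t ∈ Icc 0 T,
      C (boundaryPoint (t / T)) * Γ₂ t = blockSum (Γ t) 1 * C (boundaryPoint 0)) :
    index T Γ₂ = index T Γ := by
  set C₀ := C (boundaryPoint 0) with hC₀
  have hCi : ∀ p, (C p)⁻¹ * C p = 1 := fun p =>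
    Matrix.nonsing_inv_mul _ (SymplecticGroup.symplectic_det (hCs p))
  have hCi' : ∀ p, C p * (C p)⁻¹ = 1 := fun p =>
    Matrix.mul_nonsing_inv _ (SymplecticGroup.symplectic_det (hCs p))
  -- a regular path homotopic to `Γ`
  have hproj : ∀ t ∈ Icc 0 T, ((projIcc 0 T hT.le t : Icc 0 T) : ℝ) = t := fun t ht => by
    rw [projIcc_of_mem hT.le ht]
  obtain ⟨Γ', hgood, hhom'⟩ := exists_isGoodPath_homotopic hT
    (Γ := fun t => Γ (projIcc 0 T hT.le t))
    (hΓc.comp_continuous (by fun_prop) fun t => Subtype.mem _) (fun t => hΓs _ (Subtype.mem _))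
  have hhom : HomotopicOn 0 T Γ Γ' := hhom'.congr hT.le (fun t ht => by rw [hproj t ht])
    fun _ _ => rfl
  rw [index_eq_crossingNumber hT (hgood.isRegularPath hT) hhom]
  obtain ⟨hreg, hnum⟩ := crossingNumber_conj_blockSum_rot hT hgood (hCs (boundaryPoint 0))
  rw [← hnum]
  -- The intermediate path uses the constant frame `C₀`. Up to it, the change of frame is
  -- contracted; from it, `Γ` is deformed to `Γ'` while the identity block opens up to the rotation
  -- loop.
  refine index_eq_crossingNumber hT hreg (HomotopicOn.trans hT.le
    (Γ₁ := fun t => C₀⁻¹ * blockSum (Γ t) 1 * C₀) ?_ ?_)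
  · set pr : ℝ → unitInterval := projIcc 0 1 zero_le_one with hpr
    -- The frame change on the circle of radius `1 - s`. The inverse of `B`, multiplied by the value
    -- of `C` at the base point of the same circle, is a loop based at the identity for every `s`,
    -- so the ends stay fixed; at the centre it is constant.
    set B : ℝ × ℝ → Mat (n + 1) := fun q => C (scaleDisk (pr (1 - q.1)) (boundaryPoint (q.2 / T)))
      with hB
    have hscale : ∀ x : ℝ → ℝ, Continuous x → Continuous fun q : ℝ × ℝ =>
        C (scaleDisk (pr (1 - q.1)) (boundaryPoint (x q.2))) := by
      intro x hx
      refine hCc.comp (continuous_scaleDisk.comp (Continuous.prodMk ?_ ?_))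
      · exact (continuous_projIcc (h := zero_le_one' ℝ)).comp
          (f := fun q : ℝ × ℝ => 1 - q.1) (by fun_prop)
      · exact continuous_boundaryPoint.comp (hx.comp continuous_snd)
    have hBc : Continuous B := hscale (fun t => t / T) (by fun_prop)
    have hB0c : Continuous fun q : ℝ × ℝ => C (scaleDisk (pr (1 - q.1)) (boundaryPoint 0)) :=
      hscale (fun _ => 0) continuous_const
    have hBi : Continuous fun q => (B q)⁻¹ := continuous_iff_continuousAt.2 fun q =>
      (continuousAt_inv (SymplecticGroup.symplectic_det (hCs _)).ne_zero).comp
        (f := B) hBc.continuousAt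
    refine ⟨fun q => (B q)⁻¹ * C (scaleDisk (pr (1 - q.1)) (boundaryPoint 0)) *
      (C₀⁻¹ * blockSum (Γ q.2) 1 * C₀), ?_, ?_, ?_, ?_⟩
    · have h1 : ContinuousOn (fun q : ℝ × ℝ => blockSum (Γ q.2) 1) (Icc (0 : ℝ) 1 ×ˢ Icc 0 T) :=
        continuous_blockSum.comp_continuousOn
          ((hΓc.comp continuousOn_snd fun q hq => hq.2).prodMk continuousOn_const)
      exact (hBi.mul hB0c).continuousOn.mul ((continuousOn_const.mul h1).mul continuousOn_const)
    · intro q hq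
      exact mul_mem (mul_mem (inv_mem (hCs _)) (hCs _)) (mul_mem (mul_mem (inv_mem (hCs _))
        (blockSum_mem (hΓs _ hq.2) (one_mem _))) (hCs _))
    · intro t ht
      constructor
      · have e1 : pr (1 - 0) = 1 := by rw [sub_zero, hpr]; exact projIcc_right _
        simp only [hB, e1, scaleDisk_one]
        have := h t ht
        calc (C (boundaryPoint (t / T)))⁻¹ * C₀ * (C₀⁻¹ * blockSum (Γ t) 1 * C₀)
            = (C (boundaryPoint (t / T)))⁻¹ * ((C₀ * C₀⁻¹) * (blockSum (Γ t) 1 * C₀)) := by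
              simp only [mul_assoc]
          _ = _ := by
              rw [hCi', one_mul, ← this, ← mul_assoc, hCi, one_mul]
      · have e1 : pr (1 - 1) = 0 := by rw [sub_self, hpr]; exact projIcc_left _
        simp only [hB, e1]
        rw [scaleDisk_zero (boundaryPoint (t / T)) (boundaryPoint 0), hCi, one_mul]
    · have hend : ∀ t ∈ Icc 0 T, boundaryPoint (t / T) = boundaryPoint 0 → ∀ s,
          (B (s, t))⁻¹ * C (scaleDisk (pr (1 - s)) (boundaryPoint 0)) *
            (C₀⁻¹ * blockSum (Γ t) 1 * C₀) = Γ₂ t := by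
        intro t ht hbt s
        simp only [hB, hbt]
        rw [hCi, one_mul, mul_assoc, hC₀, ← h t ht, hbt, ← mul_assoc, hCi, one_mul]
      intro s _
      exact ⟨hend 0 (left_mem_Icc.2 hT.le) (by rw [zero_div]) s,
        hend T (right_mem_Icc.2 hT.le) (by rw [div_self hT.ne', boundaryPoint_one]) s⟩
  · obtain ⟨H, h1, h2, h3, h4⟩ := hhom
    refine ⟨fun q => C₀⁻¹ * blockSum (H q) (rot (q.1 * bump T q.2)) * C₀, ?_, ?_, ?_, ?_⟩
    · have h5 : ContinuousOn (fun q : ℝ × ℝ => blockSum (H q) (rot (q.1 * bump T q.2)))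
          (Icc (0 : ℝ) 1 ×ˢ Icc 0 T) := by
        refine continuous_blockSum.comp_continuousOn (h1.prodMk (Continuous.continuousOn ?_))
        exact continuous_rot.comp (continuous_fst.mul ((continuous_bump T).comp continuous_snd))
      exact (continuousOn_const.mul h5).mul continuousOn_const
    · exact fun q hq => mul_mem (mul_mem (inv_mem (hCs _)) (blockSum_mem (h2 q hq) (rot_mem _)))
        (hCs _)
    · intro t ht
      simp only [(h3 t ht).1, (h3 t ht).2, zero_mul, one_mul, rot_zero]
      exact ⟨trivial, rfl⟩
    · intro s hs
      have hb0 : bump T 0 = 0 := by simp [bump]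
      have hbT : bump T T = 0 := by simp [bump, hT.ne']
      simp only [(h4 s hs).1, (h4 s hs).2, hb0, hbT, mul_zero, rot_zero]
      exact ⟨trivial, trivial⟩

end CZ

/-! ### Derivatives of maps of manifolds, as maps of the model spaces. -/

section TangentDerivative

variable {E : Type*} [NormedAddCommGroup E] [NormedSpace ℝ E]
  {M : Type*} [TopologicalSpace M] [ChartedSpace E M]
  {F : Type*} [NormedAddCommGroup F] [NormedSpace ℝ F]
  {N : Type*} [TopologicalSpace N] [ChartedSpace F N]
  {G : Type*} [NormedAddCommGroup G] [NormedSpace ℝ G]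
  {P : Type*} [TopologicalSpace P] [ChartedSpace G P]

variable (E F) in
/-- The derivative of a map between manifolds, as a linear map between the model spaces. -/
def tderiv (f : M → N) (x : M) : E →L[ℝ] F := mfderiv 𝓘(ℝ, E) 𝓘(ℝ, F) f x

lemma tderiv_comp {g : N → P} {f : M → N} {x : M}
    (hg : MDifferentiableAt 𝓘(ℝ, F) 𝓘(ℝ, G) g (f x))
    (hf : MDifferentiableAt 𝓘(ℝ, E) 𝓘(ℝ, F) f x) (u : E) :
    tderiv E G (g ∘ f) x u = tderiv F G g (f x) (tderiv E F f x u) :=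
  DFunLike.congr_fun (mfderiv_comp x hg hf) u

lemma tderiv_congr {f g : M → N} {x : M} (h : f =ᶠ[𝓝 x] g) : tderiv E F f x = tderiv E F g x :=
  h.mfderiv_eq

lemma tderiv_id (x : M) (u : E) : tderiv E E (id : M → M) x u = u :=
  DFunLike.congr_fun (mfderiv_id (I := 𝓘(ℝ, E)) (x := x)) u

lemma tderiv_eq_fderiv (f : E → F) (x : E) : tderiv E F f x = fderiv ℝ f x :=
  mfderiv_eq_fderiv

end TangentDerivative

/-! ### The symplectic form in a chart. -/

section LocalForm

variable {E : Type*} [NormedAddCommGroup E] [NormedSpace ℝ E]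
  {M : Type*} [TopologicalSpace M] [ChartedSpace E M] [IsManifold 𝓘(ℝ, E) ∞ M]

/-- A symplectic form as a family of bilinear forms on the model space. -/
def SymplecticForm.bilin (Ω : SymplecticForm E M) (x : M) : E →L[ℝ] E →L[ℝ] ℝ := Ω.toFun x

lemma SymplecticForm.bilin_self (Ω : SymplecticForm E M) (x : M) (u : E) : Ω.bilin x u u = 0 :=
  Ω.alternating x u

lemma SymplecticForm.eq_zero_of_bilin (Ω : SymplecticForm E M) {x : M} {u : E}
    (h : ∀ v, Ω.bilin x u v = 0) : u = 0 :=
  Ω.nondegenerate x u h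

lemma SymplecticForm.neg_swap (Ω : SymplecticForm E M) (x : M) (u v : E) :
    Ω.bilin x u v = -Ω.bilin x v u := by
  have h := Ω.bilin_self x (u + v)
  simp only [map_add, _root_.add_apply, Ω.bilin_self] at h
  linarith

lemma contMDiffAt_extChartAt_symm {x₀ : M} {y : E} (hy : y ∈ (extChartAt 𝓘(ℝ, E) x₀).target) :
    ContMDiffAt 𝓘(ℝ, E) 𝓘(ℝ, E) ∞ (extChartAt 𝓘(ℝ, E) x₀).symm y :=
  (contMDiffOn_extChartAt_symm x₀).contMDiffAt ((isOpen_extChartAt_target x₀).mem_nhds hy)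

/-- The coordinate vector fields of a chart are smooth. -/
lemma contMDiffAt_mfderiv_extChartAt_symm {x₀ : M} {y : E}
    (hy : y ∈ (extChartAt 𝓘(ℝ, E) x₀).target) (u : E) :
    ContMDiffAt 𝓘(ℝ, E) 𝓘(ℝ, E).tangent ∞
      (fun y => (⟨(extChartAt 𝓘(ℝ, E) x₀).symm y,
        tderiv E E (extChartAt 𝓘(ℝ, E) x₀).symm y u⟩ : TangentBundle 𝓘(ℝ, E) M)) y := by
  have ht := isOpen_extChartAt_target (I := 𝓘(ℝ, E)) x₀
  have h1 := (contMDiffOn_extChartAt_symm (I := 𝓘(ℝ, E)) (n := ∞) x₀).contMDiffOn_tangentMapWithin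
    (m := ∞) le_rfl ht.uniqueMDiffOn
  have h2 : ContMDiff 𝓘(ℝ, E) 𝓘(ℝ, E).tangent ∞ (fun y : E => (⟨y, u⟩ : TangentBundle 𝓘(ℝ, E) E)) :=
    contMDiff_vectorSpace_iff_contDiff.2 contDiff_const
  have h3 := (h1.comp h2.contMDiffOn (s := (extChartAt 𝓘(ℝ, E) x₀).target)
    (fun y hy => hy)).contMDiffAt (ht.mem_nhds hy)
  refine h3.congr_of_eventuallyEq ?_
  filter_upwards [ht.mem_nhds hy] with y hy
  simp only [Function.comp, tangentMapWithin, mfderivWithin_of_isOpen ht hy]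
  rfl

/-- The form `Ω` in the coordinates of the chart at `x₀`, as a bilinear form. -/
def chartForm (Ω : SymplecticForm E M) (x₀ : M) (y : E) : E →L[ℝ] E →L[ℝ] ℝ :=
  (Ω.bilin ((extChartAt 𝓘(ℝ, E) x₀).symm y)).bilinearComp
    (tderiv E E (extChartAt 𝓘(ℝ, E) x₀).symm y) (tderiv E E (extChartAt 𝓘(ℝ, E) x₀).symm y)

lemma chartForm_apply (Ω : SymplecticForm E M) (x₀ : M) (y u v : E) :
    chartForm Ω x₀ y u v = Ω.bilin ((extChartAt 𝓘(ℝ, E) x₀).symm y)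
      (tderiv E E (extChartAt 𝓘(ℝ, E) x₀).symm y u)
      (tderiv E E (extChartAt 𝓘(ℝ, E) x₀).symm y v) := rfl

lemma contDiffAt_chartForm_apply (Ω : SymplecticForm E M) {x₀ : M} {y : E}
    (hy : y ∈ (extChartAt 𝓘(ℝ, E) x₀).target) (u v : E) :
    ContDiffAt ℝ ∞ (fun y => chartForm Ω x₀ y u v) y := by
  have h1 := contMDiffAt_mfderiv_extChartAt_symm hy u
  have h2 := contMDiffAt_mfderiv_extChartAt_symm hy v
  have h3 := (Ω.smooth.contMDiffAt (x := (extChartAt 𝓘(ℝ, E) x₀).symm y)).comp y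
    (contMDiffAt_extChartAt_symm hy)
  have h4 := ContMDiffAt.clm_bundle_apply₂ (F₃ := ℝ) (E₃ := Bundle.Trivial M ℝ) h3 h1 h2
  have h5 := Bundle.contMDiffAt_totalSpace.1 h4
  exact h5.2.contDiffAt

lemma contDiffAt_chartForm [FiniteDimensional ℝ E] (Ω : SymplecticForm E M) {x₀ : M} {y : E}
    (hy : y ∈ (extChartAt 𝓘(ℝ, E) x₀).target) : ContDiffAt ℝ ∞ (chartForm Ω x₀) y := by
  have ht := isOpen_extChartAt_target (I := 𝓘(ℝ, E)) x₀
  refine ContDiffOn.contDiffAt (s := (extChartAt 𝓘(ℝ, E) x₀).target) ?_ (ht.mem_nhds hy)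
  refine contDiffOn_clm_apply.2 fun u => contDiffOn_clm_apply.2 fun v => ?_
  exact fun y hy => (contDiffAt_chartForm_apply Ω hy u v).contDiffWithinAt

lemma chartForm_neg_swap (Ω : SymplecticForm E M) (x₀ : M) (y u v : E) :
    chartForm Ω x₀ y u v = -chartForm Ω x₀ y v u := Ω.neg_swap _ _ _

set_option synthInstance.maxHeartbeats 200000 in
-- Closedness is assumed for the scalar functions obtained from constant vectors; their derivatives
-- are the evaluations of the derivative of the operator-valued form.
lemma chartForm_closed [FiniteDimensional ℝ E] (Ω : SymplecticForm E M) {x₀ : M} {y : E}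
    (hy : y ∈ (extChartAt 𝓘(ℝ, E) x₀).target) (u v w : E) :
    fderiv ℝ (chartForm Ω x₀) y u v w + fderiv ℝ (chartForm Ω x₀) y v w u
      + fderiv ℝ (chartForm Ω x₀) y w u v = 0 := by
  have hd : HasFDerivAt (chartForm Ω x₀) (fderiv ℝ (chartForm Ω x₀) y) y :=
    ((contDiffAt_chartForm Ω hy).differentiableAt (by simp)).hasFDerivAt
  have key : ∀ a b c : E, fderiv ℝ (fun y => localForm Ω.toFun x₀ y a b) y c
      = fderiv ℝ (chartForm Ω x₀) y c a b := by
    intro a b c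
    have h1 := (hd.clm_apply (hasFDerivAt_const a y)).clm_apply (hasFDerivAt_const b y)
    have h2 : HasFDerivAt (fun y => localForm Ω.toFun x₀ y a b) _ y := h1
    rw [h2.fderiv]
    simp
  rw [← key, ← key, ← key]
  exact Ω.closed x₀ y hy u v w

lemma mdifferentiableAt_extChartAt_symm {x₀ : M} {y : E}
    (hy : y ∈ (extChartAt 𝓘(ℝ, E) x₀).target) :
    MDifferentiableAt 𝓘(ℝ, E) 𝓘(ℝ, E) (extChartAt 𝓘(ℝ, E) x₀).symm y :=
  (contMDiffAt_extChartAt_symm hy).mdifferentiableAt (by simp)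

lemma tderiv_extChartAt_comp_symm {x₀ : M} {y : E}
    (hy : y ∈ (extChartAt 𝓘(ℝ, E) x₀).target) (u : E) :
    tderiv E E (extChartAt 𝓘(ℝ, E) x₀) ((extChartAt 𝓘(ℝ, E) x₀).symm y)
      (tderiv E E (extChartAt 𝓘(ℝ, E) x₀).symm y u) = u := by
  have h := mfderiv_extChartAt_comp_mfderivWithin_extChartAt_symm (I := 𝓘(ℝ, E)) hy
  rw [ModelWithCorners.range_eq_univ, mfderivWithin_univ] at h
  exact DFunLike.congr_fun h u

lemma tderiv_extChartAt_symm_comp {x₀ x : M} (hx : x ∈ (extChartAt 𝓘(ℝ, E) x₀).source) (u : E) :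
    tderiv E E (extChartAt 𝓘(ℝ, E) x₀).symm (extChartAt 𝓘(ℝ, E) x₀ x)
      (tderiv E E (extChartAt 𝓘(ℝ, E) x₀) x u) = u := by
  have h := mfderivWithin_extChartAt_symm_comp_mfderiv_extChartAt' (I := 𝓘(ℝ, E)) hx
  rw [ModelWithCorners.range_eq_univ, mfderivWithin_univ] at h
  exact DFunLike.congr_fun h u

lemma tderiv_extChartAt_comp_symm' {x₀ x : M} (hx : x ∈ (extChartAt 𝓘(ℝ, E) x₀).source) (u : E) :
    tderiv E E (extChartAt 𝓘(ℝ, E) x₀) x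
      (tderiv E E (extChartAt 𝓘(ℝ, E) x₀).symm (extChartAt 𝓘(ℝ, E) x₀ x) u) = u := by
  have h := tderiv_extChartAt_comp_symm ((extChartAt 𝓘(ℝ, E) x₀).map_source hx) u
  rwa [(extChartAt 𝓘(ℝ, E) x₀).left_inv hx] at h

lemma chartForm_nondegenerate (Ω : SymplecticForm E M) {x₀ : M} {y : E}
    (hy : y ∈ (extChartAt 𝓘(ℝ, E) x₀).target) {u : E} (hu : ∀ v, chartForm Ω x₀ y u v = 0) :
    u = 0 := by
  have h0 : tderiv E E (extChartAt 𝓘(ℝ, E) x₀).symm y u = 0 := Ω.eq_zero_of_bilin fun v => by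
    have hs := (extChartAt 𝓘(ℝ, E) x₀).map_target hy
    have h := hu (tderiv E E (extChartAt 𝓘(ℝ, E) x₀) ((extChartAt 𝓘(ℝ, E) x₀).symm y) v)
    rw [chartForm_apply] at h
    have h2 := tderiv_extChartAt_symm_comp hs v
    rw [(extChartAt 𝓘(ℝ, E) x₀).right_inv hy] at h2
    rwa [h2] at h
  rw [← tderiv_extChartAt_comp_symm hy u, h0, map_zero]

end LocalForm

/-! ### Pullback of a closed form along solutions of Hamilton's equations. -/

section HamiltonCalculus

variable {E : Type*} [NormedAddCommGroup E] [NormedSpace ℝ E]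

/-- The product rule, at the point `x₀` of the base, for a family of bilinear forms `b` whose
derivative at `x₀` in the direction `a` is `b' a`. -/
def HasFormDerivAt (b b' : E → E → E → ℝ) (x₀ : E) : Prop :=
  ∀ (x p q : ℝ → E) (x' p' q' : E) (s : ℝ), x s = x₀ → HasDerivAt x x' s → HasDerivAt p p' s →
    HasDerivAt q q' s → HasDerivAt (fun s => b (x s) (p s) (q s))
      (b' x' (p s) (q s) + b (x s) p' (q s) + b (x s) (p s) q') s

/-- If `F` solves Hamilton's equations for a closed `2`-form `b`, then the derivative at time `t₀` of
the pullback of `b` by `F (t, ·)` vanishes. -/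
lemma hasDerivAt_pullback_of_hamilton {b b' : E → E → E → ℝ} {F : ℝ × E → E} {k : E → ℝ}
    {t₀ : ℝ} {y₀ : E} (hb : HasFormDerivAt b b' (F (t₀, y₀)))
    (hzero : ∀ y u, b y u 0 = 0)
    (hswap : ∀ y u v, b y u v = -b y v u)
    (hclosed : ∀ u v w, b' u v w + b' v w u + b' w u v = 0)
    (hF : ContDiffAt ℝ 2 F (t₀, y₀)) (hk : ContDiffAt ℝ 2 k (F (t₀, y₀)))
    (hODE : ∀ᶠ y in 𝓝 y₀, ∀ w,
      b (F (t₀, y)) (fderiv ℝ F (t₀, y) (1, 0)) w = -fderiv ℝ k (F (t₀, y)) w) (u v : E) :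
    HasDerivAt (fun t => b (F (t, y₀)) (fderiv ℝ F (t, y₀) (0, u)) (fderiv ℝ F (t, y₀) (0, v)))
      0 t₀ := by
  have hF1 : HasFDerivAt F (fderiv ℝ F (t₀, y₀)) (t₀, y₀) :=
    (hF.differentiableAt (by norm_num)).hasFDerivAt
  have hF2 : HasFDerivAt (fderiv ℝ F) (fderiv ℝ (fderiv ℝ F) (t₀, y₀)) (t₀, y₀) :=
    ((hF.fderiv_right (m := 1) (by norm_num)).differentiableAt (by norm_num)).hasFDerivAt
  have hk2 : HasFDerivAt (fderiv ℝ k) (fderiv ℝ (fderiv ℝ k) (F (t₀, y₀))) (F (t₀, y₀)) :=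
    ((hk.fderiv_right (m := 1) (by norm_num)).differentiableAt (by norm_num)).hasFDerivAt
  have hFsymm : IsSymmSndFDerivAt ℝ F (t₀, y₀) := hF.isSymmSndFDerivAt (by simp)
  have hksymm : IsSymmSndFDerivAt ℝ k (F (t₀, y₀)) := hk.isSymmSndFDerivAt (by simp)
  set F' := fderiv ℝ F (t₀, y₀)
  set F'' := fderiv ℝ (fderiv ℝ F) (t₀, y₀)
  set k'' := fderiv ℝ (fderiv ℝ k) (F (t₀, y₀))
  -- derivatives along curves through `(t₀, y₀)`
  have along : ∀ (c : ℝ → ℝ × E) (c' : ℝ × E) (s₀ : ℝ), HasDerivAt c c' s₀ → c s₀ = (t₀, y₀) →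
      HasDerivAt (fun s => F (c s)) (F' c') s₀ ∧
      (∀ a, HasDerivAt (fun s => fderiv ℝ F (c s) a) (F'' c' a) s₀) ∧
      (∀ w, HasDerivAt (fun s => fderiv ℝ k (F (c s)) w) (k'' (F' c') w) s₀) := by
    intro c c' s₀ hc hc0
    rw [← hc0] at hF1 hF2
    have h1 : HasDerivAt (fun s => F (c s)) (F' c') s₀ := hF1.comp_hasDerivAt s₀ hc
    have h2 : HasDerivAt (fun s => fderiv ℝ F (c s)) (F'' c') s₀ := hF2.comp_hasDerivAt s₀ hc
    rw [← hc0] at hk2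
    have h4 : HasDerivAt (fun s => fderiv ℝ k (F (c s))) (k'' (F' c')) s₀ :=
      HasFDerivAt.comp_hasDerivAt (f := fun s => F (c s)) s₀ hk2 h1
    refine ⟨h1, fun a => ?_, fun w => ?_⟩
    · simpa using h2.clm_apply (hasDerivAt_const s₀ a)
    · simpa using h4.clm_apply (hasDerivAt_const s₀ w)
  have htime : HasDerivAt (fun t : ℝ => (t, y₀)) ((1 : ℝ), (0 : E)) t₀ :=
    (hasDerivAt_id t₀).prodMk (hasDerivAt_const t₀ y₀)
  have hspace : ∀ u : E, HasDerivAt (fun s : ℝ => (t₀, y₀ + s • u)) ((0 : ℝ), u) 0 := fun u => by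
    have : HasDerivAt (fun s : ℝ => y₀ + s • u) u 0 := by
      simpa using ((hasDerivAt_id (0 : ℝ)).smul_const u).const_add y₀
    exact (hasDerivAt_const (0 : ℝ) t₀).prodMk this
  -- Hamilton's equation holds for all initial points near `y₀`, so it may be differentiated along
  -- the line `y₀ + s u`.
  have hdiff : ∀ u w, b' (F' (0, u)) (F' (1, 0)) w + b (F (t₀, y₀)) (F'' (0, u) (1, 0)) w
      = -k'' (F' (0, u)) w := by
    intro u w
    obtain ⟨h1, h2, h3⟩ := along _ _ 0 (hspace u) (by simp)
    have hl := hb _ _ _ _ _ _ 0 (by simp) h1 (h2 (1, 0)) (hasDerivAt_const (0 : ℝ) w)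
    have hr := (h3 w).neg
    have hev : ∀ᶠ s : ℝ in 𝓝 0, -fderiv ℝ k (F (t₀, y₀ + s • u)) w
        = b (F (t₀, y₀ + s • u)) (fderiv ℝ F (t₀, y₀ + s • u) (1, 0)) w := by
      have hc : Filter.Tendsto (fun s : ℝ => y₀ + s • u) (𝓝 0) (𝓝 y₀) := by
        have : Continuous fun s : ℝ => y₀ + s • u := by fun_prop
        simpa using this.tendsto 0
      filter_upwards [hc.eventually hODE] with s hs
      rw [hs w]
    have := (hl.congr_of_eventuallyEq hev).unique hr
    simpa [F', hzero] using this
  obtain ⟨h1, h2, -⟩ := along _ _ t₀ htime rfl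
  refine (hb _ _ _ _ _ _ t₀ rfl h1 (h2 (0, u)) (h2 (0, v))).congr_deriv ?_
  change b' (F' (1, 0)) (F' (0, u)) (F' (0, v)) + b (F (t₀, y₀)) (F'' (1, 0) (0, u)) (F' (0, v))
    + b (F (t₀, y₀)) (F' (0, u)) (F'' (1, 0) (0, v)) = 0
  -- Antisymmetry of `b'` follows by differentiating `hswap` along a line.
  have hswap' : ∀ a p q, b' a p q = -b' a q p := by
    intro a p q
    have hc : HasDerivAt (fun s : ℝ => F (t₀, y₀) + s • a) a 0 := by
      simpa using ((hasDerivAt_id (0 : ℝ)).smul_const a).const_add (F (t₀, y₀))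
    have h1 := hb _ _ _ _ _ _ 0 (by simp) hc (hasDerivAt_const 0 p) (hasDerivAt_const 0 q)
    have h2 := (hb _ _ _ _ _ _ 0 (by simp) hc (hasDerivAt_const 0 q) (hasDerivAt_const 0 p)).neg
    have h3 := h1.unique (h2.congr_of_eventuallyEq
      (Filter.Eventually.of_forall fun s => hswap _ _ _))
    simpa [hzero, hswap _ 0] using h3
  -- Antisymmetrizing the differentiated equation in `u` and `v` cancels the Hessian of `k`.
  -- Closedness trades the remaining derivatives of `b` for the derivative in the direction of the
  -- flow, and symmetry of `F''` exchanges time and space derivatives.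
  have e1 := hdiff u (F' (0, v))
  have e2 := hdiff v (F' (0, u))
  rw [hksymm (F' (0, v)) (F' (0, u))] at e2
  have e3 := hclosed (F' (1, 0)) (F' (0, u)) (F' (0, v))
  have e4 := hswap' (F' (0, v)) (F' (1, 0)) (F' (0, u))
  have e5 := hswap' (F' (0, u)) (F' (1, 0)) (F' (0, v))
  have e6 := hswap (F (t₀, y₀)) (F'' (0, v) (1, 0)) (F' (0, u))
  rw [hFsymm (1, 0) (0, u), hFsymm (1, 0) (0, v)]
  linarith

set_option synthInstance.maxHeartbeats 200000 in
lemma hasFormDerivAt_of_differentiableAt {b : E → E →L[ℝ] E →L[ℝ] ℝ} {x₀ : E}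
    (hb : DifferentiableAt ℝ b x₀) :
    HasFormDerivAt (fun y u v => b y u v) (fun a u v => fderiv ℝ b x₀ a u v) x₀ := by
  intro x p q x' p' q' s hs hx hp hq
  subst hs
  have h1 := HasFDerivAt.comp_hasDerivAt (𝕜 := ℝ) (E := E →L[ℝ] E →L[ℝ] ℝ) (F := E) (l := b)
    (l' := fderiv ℝ b (x s)) s hb.hasFDerivAt hx
  have h2 := (h1.clm_apply hp).clm_apply hq
  refine h2.congr_deriv ?_
  simp only [_root_.add_apply, Function.comp]

end HamiltonCalculus

/-! ### Hamiltonian vector fields and flows in charts. -/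

section HamiltonianFlow

variable {E : Type*} [NormedAddCommGroup E] [NormedSpace ℝ E]
  {M : Type*} [TopologicalSpace M] [ChartedSpace E M] [IsManifold 𝓘(ℝ, E) ∞ M]

/-- Nondegeneracy is injectivity into the dual space, hence surjectivity in finite dimension. It
guarantees that the vectors selected by choice in the definitions of the Hamiltonian vector field
and of the gradient have their defining property. -/
lemma SymplecticForm.exists_bilin_eq [FiniteDimensional ℝ E] (Ω : SymplecticForm E M) (x : M)
    (l : E →L[ℝ] ℝ) : ∃ u, ∀ v, Ω.bilin x u v = l v := by
  let B : E →ₗ[ℝ] Module.Dual ℝ E :=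
    (ContinuousLinearMap.coeLM ℝ).comp (Ω.bilin x : E →ₗ[ℝ] (E →L[ℝ] ℝ))
  have hB : Function.Injective B := by
    refine (injective_iff_map_eq_zero B).2 fun u hu => Ω.eq_zero_of_bilin (x := x) fun v => ?_
    exact DFunLike.congr_fun hu v
  have hs := (LinearMap.injective_iff_surjective_of_finrank_eq_finrank
    (Subspace.dual_finrank_eq (K := ℝ) (V := E)).symm).1 hB
  obtain ⟨u, hu⟩ := hs (l : E →ₗ[ℝ] ℝ)
  exact ⟨u, fun v => DFunLike.congr_fun hu v⟩

lemma SymplecticForm.bilin_injective (Ω : SymplecticForm E M) {x : M} {u u' : E}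
    (h : ∀ v, Ω.bilin x u v = Ω.bilin x u' v) : u = u' := by
  rw [← sub_eq_zero]
  refine Ω.eq_zero_of_bilin (x := x) fun v => ?_
  rw [map_sub, _root_.sub_apply, h, sub_self]

/-- The Hamiltonian vector field as a vector of the model space. -/
def hamVec (Ω : SymplecticForm E M) (H : M → ℝ) (x : M) : E := hamiltonianVectorField Ω H x

lemma bilin_hamVec [FiniteDimensional ℝ E] (Ω : SymplecticForm E M) (H : M → ℝ) (x : M) (v : E) :
    Ω.bilin x (hamVec Ω H x) v = -tderiv E ℝ H x v := by
  obtain ⟨u, hu⟩ := Ω.exists_bilin_eq x (-tderiv E ℝ H x)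
  exact Classical.epsilon_spec (p := fun u : TangentSpace 𝓘(ℝ, E) x =>
    ∀ v, Ω.toFun x u v = -(mfderiv 𝓘(ℝ, E) 𝓘(ℝ, ℝ) H x v : ℝ)) ⟨u, hu⟩ v

lemma eq_hamVec [FiniteDimensional ℝ E] {Ω : SymplecticForm E M} {H : M → ℝ} {x : M} {u : E}
    (h : ∀ v, Ω.bilin x u v = -tderiv E ℝ H x v) : u = hamVec Ω H x :=
  Ω.bilin_injective fun v => by rw [h, bilin_hamVec]

/-- Hamilton's equations in a chart. -/
lemma hasDerivAt_chart_of_solution [FiniteDimensional ℝ E] {Ω : SymplecticForm E M}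
    {H : M → ℝ} {η : ℝ → M} {t : ℝ} {p : M}
    {L : ℝ →L[ℝ] E} (hη : HasMFDerivAt 𝓘(ℝ, ℝ) 𝓘(ℝ, E) η t L) (hL : L 1 = hamVec Ω H (η t))
    (hH : MDifferentiableAt 𝓘(ℝ, E) 𝓘(ℝ, ℝ) H (η t)) (hp : η t ∈ (extChartAt 𝓘(ℝ, E) p).source) :
    ∃ v, HasDerivAt (fun s => extChartAt 𝓘(ℝ, E) p (η s)) v t ∧
      ∀ w, chartForm Ω p (extChartAt 𝓘(ℝ, E) p (η t)) v w
        = -fderiv ℝ (fun y => H ((extChartAt 𝓘(ℝ, E) p).symm y)) (extChartAt 𝓘(ℝ, E) p (η t)) w := by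
  have hk : MDifferentiableAt 𝓘(ℝ, E) 𝓘(ℝ, E) (extChartAt 𝓘(ℝ, E) p) (η t) :=
    mdifferentiableAt_extChartAt (by rwa [extChartAt_source] at hp)
  have hd : HasFDerivAt (fun s => extChartAt 𝓘(ℝ, E) p (η s))
      ((tderiv E E (extChartAt 𝓘(ℝ, E) p) (η t)).comp L) t :=
    (hk.hasMFDerivAt.comp t hη).hasFDerivAt
  refine ⟨tderiv E E (extChartAt 𝓘(ℝ, E) p) (η t) (hamVec Ω H (η t)), ?_, fun w => ?_⟩
  · refine hd.hasDerivAt.congr_deriv ?_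
    exact congrArg (tderiv E E (extChartAt 𝓘(ℝ, E) p) (η t)) hL
  · have ht := (extChartAt 𝓘(ℝ, E) p).map_source hp
    have hH' : MDifferentiableAt 𝓘(ℝ, E) 𝓘(ℝ, ℝ) H
        ((extChartAt 𝓘(ℝ, E) p).symm (extChartAt 𝓘(ℝ, E) p (η t))) := by
      rwa [(extChartAt 𝓘(ℝ, E) p).left_inv hp]
    have hc := tderiv_comp hH' (mdifferentiableAt_extChartAt_symm ht) w
    rw [tderiv_eq_fderiv] at hc
    change _ = -fderiv ℝ (H ∘ (extChartAt 𝓘(ℝ, E) p).symm) _ w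
    rw [hc, chartForm_apply, (extChartAt 𝓘(ℝ, E) p).left_inv hp, tderiv_extChartAt_symm_comp hp,
      bilin_hamVec]

lemma contMDiff_slice {h : M × ℝ → ℝ}
    (hh : ContMDiff (𝓘(ℝ, E).prod 𝓘(ℝ, ℝ)) 𝓘(ℝ, ℝ) ∞ h) (t : ℝ) :
    ContMDiff 𝓘(ℝ, E) 𝓘(ℝ, ℝ) ∞ (fun x => h (x, t)) :=
  hh.comp (contMDiff_id.prodMk contMDiff_const)

variable {X : ∀ (_ : ℝ) (x : M), TangentSpace 𝓘(ℝ, E) x} {D : Set (ℝ × M)} {φ : ℝ → M → M}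

lemma IsFlow.contMDiffAt_time (hφ : IsFlow X D φ) {t : ℝ} {x : M} (h : (t, x) ∈ D) :
    ContMDiffAt 𝓘(ℝ, E) 𝓘(ℝ, E) ∞ (φ t) x := by
  have h1 := hφ.smooth.contMDiffAt (hφ.isOpen.mem_nhds h)
  exact ContMDiffAt.comp x (f := fun y => (t, y)) h1 (contMDiffAt_const.prodMk contMDiffAt_id)

lemma IsFlow.mdifferentiableAt (hφ : IsFlow X D φ) {t : ℝ} {x : M} (h : (t, x) ∈ D) :
    MDifferentiableAt 𝓘(ℝ, E) 𝓘(ℝ, E) (φ t) x :=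
  (hφ.contMDiffAt_time h).mdifferentiableAt (by simp)

lemma IsFlow.isOpen_times (hφ : IsFlow X D φ) (x : M) : IsOpen {t : ℝ | (t, x) ∈ D} :=
  hφ.isOpen.preimage (by fun_prop : Continuous fun t : ℝ => (t, x))

variable (E) in
/-- The flow in the charts at `x` and at `p`. -/
def chartFlow (φ : ℝ → M → M) (x p : M) (q : ℝ × E) : E :=
  extChartAt 𝓘(ℝ, E) p (φ q.1 ((extChartAt 𝓘(ℝ, E) x).symm q.2))

variable (E) in
/-- The domain of the flow in the charts at `x` and at `p`. -/
def chartFlowDomain (D : Set (ℝ × M)) (φ : ℝ → M → M) (x p : M) : Set (ℝ × E) :=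
  {q | q.2 ∈ (extChartAt 𝓘(ℝ, E) x).target ∧ (q.1, (extChartAt 𝓘(ℝ, E) x).symm q.2) ∈ D ∧
    φ q.1 ((extChartAt 𝓘(ℝ, E) x).symm q.2) ∈ (extChartAt 𝓘(ℝ, E) p).source}

lemma contMDiffOn_prod_symm (x : M) :
    ContMDiffOn 𝓘(ℝ, ℝ × E) (𝓘(ℝ, ℝ).prod 𝓘(ℝ, E)) ∞
      (fun q : ℝ × E => (q.1, (extChartAt 𝓘(ℝ, E) x).symm q.2))
      {q | q.2 ∈ (extChartAt 𝓘(ℝ, E) x).target} := by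
  refine ContMDiffOn.prodMk contDiff_fst.contMDiff.contMDiffOn ?_
  exact (contMDiffOn_extChartAt_symm x).comp contDiff_snd.contMDiff.contMDiffOn fun q hq => hq

lemma IsFlow.contMDiffOn_chart (hφ : IsFlow X D φ) (x : M) :
    ContMDiffOn 𝓘(ℝ, ℝ × E) 𝓘(ℝ, E) ∞
      (fun q : ℝ × E => φ q.1 ((extChartAt 𝓘(ℝ, E) x).symm q.2))
      {q | q.2 ∈ (extChartAt 𝓘(ℝ, E) x).target ∧
        (q.1, (extChartAt 𝓘(ℝ, E) x).symm q.2) ∈ D} :=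
  hφ.smooth.comp ((contMDiffOn_prod_symm x).mono fun _ hq => hq.1) fun _ hq => hq.2

lemma IsFlow.isOpen_chartFlowDomain (hφ : IsFlow X D φ) (x p : M) :
    IsOpen (chartFlowDomain E D φ x p) := by
  have h1 : IsOpen {q : ℝ × E | q.2 ∈ (extChartAt 𝓘(ℝ, E) x).target} :=
    (isOpen_extChartAt_target x).preimage continuous_snd
  have h2 := (contMDiffOn_prod_symm x).continuousOn.isOpen_inter_preimage h1 hφ.isOpen
  have h3 := (hφ.contMDiffOn_chart x).continuousOn.isOpen_inter_preimage h2
    (isOpen_extChartAt_source (I := 𝓘(ℝ, E)) p)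
  convert h3 using 1
  ext q
  simp only [chartFlowDomain, mem_ofPred_eq, mem_inter_iff, mem_preimage, and_assoc]

lemma IsFlow.contDiffAt_chartFlow (hφ : IsFlow X D φ) {x p : M} {q : ℝ × E}
    (hq : q ∈ chartFlowDomain E D φ x p) : ContDiffAt ℝ ∞ (chartFlow E φ x p) q := by
  have h1 : ContMDiffOn 𝓘(ℝ, ℝ × E) 𝓘(ℝ, E) ∞ (chartFlow E φ x p) (chartFlowDomain E D φ x p) :=
    (contMDiffOn_extChartAt (x := p)).comp
      ((hφ.contMDiffOn_chart x).mono fun q hq => ⟨hq.1, hq.2.1⟩) fun q hq => by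
        have := hq.2.2
        rwa [extChartAt_source] at this
  exact (h1.contMDiffAt ((hφ.isOpen_chartFlowDomain x p).mem_nhds hq)).contDiffAt

lemma symm_chartFlow {x p : M} {q : ℝ × E} (hq : q ∈ chartFlowDomain E D φ x p) :
    (extChartAt 𝓘(ℝ, E) p).symm (chartFlow E φ x p q)
      = φ q.1 ((extChartAt 𝓘(ℝ, E) x).symm q.2) :=
  (extChartAt 𝓘(ℝ, E) p).left_inv hq.2.2

lemma chartFlow_mem_target {x p : M} {q : ℝ × E} (hq : q ∈ chartFlowDomain E D φ x p) :
    chartFlow E φ x p q ∈ (extChartAt 𝓘(ℝ, E) p).target :=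
  (extChartAt 𝓘(ℝ, E) p).map_source hq.2.2

/-- The space derivative of the flow in charts. -/
lemma IsFlow.tderiv_symm_fderiv_chartFlow (hφ : IsFlow X D φ) {x p : M} {q : ℝ × E}
    (hq : q ∈ chartFlowDomain E D φ x p) (u : E) :
    tderiv E E (extChartAt 𝓘(ℝ, E) p).symm (chartFlow E φ x p q)
        (fderiv ℝ (chartFlow E φ x p) q (0, u))
      = tderiv E E (φ q.1) ((extChartAt 𝓘(ℝ, E) x).symm q.2)
        (tderiv E E (extChartAt 𝓘(ℝ, E) x).symm q.2 u) := by
  obtain ⟨t, y⟩ := q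
  have hF := ((hφ.contDiffAt_chartFlow hq).differentiableAt (by simp)).hasFDerivAt
  have hs : HasFDerivAt (fun y' : E => (t, y')) (ContinuousLinearMap.inr ℝ ℝ E) y :=
    hasFDerivAt_prodMk_right t y
  have h1 : HasFDerivAt (extChartAt 𝓘(ℝ, E) p ∘ φ t ∘ (extChartAt 𝓘(ℝ, E) x).symm) _ y :=
    hF.comp y hs
  have hk : MDifferentiableAt 𝓘(ℝ, E) 𝓘(ℝ, E) (extChartAt 𝓘(ℝ, E) p)
      (φ t ((extChartAt 𝓘(ℝ, E) x).symm y)) :=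
    mdifferentiableAt_extChartAt (by have := hq.2.2; rwa [extChartAt_source] at this)
  have hx := mdifferentiableAt_extChartAt_symm (E := E) hq.1
  have hft := hφ.mdifferentiableAt hq.2.1
  have h2 : fderiv ℝ (chartFlow E φ x p) (t, y) (0, u)
      = tderiv E E (extChartAt 𝓘(ℝ, E) p ∘ φ t ∘ (extChartAt 𝓘(ℝ, E) x).symm) y u := by
    rw [tderiv_eq_fderiv, h1.fderiv]
    rfl
  have h3 : MDifferentiableAt 𝓘(ℝ, E) 𝓘(ℝ, E) (φ t ∘ (extChartAt 𝓘(ℝ, E) x).symm) y :=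
    MDifferentiableAt.comp y hft hx
  rw [h2, tderiv_comp (f := φ t ∘ (extChartAt 𝓘(ℝ, E) x).symm) hk h3, tderiv_comp hft hx]
  exact tderiv_extChartAt_symm_comp hq.2.2 _

end HamiltonianFlow

/-! ### Hamiltonian flows are symplectic. -/

section SymplecticFlow

variable {E : Type*} [NormedAddCommGroup E] [NormedSpace ℝ E] [FiniteDimensional ℝ E]
  {M : Type*} [TopologicalSpace M] [ChartedSpace E M] [IsManifold 𝓘(ℝ, E) ∞ M]
  {Ω : SymplecticForm E M} {h : M × ℝ → ℝ} {D : Set (ℝ × M)} {φ : ℝ → M → M}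

lemma two_le_infty : (2 : WithTop ℕ∞) ≤ ∞ := WithTop.coe_le_coe.2 le_top

lemma IsSolutionOn.hasDerivAt_chart (hh : ContMDiff (𝓘(ℝ, E).prod 𝓘(ℝ, ℝ)) 𝓘(ℝ, ℝ) ∞ h)
    {η : ℝ → M} {S : Set ℝ} (hη : IsSolutionOn (timeHamiltonianVectorField Ω h) η S) {t : ℝ}
    (ht : t ∈ S) {p : M} (hp : η t ∈ (extChartAt 𝓘(ℝ, E) p).source) :
    ∃ v, HasDerivAt (fun s => extChartAt 𝓘(ℝ, E) p (η s)) v t ∧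
      ∀ w, chartForm Ω p (extChartAt 𝓘(ℝ, E) p (η t)) v w
        = -fderiv ℝ (fun y => h ((extChartAt 𝓘(ℝ, E) p).symm y, t))
          (extChartAt 𝓘(ℝ, E) p (η t)) w :=
  hasDerivAt_chart_of_solution (H := fun x => h (x, t)) (hη t ht)
    (one_smul ℝ (hamVec Ω (fun x => h (x, t)) (η t)))
    ((contMDiff_slice hh t).mdifferentiable (by simp) _) hp

lemma contDiffAt_slice_symm (hh : ContMDiff (𝓘(ℝ, E).prod 𝓘(ℝ, ℝ)) 𝓘(ℝ, ℝ) ∞ h) {p : M} {y : E}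
    (hy : y ∈ (extChartAt 𝓘(ℝ, E) p).target) (t : ℝ) :
    ContDiffAt ℝ ∞ (fun y => h ((extChartAt 𝓘(ℝ, E) p).symm y, t)) y :=
  ((contMDiff_slice hh t).contMDiffAt.comp y (contMDiffAt_extChartAt_symm hy)).contDiffAt

/-- Hamilton's equations for the flow in charts. -/
lemma IsFlow.chartFlow_ode (hφ : IsFlow (timeHamiltonianVectorField Ω h) D φ)
    (hh : ContMDiff (𝓘(ℝ, E).prod 𝓘(ℝ, ℝ)) 𝓘(ℝ, ℝ) ∞ h) {x p : M} {q : ℝ × E}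
    (hq : q ∈ chartFlowDomain E D φ x p) (w : E) :
    chartForm Ω p (chartFlow E φ x p q) (fderiv ℝ (chartFlow E φ x p) q (1, 0)) w
      = -fderiv ℝ (fun y => h ((extChartAt 𝓘(ℝ, E) p).symm y, q.1)) (chartFlow E φ x p q) w := by
  obtain ⟨t, y⟩ := q
  obtain ⟨v, hv, hv'⟩ := (hφ.solution ((extChartAt 𝓘(ℝ, E) x).symm y)).hasDerivAt_chart hh
    hq.2.1 hq.2.2
  have hF := ((hφ.contDiffAt_chartFlow hq).differentiableAt (by simp)).hasFDerivAt
  have hc : HasDerivAt (fun s : ℝ => (s, y)) ((1 : ℝ), (0 : E)) t :=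
    (hasDerivAt_id t).prodMk (hasDerivAt_const t y)
  have h1 : HasDerivAt (fun s => extChartAt 𝓘(ℝ, E) p (φ s ((extChartAt 𝓘(ℝ, E) x).symm y)))
      (fderiv ℝ (chartFlow E φ x p) (t, y) (1, 0)) t := 
    HasFDerivAt.comp_hasDerivAt (f := fun s : ℝ => (s, y)) t hF hc
  rw [h1.unique hv]
  exact hv' w

/-- A Hamiltonian flow preserves the symplectic form. -/
theorem IsFlow.bilin_tderiv (hφ : IsFlow (timeHamiltonianVectorField Ω h) D φ)
    (hh : ContMDiff (𝓘(ℝ, E).prod 𝓘(ℝ, ℝ)) 𝓘(ℝ, ℝ) ∞ h) {t : ℝ} {x : M} (ht : (t, x) ∈ D)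
    (u v : E) :
    Ω.bilin (φ t x) (tderiv E E (φ t) x u) (tderiv E E (φ t) x v) = Ω.bilin x u v := by
  set c : ℝ → ℝ := fun t => Ω.bilin (φ t x) (tderiv E E (φ t) x u) (tderiv E E (φ t) x v) with hc
  -- Near each time `t₀` the computation takes place in a chart at `φ t₀ x`. Constancy on the
  -- connected set of times then compares with time `0`, where the flow is the identity.
  have key : ∀ t ∈ {t : ℝ | (t, x) ∈ D}, HasDerivAt c 0 t := by
    intro t₀ ht₀
    have hxs := mem_extChartAt_source (I := 𝓘(ℝ, E)) x
    set y₀ := extChartAt 𝓘(ℝ, E) x x with hy₀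
    have hy : (extChartAt 𝓘(ℝ, E) x).symm y₀ = x := (extChartAt 𝓘(ℝ, E) x).left_inv hxs
    set p := φ t₀ x with hp
    have hq : (t₀, y₀) ∈ chartFlowDomain E D φ x p := by
      refine ⟨(extChartAt 𝓘(ℝ, E) x).map_source hxs, ?_, ?_⟩
      · rw [hy]; exact ht₀
      · rw [hy]; exact mem_extChartAt_source p
    have hopen := (hφ.isOpen_chartFlowDomain x p).mem_nhds hq
    have hF := hφ.contDiffAt_chartFlow hq
    have htar := chartFlow_mem_target (E := E) hq
    have hb := hasFormDerivAt_of_differentiableAt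
      ((contDiffAt_chartForm Ω htar).differentiableAt (by simp))
    have hmain := hasDerivAt_pullback_of_hamilton (k := fun y => h ((extChartAt 𝓘(ℝ, E) p).symm y, t₀))
      hb (fun _ _ => map_zero _) (fun y u v => chartForm_neg_swap Ω p y u v)
      (chartForm_closed Ω htar) (hF.of_le two_le_infty)
      ((contDiffAt_slice_symm hh htar t₀).of_le two_le_infty) ?_
      (tderiv E E (extChartAt 𝓘(ℝ, E) x) x u) (tderiv E E (extChartAt 𝓘(ℝ, E) x) x v)
    · refine hmain.congr_of_eventuallyEq ?_
      have hcont : Continuous fun t : ℝ => (t, y₀) := by fun_prop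
      filter_upwards [hcont.continuousAt.preimage_mem_nhds hopen] with t ht
      have e := symm_chartFlow (E := E) ht
      simp only [hy] at e
      have e2 : ∀ u, tderiv E E (extChartAt 𝓘(ℝ, E) p).symm (chartFlow E φ x p (t, y₀))
          (fderiv ℝ (chartFlow E φ x p) (t, y₀) (0, tderiv E E (extChartAt 𝓘(ℝ, E) x) x u))
          = tderiv E E (φ t) x u := by
        intro u
        have := hφ.tderiv_symm_fderiv_chartFlow ht (tderiv E E (extChartAt 𝓘(ℝ, E) x) x u)
        simp only [hy] at this
        rw [this, hy₀, tderiv_extChartAt_symm_comp hxs]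
      rw [hc, chartForm_apply, e2, e2, e]
    · have hcont : Continuous fun y : E => (t₀, y) := by fun_prop
      filter_upwards [hcont.continuousAt.preimage_mem_nhds hopen] with y hy w
      exact hφ.chartFlow_ode hh hy w
  have hconst := (hφ.isOpen_times x).is_const_of_deriv_eq_zero
    (hφ.ordConnected x).isPreconnected
    (fun t ht => (key t ht).differentiableAt.differentiableWithinAt)
    (fun t ht => (key t ht).deriv) (x := t) (y := 0) ht (hφ.zero_mem x)
  rw [hc] at hconst
  have h0 : φ 0 = id := funext hφ.zero_apply
  simp only [h0, tderiv_id, id] at hconst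
  exact hconst

end SymplecticFlow

/-! ### Uniqueness of solutions of Hamilton's equations. -/

section Uniqueness

variable {E : Type*} [NormedAddCommGroup E] [NormedSpace ℝ E] [FiniteDimensional ℝ E]
  {M : Type*} [TopologicalSpace M] [ChartedSpace E M] [IsManifold 𝓘(ℝ, E) ∞ M]
  {Ω : SymplecticForm E M} {h : M × ℝ → ℝ} {D : Set (ℝ × M)} {φ : ℝ → M → M}

/-- The form `Ω` in a chart, as an isomorphism onto the dual space. -/
lemma exists_equiv_chartForm (Ω : SymplecticForm E M) {p : M} {y : E}
    (hy : y ∈ (extChartAt 𝓘(ℝ, E) p).target) :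
    ∃ e : E ≃L[ℝ] (E →L[ℝ] ℝ), (e : E →L[ℝ] (E →L[ℝ] ℝ)) = chartForm Ω p y := by
  have hinj : Function.Injective (chartForm Ω p y : E →ₗ[ℝ] (E →L[ℝ] ℝ)) := by
    refine (injective_iff_map_eq_zero _).2 fun u hu => chartForm_nondegenerate Ω hy fun v => ?_
    exact DFunLike.congr_fun hu v
  have hfr : Module.finrank ℝ E = Module.finrank ℝ (E →L[ℝ] ℝ) := by
    rw [← (LinearMap.toContinuousLinearMap (𝕜 := ℝ) (E := E) (F' := ℝ)).finrank_eq]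
    exact (Subspace.dual_finrank_eq (K := ℝ) (V := E)).symm
  let e := LinearEquiv.ofInjectiveOfFinrankEq _ hinj hfr
  exact ⟨e.toContinuousLinearEquiv, by ext u v; rfl⟩

/-- The Hamiltonian vector field in a chart. -/
def chartHam (Ω : SymplecticForm E M) (h : M × ℝ → ℝ) (p : M) (q : ℝ × E) : E :=
  (chartForm Ω p q.2).inverse (-((fderiv ℝ
    (fun q : ℝ × E => h ((extChartAt 𝓘(ℝ, E) p).symm q.2, q.1)) q).comp
      (ContinuousLinearMap.inr ℝ ℝ E)))

lemma contDiffAt_prod_symm (hh : ContMDiff (𝓘(ℝ, E).prod 𝓘(ℝ, ℝ)) 𝓘(ℝ, ℝ) ∞ h) {p : M} {q : ℝ × E}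
    (hq : q.2 ∈ (extChartAt 𝓘(ℝ, E) p).target) :
    ContDiffAt ℝ ∞ (fun q : ℝ × E => h ((extChartAt 𝓘(ℝ, E) p).symm q.2, q.1)) q := by
  have h1 : IsOpen {q : ℝ × E | q.2 ∈ (extChartAt 𝓘(ℝ, E) p).target} :=
    (isOpen_extChartAt_target p).preimage continuous_snd
  have h2 := (contMDiffOn_prod_symm p).contMDiffAt (h1.mem_nhds hq)
  have h3 : ContMDiffAt 𝓘(ℝ, ℝ × E) (𝓘(ℝ, E).prod 𝓘(ℝ, ℝ)) ∞
    (fun q : ℝ × E => ((extChartAt 𝓘(ℝ, E) p).symm q.2, q.1)) q := h2.snd.prodMk h2.fst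
  exact (hh.contMDiffAt.comp q h3).contDiffAt

lemma eq_chartHam (hh : ContMDiff (𝓘(ℝ, E).prod 𝓘(ℝ, ℝ)) 𝓘(ℝ, ℝ) ∞ h) {p : M} {t : ℝ} {y v : E}
    (hy : y ∈ (extChartAt 𝓘(ℝ, E) p).target)
    (hv : ∀ w, chartForm Ω p y v w
      = -fderiv ℝ (fun y => h ((extChartAt 𝓘(ℝ, E) p).symm y, t)) y w) :
    v = chartHam Ω h p (t, y) := by
  obtain ⟨e, he⟩ := exists_equiv_chartForm Ω hy
  have hK := ((contDiffAt_prod_symm hh (q := (t, y)) hy).differentiableAt (by simp)).hasFDerivAt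
  have h1 : HasFDerivAt (fun y => h ((extChartAt 𝓘(ℝ, E) p).symm y, t)) _ y :=
    hK.comp y (hasFDerivAt_prodMk_right t y)
  have h2 : e v = -((fderiv ℝ (fun q : ℝ × E => h ((extChartAt 𝓘(ℝ, E) p).symm q.2, q.1))
      (t, y)).comp (ContinuousLinearMap.inr ℝ ℝ E)) := by
    ext w
    have := hv w
    rw [h1.fderiv, ← he] at this
    exact this
  rw [chartHam, ← h2, ← he, ContinuousLinearMap.inverse_equiv]
  exact (e.symm_apply_apply v).symm

set_option synthInstance.maxHeartbeats 200000 in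
-- Inversion of invertible operators is smooth, and so are the form and the Hamiltonian.
-- Differentiability of class `C¹` yields the local Lipschitz bound needed for uniqueness.
lemma contDiffAt_chartHam (hh : ContMDiff (𝓘(ℝ, E).prod 𝓘(ℝ, ℝ)) 𝓘(ℝ, ℝ) ∞ h) {p : M} {q : ℝ × E}
    (hq : q.2 ∈ (extChartAt 𝓘(ℝ, E) p).target) : ContDiffAt ℝ 1 (chartHam Ω h p) q := by
  obtain ⟨e, he⟩ := exists_equiv_chartForm Ω hq
  have h1 : ContDiffAt ℝ 1 (fun q : ℝ × E => chartForm Ω p q.2) q :=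
    ((contDiffAt_chartForm Ω hq).of_le (by simp)).comp q contDiffAt_snd
  have h2 : ContDiffAt ℝ 1 (fun q : ℝ × E => (chartForm Ω p q.2).inverse) q := by
    have h3 := contDiffAt_map_inverse (𝕜 := ℝ) (n := 1) e
    rw [he] at h3
    exact h3.comp q h1
  have h4 := (contDiffAt_prod_symm hh hq).fderiv_right (m := 1) (by rw [one_add_one_eq_two]; exact two_le_infty)
  exact h2.clm_apply (h4.clm_comp contDiffAt_const).neg

/-- Near `t₀` both curves stay in one chart and in a region where the field in the chart is
Lipschitz, so they satisfy the same well-posed initial value problem. -/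
lemma IsSolutionOn.eventuallyEq (hh : ContMDiff (𝓘(ℝ, E).prod 𝓘(ℝ, ℝ)) 𝓘(ℝ, ℝ) ∞ h)
    {η₁ η₂ : ℝ → M} {S : Set ℝ} (hS : IsOpen S)
    (h₁ : IsSolutionOn (timeHamiltonianVectorField Ω h) η₁ S)
    (h₂ : IsSolutionOn (timeHamiltonianVectorField Ω h) η₂ S) {t₀ : ℝ} (ht₀ : t₀ ∈ S)
    (heq : η₁ t₀ = η₂ t₀) : η₁ =ᶠ[𝓝 t₀] η₂ := by
  set p := η₁ t₀ with hp
  have hps := mem_extChartAt_source (I := 𝓘(ℝ, E)) p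
  have hpt := (extChartAt 𝓘(ℝ, E) p).map_source hps
  obtain ⟨K, U, hU, hL⟩ := (contDiffAt_chartHam (Ω := Ω) hh
    (q := (t₀, extChartAt 𝓘(ℝ, E) p p)) hpt).exists_lipschitzOnWith
  obtain ⟨U₁, hU₁, U₂, hU₂, hU⟩ := mem_nhds_prod_iff.1 hU
  have hcurve : ∀ η : ℝ → M, IsSolutionOn (timeHamiltonianVectorField Ω h) η S → η t₀ = p →
      ∀ᶠ t in 𝓝 t₀, η t ∈ (extChartAt 𝓘(ℝ, E) p).source ∧
        HasDerivAt (fun s => extChartAt 𝓘(ℝ, E) p (η s))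
          (chartHam Ω h p (t, extChartAt 𝓘(ℝ, E) p (η t))) t ∧
        extChartAt 𝓘(ℝ, E) p (η t) ∈ U₂ := by
    intro η hη hη0
    have hc : ContinuousAt η t₀ := (hη t₀ ht₀).continuousAt
    have hsrc : ∀ᶠ t in 𝓝 t₀, η t ∈ (extChartAt 𝓘(ℝ, E) p).source :=
      hc.preimage_mem_nhds ((isOpen_extChartAt_source p).mem_nhds (by rw [hη0]; exact hps))
    have hc2 : ContinuousAt (fun s => extChartAt 𝓘(ℝ, E) p (η s)) t₀ := by
      have := continuousAt_extChartAt (I := 𝓘(ℝ, E)) p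
      exact ContinuousAt.comp (by rwa [hη0]) hc
    have hU₂' : ∀ᶠ t in 𝓝 t₀, extChartAt 𝓘(ℝ, E) p (η t) ∈ U₂ :=
      hc2.preimage_mem_nhds (by rwa [hη0])
    filter_upwards [hsrc, hU₂', hS.mem_nhds ht₀] with t h1 h2 h3
    obtain ⟨v, hv, hv'⟩ := hη.hasDerivAt_chart hh h3 h1
    rw [← eq_chartHam hh ((extChartAt 𝓘(ℝ, E) p).map_source h1) hv']
    exact ⟨h1, hv, h2⟩
  have hc₁ := hcurve η₁ h₁ rfl
  have hc₂ := hcurve η₂ h₂ heq.symm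
  have := ODE_solution_unique_of_eventually (v := fun t y => chartHam Ω h p (t, y))
    (s := fun _ => U₂) (K := K) (f := fun s => extChartAt 𝓘(ℝ, E) p (η₁ s))
    (g := fun s => extChartAt 𝓘(ℝ, E) p (η₂ s)) (t₀ := t₀) ?_
    (hc₁.mono fun t ht => ht.2) (hc₂.mono fun t ht => ht.2) (congrArg _ (hp.symm.trans heq))
  · filter_upwards [this, hc₁, hc₂] with t ht ht1 ht2
    exact (extChartAt 𝓘(ℝ, E) p).injOn ht1.1 ht2.1 ht
  · filter_upwards [hU₁] with t ht
    refine LipschitzOnWith.of_dist_le_mul fun y hy y' hy' => ?_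
    have := hL.dist_le_mul (t, y) (hU ⟨ht, hy⟩) (t, y') (hU ⟨ht, hy'⟩)
    rwa [dist_prod_same_left] at this

/-- Solutions of Hamilton's equations are the orbits of the Hamiltonian flow. -/
theorem IsFlow.eq_of_solution [T2Space M] (hφ : IsFlow (timeHamiltonianVectorField Ω h) D φ)
    (hh : ContMDiff (𝓘(ℝ, E).prod 𝓘(ℝ, ℝ)) 𝓘(ℝ, ℝ) ∞ h) {η : ℝ → M} {a b : ℝ} (ha : a < 0)
    (hb : 0 < b) (hη : IsSolutionOn (timeHamiltonianVectorField Ω h) η (Ioo a b)) {t : ℝ}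
    (ht : t ∈ Ioo a b) : (t, η 0) ∈ D ∧ η t = φ t (η 0) := by
  have hD := hφ.maximal η a b ha hb hη
  refine ⟨hD t ht, ?_⟩
  have hsol : IsSolutionOn (timeHamiltonianVectorField Ω h) (fun t => φ t (η 0)) (Ioo a b) :=
    fun t ht => hφ.solution (η 0) t (hD t ht)
  have hcη : ContinuousOn η (Ioo a b) := fun t ht => (hη t ht).continuousAt.continuousWithinAt
  have hcφ : ContinuousOn (fun t => φ t (η 0)) (Ioo a b) := fun t ht =>
    (hsol t ht).continuousAt.continuousWithinAt
  -- The times near which the curves agree form an open set; by the Hausdorff property so do the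
  -- times at which they differ. Connectedness of the interval leaves only agreement.
  have hV : IsOpen {t | t ∈ Ioo a b ∧ η t ≠ φ t (η 0)} := by
    have := (hcη.prodMk hcφ).isOpen_inter_preimage isOpen_Ioo
      (isClosed_diagonal (X := M)).isOpen_compl
    exact this
  have hU : IsOpen {t | ∀ᶠ s in 𝓝 t, η s = φ s (η 0)} := isOpen_setOfPred_eventually_nhds
  have h0 : (0 : ℝ) ∈ Ioo a b := ⟨ha, hb⟩
  have hloc : ∀ t ∈ Ioo a b, η t = φ t (η 0) → ∀ᶠ s in 𝓝 t, η s = φ s (η 0) := fun t ht he =>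
    IsSolutionOn.eventuallyEq hh isOpen_Ioo hη hsol ht he
  have := isPreconnected_Ioo.subset_left_of_subset_union hU hV
    (Set.disjoint_left.2 fun s hs hs' => hs'.2 hs.self_of_nhds)
    (fun s hs => (em (η s = φ s (η 0))).imp (hloc s hs) fun he => ⟨hs, he⟩)
    ⟨0, h0, hloc 0 h0 (hφ.zero_apply _).symm⟩
  exact (this ht).self_of_nhds

end Uniqueness

/-! ### Tangent spaces of regular levels and local retractions. -/

section Level

variable {E : Type*} [NormedAddCommGroup E] [NormedSpace ℝ E] [FiniteDimensional ℝ E]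
  {V : Type*} [TopologicalSpace V] [ChartedSpace E V] [IsManifold 𝓘(ℝ, E) ∞ V]
  {E₁ : Type*} [NormedAddCommGroup E₁] [NormedSpace ℝ E₁] [FiniteDimensional ℝ E₁]
  {f : V → ℝ} {c : ℝ} [ChartedSpace E₁ (LevelSet f c)]
  [IsManifold 𝓘(ℝ, E₁) ∞ (LevelSet f c)]
  {F : Type*} [NormedAddCommGroup F] [NormedSpace ℝ F]
  {N : Type*} [TopologicalSpace N] [ChartedSpace F N]

/-- The inclusion of a level set. -/
def levelIncl (f : V → ℝ) (c : ℝ) : LevelSet f c → V := fun z => (z : V)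

lemma mdifferentiableAt_levelIncl (hZ : IsRegularLevel E E₁ f c) (z : LevelSet f c) :
    MDifferentiableAt 𝓘(ℝ, E₁) 𝓘(ℝ, E) (levelIncl f c) z :=
  hZ.smooth.mdifferentiable (by simp) z

/-- The tangent space of a regular level of `f` is the kernel of `df`. -/
lemma exists_tderiv_levelIncl_eq (hZ : IsRegularLevel E E₁ f c)
    (hf : ContMDiff 𝓘(ℝ, E) 𝓘(ℝ, ℝ) ∞ f) (hdim : Module.finrank ℝ E = Module.finrank ℝ E₁ + 1)
    {z : LevelSet f c} {u : E} (hu : tderiv E ℝ f z u = 0) :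
    ∃ u', tderiv E₁ E (levelIncl f c) z u' = u := by
  have hfd : MDifferentiableAt 𝓘(ℝ, E) 𝓘(ℝ, ℝ) f (levelIncl f c z) := hf.mdifferentiable (by simp) _
  have hle : LinearMap.range (tderiv E₁ E (levelIncl f c) z : E₁ →ₗ[ℝ] E)
      ≤ LinearMap.ker (tderiv E ℝ f z : E →ₗ[ℝ] ℝ) := by
    rintro _ ⟨u', rfl⟩
    have h1 := tderiv_comp hfd (mdifferentiableAt_levelIncl hZ z) u'
    have h2 : f ∘ levelIncl f c = fun _ => c := funext fun z => z.2
    have h3 : tderiv E₁ ℝ (f ∘ levelIncl f c) z = 0 := by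
      rw [h2]; exact mfderiv_const
    rw [h3] at h1
    exact h1.symm
  have hinj : Function.Injective (tderiv E₁ E (levelIncl f c) z : E₁ →ₗ[ℝ] E) := hZ.immersion z
  have h1 := LinearMap.finrank_range_of_inj hinj
  have hne : tderiv E ℝ f z ≠ 0 := hZ.regular z
  have hsurj : LinearMap.range (tderiv E ℝ f z : E →ₗ[ℝ] ℝ) = ⊤ := by
    refine LinearMap.range_eq_top.2 (LinearMap.surjective fun h => hne ?_)
    ext v
    exact DFunLike.congr_fun h v
  have h2 := LinearMap.finrank_range_add_finrank_ker (tderiv E ℝ f z : E →ₗ[ℝ] ℝ)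
  rw [hsurj, finrank_top, Module.finrank_self] at h2
  -- Both subspaces have dimension `finrank E₁`: one since the inclusion is an immersion, the other
  -- since `df` is onto `ℝ`.
  have h3 := Submodule.eq_of_le_of_finrank_eq hle (by omega)
  have h4 : u ∈ LinearMap.ker (tderiv E ℝ f z : E →ₗ[ℝ] ℝ) := hu
  rw [← h3] at h4
  exact h4

/-- Regular levels are locally retracts. -/
lemma exists_local_retraction (hZ : IsRegularLevel E E₁ f c) (z₀ : LevelSet f c) :
    ∃ r : V → LevelSet f c, ContMDiffAt 𝓘(ℝ, E) 𝓘(ℝ, E₁) ∞ r z₀ ∧ ∀ᶠ z : LevelSet f c in 𝓝 z₀, r (z : V) = z := by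
  set χ := extChartAt 𝓘(ℝ, E₁) z₀ with hχ
  set κ := extChartAt 𝓘(ℝ, E) (z₀ : V) with hκ
  have hzs : z₀ ∈ χ.source := mem_extChartAt_source z₀
  have hyt : χ z₀ ∈ χ.target := χ.map_source hzs
  have hsymm : χ.symm (χ z₀) = z₀ := χ.left_inv hzs
  have hκ1 : ContMDiffAt 𝓘(ℝ, E) 𝓘(ℝ, E) ∞ κ (levelIncl f c z₀) := contMDiffAt_extChartAt
  have hi1 : ContMDiffAt 𝓘(ℝ, E₁) 𝓘(ℝ, E) ∞ (levelIncl f c) (χ.symm (χ z₀)) :=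
    hZ.smooth.contMDiffAt
  have hχ1 : ContMDiffAt 𝓘(ℝ, E₁) 𝓘(ℝ, E₁) ∞ χ.symm (χ z₀) := contMDiffAt_extChartAt_symm hyt
  have hiχ : ContMDiffAt 𝓘(ℝ, E₁) 𝓘(ℝ, E) ∞ (levelIncl f c ∘ χ.symm) (χ z₀) := hi1.comp _ hχ1
  have hκ1' : ContMDiffAt 𝓘(ℝ, E) 𝓘(ℝ, E) ∞ κ ((levelIncl f c ∘ χ.symm) (χ z₀)) := by
    rwa [Function.comp, hsymm]
  have hι : ContDiffAt ℝ ∞ (κ ∘ levelIncl f c ∘ χ.symm) (χ z₀) :=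
    (ContMDiffAt.comp (χ z₀) hκ1' hiχ).contDiffAt
  have hA : ∀ u, fderiv ℝ (κ ∘ levelIncl f c ∘ χ.symm) (χ z₀) u
      = tderiv E E κ (levelIncl f c z₀) (tderiv E₁ E (levelIncl f c) z₀
        (tderiv E₁ E₁ χ.symm (χ z₀) u)) := by
    intro u
    rw [← tderiv_eq_fderiv, tderiv_comp (hκ1'.mdifferentiableAt (by simp))
      (hiχ.mdifferentiableAt (by simp)), tderiv_comp (hi1.mdifferentiableAt (by simp))
      (hχ1.mdifferentiableAt (by simp))]
    simp only [Function.comp, hsymm]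
  have hinj : Function.Injective (fderiv ℝ (κ ∘ levelIncl f c ∘ χ.symm) (χ z₀) : E₁ →ₗ[ℝ] E) := by
    refine (injective_iff_map_eq_zero _).2 fun u hu => ?_
    have h1 : fderiv ℝ (κ ∘ levelIncl f c ∘ χ.symm) (χ z₀) u = 0 := hu
    rw [hA] at h1
    have h2 := (tderiv_extChartAt_symm_comp (x₀ := (z₀ : V)) (x := levelIncl f c z₀)
      (mem_extChartAt_source (z₀ : V)) _).symm.trans
      ((congrArg (tderiv E E κ.symm (κ (levelIncl f c z₀))) h1).trans (map_zero _))
    have h3 : tderiv E₁ E₁ χ.symm (χ z₀) u = 0 := hZ.immersion z₀ (h2.trans (map_zero _).symm)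
    have h4 := tderiv_extChartAt_comp_symm' (E := E₁) (x₀ := z₀) hzs u
    rw [← h4]
    exact (congrArg _ h3).trans (map_zero _)
  -- Following the inclusion, read in charts, by a linear left inverse of its derivative gives a
  -- local diffeomorphism of `E₁`. Its local inverse composed with that linear map is the retraction
  -- in charts.
  obtain ⟨L, hL⟩ := LinearMap.exists_leftInverse_of_injective _ (LinearMap.ker_eq_bot.2 hinj)
  set L' : E →L[ℝ] E₁ := L.toContinuousLinearMap with hL'
  have hLι : ContDiffAt ℝ ∞ (fun y => L' (κ (levelIncl f c (χ.symm y)))) (χ z₀) :=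
    L'.contDiff.contDiffAt.comp (χ z₀) hι
  have hLd : HasFDerivAt (fun y => L' (κ (levelIncl f c (χ.symm y))))
      ((ContinuousLinearEquiv.refl ℝ E₁ : E₁ ≃L[ℝ] E₁) : E₁ →L[ℝ] E₁) (χ z₀) := by
    have h1 := L'.hasFDerivAt.comp (χ z₀) (hι.differentiableAt (by simp)).hasFDerivAt
    refine h1.congr_fderiv ?_
    ext u
    exact DFunLike.congr_fun hL u
  set g := hLι.localInverse hLd (by simp) with hg
  have hg1 : ContDiffAt ℝ ∞ g (L' (κ (levelIncl f c (χ.symm (χ z₀))))) :=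
    hLι.to_localInverse hLd (by simp)
  have hg2 : ∀ᶠ y in 𝓝 (χ z₀), g (L' (κ (levelIncl f c (χ.symm y)))) = y :=
    (hLι.hasStrictFDerivAt' hLd (by simp)).eventually_left_inverse
  rw [hsymm] at hg1
  refine ⟨fun v => χ.symm (g (L' (κ v))), ?_, ?_⟩
  · have h0 : g (L' (κ (levelIncl f c z₀))) = χ z₀ := by
      have := hg2.self_of_nhds
      rwa [hsymm] at this
    have h1 : ContMDiffAt 𝓘(ℝ, E) 𝓘(ℝ, E₁) ∞ (fun v => g (L' (κ v))) (levelIncl f c z₀) :=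
      ContMDiffAt.comp (levelIncl f c z₀) (g := fun y => g (L' y))
        ((hg1.comp _ L'.contDiff.contDiffAt).contMDiffAt) hκ1
    exact ContMDiffAt.comp (levelIncl f c z₀) (g := χ.symm) (by rw [h0]; exact hχ1) h1
  · have hcont : ContinuousAt χ z₀ := continuousAt_extChartAt z₀
    filter_upwards [hcont.eventually hg2, (isOpen_extChartAt_source (I := 𝓘(ℝ, E₁)) z₀).mem_nhds hzs]
      with z hz hzs'
    have : χ.symm (χ z) = z := χ.left_inv hzs'
    rw [this] at hz
    change χ.symm (g (L' (κ (levelIncl f c z)))) = z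
    rw [hz, this]

end Level

/-! ### Reduction: projection of vectors, orbits and linearized flows. -/

section Reduction

variable {E : Type*} [NormedAddCommGroup E] [NormedSpace ℝ E] [FiniteDimensional ℝ E]
  {V : Type*} [TopologicalSpace V] [ChartedSpace E V] [IsManifold 𝓘(ℝ, E) ∞ V]
  {E₁ : Type*} [NormedAddCommGroup E₁] [NormedSpace ℝ E₁] [FiniteDimensional ℝ E₁]
  {f : V → ℝ} {c : ℝ} [ChartedSpace E₁ (LevelSet f c)]
  [IsManifold 𝓘(ℝ, E₁) ∞ (LevelSet f c)]
  {E₂ : Type*} [NormedAddCommGroup E₂] [NormedSpace ℝ E₂] [FiniteDimensional ℝ E₂]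
  {W : Type*} [TopologicalSpace W] [ChartedSpace E₂ W] [IsManifold 𝓘(ℝ, E₂) ∞ W]
  {N : Type*} [TopologicalSpace N]

/-- `pr` is a submersion of the regular level `f⁻¹(c)` onto a symplectic manifold whose form pulls
back to the restriction of `Ω`. -/
structure IsReduction (E₁ : Type*) [NormedAddCommGroup E₁] [NormedSpace ℝ E₁] (Ω : SymplecticForm E V)
    (f : V → ℝ) (c : ℝ) [ChartedSpace E₁ (LevelSet f c)] (ωW : SymplecticForm E₂ W)
    (pr : LevelSet f c → W) : Prop where
  level : IsRegularLevel E E₁ f c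
  smooth_fun : ContMDiff 𝓘(ℝ, E) 𝓘(ℝ, ℝ) ∞ f
  finrank : Module.finrank ℝ E = Module.finrank ℝ E₁ + 1
  smooth : ContMDiff 𝓘(ℝ, E₁) 𝓘(ℝ, E₂) ∞ pr
  submersion : ∀ z, Function.Surjective (tderiv E₁ E₂ pr z)
  pullback : ∀ z u v, ωW.bilin (pr z) (tderiv E₁ E₂ pr z u) (tderiv E₁ E₂ pr z v)
    = Ω.bilin (z : V) (tderiv E₁ E (levelIncl f c) z u) (tderiv E₁ E (levelIncl f c) z v)

/-- `q` extends `pr` to the neighbourhood `U` of `z₀` in the ambient manifold. -/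
structure LocalExtension (E E₂ : Type*) [NormedAddCommGroup E] [NormedSpace ℝ E] [ChartedSpace E V]
    [NormedAddCommGroup E₂] [NormedSpace ℝ E₂] [ChartedSpace E₂ W]
    (pr : LevelSet f c → W) (z₀ : LevelSet f c) (q : V → W) (U : Set V) : Prop where
  isOpen : IsOpen U
  mem : (z₀ : V) ∈ U
  smooth : ContMDiffOn 𝓘(ℝ, E) 𝓘(ℝ, E₂) 1 q U
  eq : ∀ z : LevelSet f c, (z : V) ∈ U → q z = pr z

variable {Ω : SymplecticForm E V} {ωW : SymplecticForm E₂ W} {pr : LevelSet f c → W}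

/-- Precomposing the projection with a local retraction onto the level allows its derivative to be
applied to vectors tangent to `V`. Only the values on `ker df` have a meaning independent of the
retraction. -/
lemma IsReduction.exists_localExtension (R : IsReduction E₁ Ω f c ωW pr) (z₀ : LevelSet f c) :
    ∃ q U, LocalExtension E E₂ pr z₀ q U := by
  obtain ⟨r, hr, hr'⟩ := exists_local_retraction R.level z₀
  have hq : ContMDiffAt 𝓘(ℝ, E) 𝓘(ℝ, E₂) 1 (pr ∘ r) (z₀ : V) :=
    (R.smooth.contMDiffAt.comp (z₀ : V) hr).of_le (by simp)
  obtain ⟨U₁, hU₁, hq⟩ := (contMDiffAt_iff_contMDiffOn_nhds (by simp)).1 hq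
  obtain ⟨U₂, hU₂, hU₂'⟩ := mem_nhds_subtype _ _ _ |>.1 hr'
  obtain ⟨U, hU, hUo, hz⟩ := mem_nhds_iff.1 (Filter.inter_mem hU₁ hU₂)
  refine ⟨pr ∘ r, U, hUo, hz, hq.mono fun x hx => (hU hx).1, fun z hz => ?_⟩
  exact congrArg pr (hU₂' (hU hz).2)

variable {z₀ : LevelSet f c} {q : V → W} {U : Set V}

lemma LocalExtension.mdifferentiableAt (e : LocalExtension E E₂ pr z₀ q U) {x : V} (hx : x ∈ U) :
    MDifferentiableAt 𝓘(ℝ, E) 𝓘(ℝ, E₂) q x :=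
  (e.smooth.contMDiffAt (e.isOpen.mem_nhds hx)).mdifferentiableAt (by simp)

lemma LocalExtension.eventually_eq (e : LocalExtension E E₂ pr z₀ q U) {z : LevelSet f c}
    (hz : (z : V) ∈ U) : ∀ᶠ z' : LevelSet f c in 𝓝 z, q z' = pr z' := by
  have : ∀ᶠ z' : LevelSet f c in 𝓝 z, (z' : V) ∈ U :=
    continuous_subtype_val.continuousAt.preimage_mem_nhds (e.isOpen.mem_nhds hz)
  exact this.mono fun z' hz' => e.eq z' hz'

lemma IsReduction.tderiv_extension (R : IsReduction E₁ Ω f c ωW pr)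
    (e : LocalExtension E E₂ pr z₀ q U) {z : LevelSet f c} (hz : (z : V) ∈ U) (u : E₁) :
    tderiv E E₂ q z (tderiv E₁ E (levelIncl f c) z u) = tderiv E₁ E₂ pr z u := by
  have h1 := tderiv_comp (f := levelIncl f c) (e.mdifferentiableAt hz)
    (mdifferentiableAt_levelIncl R.level z) u
  rw [tderiv_congr (E := E₁) (F := E₂) (f := q ∘ levelIncl f c) (g := pr) (e.eventually_eq hz)] at h1
  exact h1.symm

lemma IsReduction.bilin_tderiv_extension (R : IsReduction E₁ Ω f c ωW pr)
    (e : LocalExtension E E₂ pr z₀ q U) {z : LevelSet f c} (hz : (z : V) ∈ U) {u v : E}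
    (hu : tderiv E ℝ f z u = 0) (hv : tderiv E ℝ f z v = 0) :
    ωW.bilin (pr z) (tderiv E E₂ q z u) (tderiv E E₂ q z v) = Ω.bilin (z : V) u v := by
  obtain ⟨u', rfl⟩ := exists_tderiv_levelIncl_eq R.level R.smooth_fun R.finrank hu
  obtain ⟨v', rfl⟩ := exists_tderiv_levelIncl_eq R.level R.smooth_fun R.finrank hv
  rw [R.tderiv_extension e hz, R.tderiv_extension e hz, R.pullback]

lemma IsReduction.exists_tderiv_extension_eq (R : IsReduction E₁ Ω f c ωW pr)
    (e : LocalExtension E E₂ pr z₀ q U) {z : LevelSet f c} (hz : (z : V) ∈ U) (w : E₂) :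
    ∃ v, tderiv E ℝ f z v = 0 ∧ tderiv E E₂ q z v = w := by
  obtain ⟨v', rfl⟩ := R.submersion z w
  refine ⟨_, ?_, R.tderiv_extension e hz v'⟩
  have h1 := tderiv_comp (f := levelIncl f c) (R.smooth_fun.mdifferentiable (by simp) _)
    (mdifferentiableAt_levelIncl R.level z) v'
  have h2 : f ∘ levelIncl f c = fun _ => c := funext fun z => z.2
  have h3 : tderiv E₁ ℝ (f ∘ levelIncl f c) z = 0 := by
    rw [h2]; exact mfderiv_const
  rw [h3] at h1
  exact h1.symm

/-- Functions that agree on the level have derivatives that agree on its tangent vectors. This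
serves both to compare the differentials of the two Hamiltonians and to compare the two linearized
flows. -/
lemma IsReduction.tderiv_comp_extension {G : Type*} [NormedAddCommGroup G] [NormedSpace ℝ G]
    [ChartedSpace G N] (R : IsReduction E₁ Ω f c ωW pr)
    (e : LocalExtension E E₂ pr z₀ q U) {z : LevelSet f c} (hz : (z : V) ∈ U) {a : W → N} {b : V → N}
    (ha : MDifferentiableAt 𝓘(ℝ, E₂) 𝓘(ℝ, G) a (pr z)) (hb : MDifferentiableAt 𝓘(ℝ, E) 𝓘(ℝ, G) b z)
    (hab : ∀ᶠ z' : LevelSet f c in 𝓝 z, a (pr z') = b z') {u : E} (hu : tderiv E ℝ f z u = 0) :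
    tderiv E₂ G a (pr z) (tderiv E E₂ q z u) = tderiv E G b z u := by
  obtain ⟨u', rfl⟩ := exists_tderiv_levelIncl_eq R.level R.smooth_fun R.finrank hu
  have hpr : MDifferentiableAt 𝓘(ℝ, E₁) 𝓘(ℝ, E₂) pr z := R.smooth.mdifferentiable (by simp) z
  have h1 := tderiv_comp (f := levelIncl f c) hb (mdifferentiableAt_levelIncl R.level z) u'
  have h2 := tderiv_congr (E := E₁) (F := G) (f := a ∘ pr) (g := b ∘ levelIncl f c) hab
  rw [R.tderiv_extension e hz, ← tderiv_comp ha hpr]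
  exact (DFunLike.congr_fun h2 u').trans h1

/-- First integrals and uniqueness of solutions are formulated on open intervals; openness of the
set of times leaves room beyond `s` and `t`. -/
lemma exists_Ioo_subset {S : Set ℝ} (hS : IsOpen S) (hS' : OrdConnected S) {s t : ℝ} (hs : s ∈ S)
    (ht : t ∈ S) : ∃ a b, s ∈ Ioo a b ∧ t ∈ Ioo a b ∧ Ioo a b ⊆ S := by
  have hmin : min s t ∈ S := by rcases min_choice s t with h | h <;> rwa [h]
  have hmax : max s t ∈ S := by rcases max_choice s t with h | h <;> rwa [h]
  obtain ⟨ε, hε, hε'⟩ := Metric.isOpen_iff.1 hS _ hmin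
  obtain ⟨δ, hδ, hδ'⟩ := Metric.isOpen_iff.1 hS _ hmax
  rw [Real.ball_eq_Ioo] at hε' hδ'
  have h1 := min_le_left s t
  have h2 := min_le_right s t
  have h3 := le_max_left s t
  have h4 := le_max_right s t
  refine ⟨min s t - ε, max s t + δ, ⟨by linarith, by linarith⟩, ⟨by linarith, by linarith⟩, ?_⟩
  intro x hx
  rcases lt_or_ge x (min s t) with h | h
  · exact hε' ⟨hx.1, by linarith⟩
  · rcases lt_or_ge (max s t) x with h' | h'
    · exact hδ' ⟨by linarith, hx.2⟩
    · exact hS'.out hmin hmax ⟨h, h'⟩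

variable {h : V × ℝ → ℝ} {D : Set (ℝ × V)} {φ : ℝ → V → V}

lemma IsFirstIntegral.apply_flow {X : ∀ (_ : ℝ) (x : V), TangentSpace 𝓘(ℝ, E) x}
    (hf : IsFirstIntegral X f) (hφ : IsFlow X D φ) {t : ℝ} {x : V} (ht : (t, x) ∈ D) :
    f (φ t x) = f x := by
  obtain ⟨a, b, h0, ht', hab⟩ := exists_Ioo_subset (hφ.isOpen_times x) (hφ.ordConnected x)
    (hφ.zero_mem x) ht
  have := hf.const (fun t => φ t x) a b (fun s hs => hφ.solution x s (hab hs)) t ht' 0 h0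
  rwa [hφ.zero_apply] at this

/-- The flow domain is open, so `f ∘ φ t = f` near `x` and the identity can be differentiated in
space. -/
lemma IsFirstIntegral.tderiv_flow {X : ∀ (_ : ℝ) (x : V), TangentSpace 𝓘(ℝ, E) x}
    (hf : IsFirstIntegral X f) (hφ : IsFlow X D φ) {t : ℝ} {x : V} (ht : (t, x) ∈ D) (u : E) :
    tderiv E ℝ f (φ t x) (tderiv E E (φ t) x u) = tderiv E ℝ f x u := by
  rw [← tderiv_comp (hf.smooth.mdifferentiable (by simp) _) (hφ.mdifferentiableAt ht)]
  have hev : ∀ᶠ y in 𝓝 x, (f ∘ φ t) y = f y := by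
    have hc : Continuous fun y : V => (t, y) := by fun_prop
    filter_upwards [hc.continuousAt.preimage_mem_nhds (hφ.isOpen.mem_nhds ht)] with y hy
    exact hf.apply_flow hφ hy
  rw [tderiv_congr (E := E) (F := ℝ) hev]

/-- Differentiating the constancy of `f` in time: the Hamiltonian vector field is tangent to the
levels and can be projected to the reduction. -/
lemma IsFirstIntegral.tderiv_hamVec (hf : IsFirstIntegral (timeHamiltonianVectorField Ω h) f)
    (hφ : IsFlow (timeHamiltonianVectorField Ω h) D φ) {t : ℝ} {x : V} (ht : (t, x) ∈ D) :
    tderiv E ℝ f (φ t x) (hamVec Ω (fun y => h (y, t)) (φ t x)) = 0 := by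
  have h1 := hφ.solution x t ht
  have h2 := (hf.smooth.mdifferentiable (by simp) (φ t x)).hasMFDerivAt.comp t h1
  have h3 : HasFDerivAt (fun s => f (φ s x)) ((tderiv E ℝ f (φ t x)).comp
      ((1 : ℝ →L[ℝ] ℝ).smulRight (hamVec Ω (fun y => h (y, t)) (φ t x)))) t := h2.hasFDerivAt
  have h4 : HasFDerivAt (fun s => f (φ s x)) (0 : ℝ →L[ℝ] ℝ) t := by
    refine (hasFDerivAt_const (f x) t).congr_of_eventuallyEq ?_
    filter_upwards [(hφ.isOpen_times x).mem_nhds ht] with s hs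
    exact hf.apply_flow hφ hs
  have h5 := DFunLike.congr_fun (h3.unique h4) 1
  simpa using h5

open Classical in
/-- The orbit of a point of the level, as a curve in the level. -/
def levelOrbit (φ : ℝ → V → V) (z : LevelSet f c) (t : ℝ) : LevelSet f c :=
  if h : f (φ t z) = c then ⟨φ t z, h⟩ else z

lemma IsFirstIntegral.coe_levelOrbit {X : ∀ (_ : ℝ) (x : V), TangentSpace 𝓘(ℝ, E) x}
    (hf : IsFirstIntegral X f) (hφ : IsFlow X D φ) {t : ℝ} {z : LevelSet f c}
    (ht : (t, (z : V)) ∈ D) : ((levelOrbit φ z t : LevelSet f c) : V) = φ t z := by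
  have : f (φ t z) = c := (hf.apply_flow hφ ht).trans z.2
  rw [levelOrbit, dif_pos this]

/-- The orbits in the level project to orbits of the reduced Hamiltonian. -/
lemma IsReduction.isSolutionOn_proj (R : IsReduction E₁ Ω f c ωW pr)
    (hh : ContMDiff (𝓘(ℝ, E).prod 𝓘(ℝ, ℝ)) 𝓘(ℝ, ℝ) ∞ h)
    (hφ : IsFlow (timeHamiltonianVectorField Ω h) D φ)
    (hf : IsFirstIntegral (timeHamiltonianVectorField Ω h) f) {g : W × ℝ → ℝ}
    (hg : ContMDiff (𝓘(ℝ, E₂).prod 𝓘(ℝ, ℝ)) 𝓘(ℝ, ℝ) ∞ g)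
    (hgh : ∀ (z : LevelSet f c) (t : ℝ), g (pr z, t) = h ((z : V), t)) (z : LevelSet f c) :
    IsSolutionOn (timeHamiltonianVectorField ωW g) (fun t => pr (levelOrbit φ z t))
      {t | (t, (z : V)) ∈ D} := by
  intro t ht
  obtain ⟨q, U, e⟩ := R.exists_localExtension (levelOrbit φ z t)
  have hz := e.mem
  have hcoe := hf.coe_levelOrbit hφ ht
  have h1 := hφ.solution z t ht
  have h2 := ((e.mdifferentiableAt (x := φ t z) (by rwa [← hcoe])).hasMFDerivAt.comp t h1)
  -- A vector of `TW` is determined by its pairings. Every vector to pair with lifts to one tangent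
  -- to the level, and there the two forms and the differentials of the two Hamiltonians correspond.
  have hham : tderiv E E₂ q (φ t z) (hamVec Ω (fun y => h (y, t)) (φ t z))
      = hamVec ωW (fun w => g (w, t)) (pr (levelOrbit φ z t)) := by
    have h0 := hf.tderiv_hamVec hφ ht
    rw [← hcoe] at h0 ⊢
    refine eq_hamVec fun w => ?_
    obtain ⟨v, hv, rfl⟩ := R.exists_tderiv_extension_eq e hz w
    rw [R.bilin_tderiv_extension e hz h0 hv, bilin_hamVec,
      R.tderiv_comp_extension e hz (b := fun y => h (y, t))
        ((contMDiff_slice hg t).mdifferentiable (by simp) _)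
        ((contMDiff_slice hh t).mdifferentiable (by simp) _)
        (Filter.Eventually.of_forall fun z' => hgh z' t) hv]
  obtain ⟨L, hL⟩ : ∃ L : ℝ →L[ℝ] E₂, L = (1 : ℝ →L[ℝ] ℝ).smulRight
    (hamVec ωW (fun w => g (w, t)) (pr (levelOrbit φ z t))) := ⟨_, rfl⟩
  have h4 : (tderiv E E₂ q (φ t z)).comp
      ((1 : ℝ →L[ℝ] ℝ).smulRight (hamVec Ω (fun y => h (y, t)) (φ t z)))
      = L := by
    rw [hL]
    ext
    simp [hham]
  have h3 : HasMFDerivAt 𝓘(ℝ, ℝ) 𝓘(ℝ, E₂) (fun s => q (φ s z)) t L := h2.congr_mfderiv h4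
  suffices h5 : HasMFDerivAt 𝓘(ℝ, ℝ) 𝓘(ℝ, E₂) (fun t => pr (levelOrbit φ z t)) t L by
    rw [hL] at h5
    exact h5
  refine h3.congr_of_eventuallyEq ?_
  have hcont : ContinuousAt (fun s => φ s z) t := h1.continuousAt
  filter_upwards [(hφ.isOpen_times (z : V)).mem_nhds ht,
    hcont.preimage_mem_nhds (e.isOpen.mem_nhds (by rwa [← hcoe]))] with s hs hs'
  have hcs := hf.coe_levelOrbit hφ hs
  rw [← hcs]
  exact (e.eq _ (by rw [hcs]; exact hs')).symm

/-- The flow of the reduced Hamiltonian is the projection of the flow on the level. -/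
lemma IsReduction.flow_proj [T2Space W] (R : IsReduction E₁ Ω f c ωW pr)
    (hh : ContMDiff (𝓘(ℝ, E).prod 𝓘(ℝ, ℝ)) 𝓘(ℝ, ℝ) ∞ h)
    (hφ : IsFlow (timeHamiltonianVectorField Ω h) D φ)
    (hf : IsFirstIntegral (timeHamiltonianVectorField Ω h) f) {g : W × ℝ → ℝ}
    (hg : ContMDiff (𝓘(ℝ, E₂).prod 𝓘(ℝ, ℝ)) 𝓘(ℝ, ℝ) ∞ g)
    (hgh : ∀ (z : LevelSet f c) (t : ℝ), g (pr z, t) = h ((z : V), t))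
    {DW : Set (ℝ × W)} {ψ : ℝ → W → W} (hψ : IsFlow (timeHamiltonianVectorField ωW g) DW ψ)
    {t : ℝ} {z : LevelSet f c} (ht : (t, (z : V)) ∈ D) :
    (t, pr z) ∈ DW ∧ ψ t (pr z) = pr (levelOrbit φ z t) := by
  obtain ⟨a, b, h0, ht', hab⟩ := exists_Ioo_subset (hφ.isOpen_times (z : V)) (hφ.ordConnected z)
    (hφ.zero_mem z) ht
  have hsol := R.isSolutionOn_proj hh hφ hf hg hgh z
  have h1 := hψ.eq_of_solution hg h0.1 h0.2 (fun s hs => hsol s (hab hs)) ht'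
  have h2 : levelOrbit φ z 0 = z := Subtype.ext <| by
    rw [hf.coe_levelOrbit hφ (hφ.zero_mem _), hφ.zero_apply]
  simp only [h2] at h1
  exact ⟨h1.1, h1.2.symm⟩

/-- The linearized flows are related by the derivative of the projection. -/
lemma IsReduction.tderiv_flow_proj [T2Space W] (R : IsReduction E₁ Ω f c ωW pr)
    (hh : ContMDiff (𝓘(ℝ, E).prod 𝓘(ℝ, ℝ)) 𝓘(ℝ, ℝ) ∞ h)
    (hφ : IsFlow (timeHamiltonianVectorField Ω h) D φ)
    (hf : IsFirstIntegral (timeHamiltonianVectorField Ω h) f) {g : W × ℝ → ℝ}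
    (hg : ContMDiff (𝓘(ℝ, E₂).prod 𝓘(ℝ, ℝ)) 𝓘(ℝ, ℝ) ∞ g)
    (hgh : ∀ (z : LevelSet f c) (t : ℝ), g (pr z, t) = h ((z : V), t))
    {DW : Set (ℝ × W)} {ψ : ℝ → W → W} (hψ : IsFlow (timeHamiltonianVectorField ωW g) DW ψ)
    {t : ℝ} {z z₁ : LevelSet f c} (ht : (t, (z : V)) ∈ D) (e : LocalExtension E E₂ pr z₀ q U)
    (hz : (z : V) ∈ U) {q₁ : V → W} {U₁ : Set V} (e₁ : LocalExtension E E₂ pr z₁ q₁ U₁)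
    (hz₁ : φ t z ∈ U₁) {u : E} (hu : tderiv E ℝ f z u = 0) :
    tderiv E₂ E₂ (ψ t) (pr z) (tderiv E E₂ q z u)
      = tderiv E E₂ q₁ (φ t z) (tderiv E E (φ t) z u) := by
  have hflow := hφ.mdifferentiableAt ht
  have hψt := hψ.mdifferentiableAt (R.flow_proj hh hφ hf hg hgh hψ ht).1
  rw [← tderiv_comp (e₁.mdifferentiableAt hz₁) hflow]
  -- The functions compared are `ψ t` on the reduction and `q₁ ∘ φ t` on `V`; they correspond on the
  -- level by `flow_proj`.
  refine R.tderiv_comp_extension e hz hψt (MDifferentiableAt.comp (z : V)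
    (e₁.mdifferentiableAt hz₁) hflow) ?_ hu
  have hc : Continuous fun z' : LevelSet f c => (t, (z' : V)) := by fun_prop
  have hc' : ContinuousAt (fun z' : LevelSet f c => φ t z') z :=
    ContinuousAt.comp (g := φ t) hflow.continuousAt continuous_subtype_val.continuousAt
  filter_upwards [hc.continuousAt.preimage_mem_nhds (hφ.isOpen.mem_nhds ht),
    hc'.preimage_mem_nhds (e₁.isOpen.mem_nhds hz₁)] with z' hz' hz''
  rw [(R.flow_proj hh hφ hf hg hgh hψ hz').2]
  have hcs := hf.coe_levelOrbit hφ hz'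
  rw [Function.comp, ← hcs]
  exact (e₁.eq _ (by rw [hcs]; exact hz'')).symm

end Reduction

/-! ### The standard form on block vectors, and symplectic matrices. -/

namespace CZ

variable {n : ℕ}

lemma stdForm_blockVec (x x' : Fin n ⊕ Fin n → ℝ) (y y' : Fin 1 ⊕ Fin 1 → ℝ) :
    stdForm (blockVec x y) (blockVec x' y') = stdForm x x' + stdForm y y' := by
  rw [stdForm, ← blockSum_J, blockSum_mulVec, blockVec_dotProduct]
  rfl

lemma stdForm_fin_one (a b a' b' : ℝ) :
    stdForm (n := 1) (Sum.elim (fun _ => a) fun _ => b) (Sum.elim (fun _ => a') fun _ => b')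
      = a * b' - b * a' := by
  simp [stdForm, Matrix.J, Matrix.mulVec, dotProduct]
  ring

lemma stdForm_J_single (a : Fin n ⊕ Fin n → ℝ) (i : Fin n ⊕ Fin n) :
    stdForm a (Matrix.J (Fin n) ℝ *ᵥ Pi.single i 1) = a i := by
  rw [stdForm, Matrix.dotProduct_mulVec, ← Matrix.mulVec_transpose, Matrix.mulVec_mulVec,
    J_transpose_mul_J, Matrix.one_mulVec, dotProduct_single, mul_one]

lemma toMatrix'_mem {A : (Fin n ⊕ Fin n → ℝ) →ₗ[ℝ] (Fin n ⊕ Fin n → ℝ)}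
    (hA : ∀ a b, stdForm (A a) (A b) = stdForm a b) :
    LinearMap.toMatrix' A ∈ Matrix.symplecticGroup (Fin n) ℝ := by
  rw [SymplecticGroup.mem_iff']
  have h : ∀ a b, (((LinearMap.toMatrix' A)ᵀ * Matrix.J (Fin n) ℝ * LinearMap.toMatrix' A) *ᵥ a) ⬝ᵥ b
      = (Matrix.J (Fin n) ℝ *ᵥ a) ⬝ᵥ b := by
    intro a b
    have := hA a b
    rw [← LinearMap.toMatrix'_mulVec, ← LinearMap.toMatrix'_mulVec, stdForm, stdForm,
      Matrix.dotProduct_mulVec] at this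
    rw [← this, ← Matrix.mulVec_mulVec, ← Matrix.mulVec_mulVec, Matrix.mulVec_transpose]
  ext i j
  have := h (Pi.single j 1) (Pi.single i 1)
  simpa using this

end CZ

/-! ### Continuity of tangent vectors and of their coordinates in a frame. -/

section Frames

variable {E : Type*} [NormedAddCommGroup E] [NormedSpace ℝ E]
  {M : Type*} [TopologicalSpace M] [ChartedSpace E M] [IsManifold 𝓘(ℝ, E) ∞ M]
  {Ω : SymplecticForm E M} {n : ℕ} {σ : C(Disk, M)}
  {F : Type*} [NormedAddCommGroup F] [NormedSpace ℝ F]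
  {N : Type*} [TopologicalSpace N] [ChartedSpace F N] [IsManifold 𝓘(ℝ, F) ∞ N]
  {X : Type*} [TopologicalSpace X]

/-- A tangent vector given by a vector of the model space. -/
def tvec (x : M) (u : E) : TangentBundle 𝓘(ℝ, E) M := ⟨x, u⟩

/-- The coordinates of a symplectic trivialization, on the model space. -/
def SymplecticTrivialization.frame (Φ : SymplecticTrivialization Ω n σ) (p : Disk) :
    E ≃ₗ[ℝ] (Fin n ⊕ Fin n → ℝ) := Φ.toEquiv p

lemma SymplecticTrivialization.bilin_eq (Φ : SymplecticTrivialization Ω n σ) (p : Disk) (u v : E) :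
    Ω.bilin (σ p) u v = CZ.stdForm (Φ.frame p u) (Φ.frame p v) := Φ.symplectic p u v

lemma SymplecticTrivialization.continuous_frame_symm (Φ : SymplecticTrivialization Ω n σ)
    (a : Fin n ⊕ Fin n → ℝ) : Continuous fun p => tvec (σ p) ((Φ.frame p).symm a) :=
  Φ.continuous_symm a

lemma SymplecticTrivialization.coord_of_eq (Φ : SymplecticTrivialization Ω n σ) {p : Disk} {x : M}
    {u : E} (hx : x = σ p) : Φ.coord p (tvec x u) = Φ.frame p u := by
  subst hx
  rw [SymplecticTrivialization.coord, dif_pos (show (tvec (σ p) u).proj = σ p from rfl)]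
  rfl

/-- The coordinates in a symplectic frame are pairings with frame vectors. A trivialization is only
required to have continuous frame vectors, and this formula yields continuity of the coordinates. -/
lemma SymplecticTrivialization.frame_apply (Φ : SymplecticTrivialization Ω n σ) (p : Disk) (u : E)
    (i : Fin n ⊕ Fin n) : Φ.frame p u i
      = Ω.bilin (σ p) u ((Φ.frame p).symm (Matrix.J (Fin n) ℝ *ᵥ Pi.single i 1)) := by
  rw [Φ.bilin_eq, LinearEquiv.apply_symm_apply, CZ.stdForm_J_single]

lemma continuousAt_base {b : X → M} {u : X → E} {x₀ : X}
    (hu : ContinuousAt (fun x => tvec (b x) (u x)) x₀) : ContinuousAt b x₀ :=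
  (FiberBundle.continuous_proj E (fun x : M => TangentSpace 𝓘(ℝ, E) x)).continuousAt.comp hu

lemma continuousAt_bilin {b : X → M} {u v : X → E} {x₀ : X}
    (hu : ContinuousAt (fun x => tvec (b x) (u x)) x₀)
    (hv : ContinuousAt (fun x => tvec (b x) (v x)) x₀) :
    ContinuousAt (fun x => Ω.bilin (b x) (u x) (v x)) x₀ := by
  have h1 : ContinuousAt (fun x => TotalSpace.mk' (E →L[ℝ] E →L[ℝ] ℝ)
      (E := fun x : M => TangentSpace 𝓘(ℝ, E) x →L[ℝ] TangentSpace 𝓘(ℝ, E) x →L[ℝ] ℝ)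
      (b x) (Ω.toFun (b x))) x₀ :=
    ContinuousAt.comp (f := b) Ω.smooth.continuous.continuousAt (continuousAt_base hu)
  have h2 := ContinuousAt.clm_bundle_apply₂ (F₃ := ℝ) (E₃ := Bundle.Trivial M ℝ) h1 hu hv
  exact ((FiberBundle.continuousAt_totalSpace _ _).1 h2).2

lemma continuousAt_tderiv_fun {f : M → ℝ} (hf : ContMDiff 𝓘(ℝ, E) 𝓘(ℝ, ℝ) ∞ f) {b : X → M}
    {u : X → E} {x₀ : X} (hu : ContinuousAt (fun x => tvec (b x) (u x)) x₀) :
    ContinuousAt (fun x => tderiv E ℝ f (b x) (u x)) x₀ := by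
  have h1 := (hf.continuous_tangentMap (by simp)).continuousAt.comp hu
  have h2 := (tangentBundleModelSpaceHomeomorph 𝓘(ℝ, ℝ)).continuous.continuousAt.comp h1
  exact continuousAt_snd.comp h2

lemma continuousAt_tderiv {q : M → N} {U : Set M} (hU : IsOpen U)
    (hq : ContMDiffOn 𝓘(ℝ, E) 𝓘(ℝ, F) 1 q U) {b : X → M} {u : X → E} {x₀ : X} (hx₀ : b x₀ ∈ U)
    (hu : ContinuousAt (fun x => tvec (b x) (u x)) x₀) :
    ContinuousAt (fun x => tvec (q (b x)) (tderiv E F q (b x) (u x))) x₀ := by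
  have h1 := hq.continuousOn_tangentMapWithin le_rfl hU.uniqueMDiffOn
  have hpre : IsOpen (TotalSpace.proj ⁻¹' U : Set (TangentBundle 𝓘(ℝ, E) M)) :=
    hU.preimage (FiberBundle.continuous_proj E (fun x : M => TangentSpace 𝓘(ℝ, E) x))
  have h2 := (h1.continuousAt (hpre.mem_nhds (x := tvec (b x₀) (u x₀)) hx₀)).comp
    (f := fun x => tvec (b x) (u x)) hu
  refine h2.congr ?_
  filter_upwards [(continuousAt_base hu).preimage_mem_nhds (hU.mem_nhds hx₀)] with x hx
  have : mfderivWithin 𝓘(ℝ, E) 𝓘(ℝ, F) q U (b x) = mfderiv 𝓘(ℝ, E) 𝓘(ℝ, F) q (b x) :=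
    mfderivWithin_of_isOpen hU hx
  simp only [Function.comp, tangentMapWithin, tvec, this]
  rfl

lemma SymplecticTrivialization.continuousAt_frame (Φ : SymplecticTrivialization Ω n σ) {b : X → Disk}
    {u : X → E} {x₀ : X} (hb : ContinuousAt b x₀)
    (hu : ContinuousAt (fun x => tvec (σ (b x)) (u x)) x₀) :
    ContinuousAt (fun x => Φ.frame (b x) (u x)) x₀ := by
  refine continuousAt_pi.2 fun i => ?_
  simp only [Φ.frame_apply]
  exact continuousAt_bilin hu (ContinuousAt.comp (f := b)
    (Φ.continuous_frame_symm _).continuousAt hb)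

/-- Linear combinations of the vectors of a frame, with continuous coefficients, are continuous. -/
lemma SymplecticTrivialization.continuousAt_frame_symm (Φ : SymplecticTrivialization Ω n σ)
    {b : X → Disk} {a : X → Fin n ⊕ Fin n → ℝ} {x₀ : X} (hb : ContinuousAt b x₀)
    (ha : ContinuousAt a x₀) :
    ContinuousAt (fun x => tvec (σ (b x)) ((Φ.frame (b x)).symm (a x))) x₀ := by
  have hσ : ContinuousAt (fun x => σ (b x)) x₀ := σ.continuous.continuousAt.comp hb
  refine (FiberBundle.continuousAt_totalSpace _ _).2 ⟨hσ, ?_⟩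
  set e := trivializationAt E (fun x : M => TangentSpace 𝓘(ℝ, E) x) (σ (b x₀)) with he
  have hk : ∀ k : Fin n ⊕ Fin n, ContinuousAt
      (fun x => (e (tvec (σ (b x)) ((Φ.frame (b x)).symm (Pi.single k 1)))).2) x₀ := fun k =>
    ((FiberBundle.continuousAt_totalSpace _ _).1 (ContinuousAt.comp (f := b)
      (Φ.continuous_frame_symm (Pi.single k 1)).continuousAt hb)).2
  have hsum : ContinuousAt (fun x => ∑ k, a x k •
      (e (tvec (σ (b x)) ((Φ.frame (b x)).symm (Pi.single k 1)))).2) x₀ :=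
    tendsto_finsetSum _ fun k _ => ((continuousAt_pi.1 ha k).smul (hk k))
  refine hsum.congr ?_
  have hbase : e.baseSet ∈ 𝓝 (σ (b x₀)) :=
    e.open_baseSet.mem_nhds (FiberBundle.mem_baseSet_trivializationAt' _)
  filter_upwards [hσ.preimage_mem_nhds hbase] with x hx
  have hlin := e.linear ℝ hx
  set l : E →ₗ[ℝ] E := hlin.mk' _ with hl
  have hl' : ∀ u : E, l u = (e (tvec (σ (b x)) u)).2 := fun u => rfl
  change _ = (e (tvec (σ (b x)) ((Φ.frame (b x)).symm (a x)))).2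
  simp only [← hl', ← map_smul, ← map_sum]
  congr 2
  ext i
  simp [Finset.sum_apply, Pi.single_apply]

end Frames

/-! ### The gradient and its transport by the flow. -/

section Gradient

variable {E : Type*} [NormedAddCommGroup E] [NormedSpace ℝ E] [FiniteDimensional ℝ E]
  {V : Type*} [TopologicalSpace V] [ChartedSpace E V] [IsManifold 𝓘(ℝ, E) ∞ V]
  {Ω : SymplecticForm E V} {f : V → ℝ} {c : ℝ} {h : V × ℝ → ℝ} {D : Set (ℝ × V)} {φ : ℝ → V → V}

/-- The almost complex structure on the model space. -/
def CompatibleAlmostComplex.map (J : CompatibleAlmostComplex Ω) (x : V) : E →L[ℝ] E := J.toFun x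

lemma CompatibleAlmostComplex.map_map (J : CompatibleAlmostComplex Ω) (x : V) (u : E) :
    J.map x (J.map x u) = -u := J.sq x u

lemma CompatibleAlmostComplex.pos (J : CompatibleAlmostComplex Ω) (x : V) {u : E} (hu : u ≠ 0) :
    0 < Ω.bilin x u (J.map x u) := J.positive x u hu

/-- The gradient as a vector of the model space. -/
def gradVec (J : CompatibleAlmostComplex Ω) (f : V → ℝ) (x : V) : E := gradientField J f x

lemma bilin_gradVec_map (J : CompatibleAlmostComplex Ω) (f : V → ℝ) (x : V) (v : E) :
    Ω.bilin x (gradVec J f x) (J.map x v) = tderiv E ℝ f x v := by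
  obtain ⟨u, hu⟩ := Ω.exists_bilin_eq x (-(tderiv E ℝ f x).comp (J.map x))
  have key : ∀ v : E, Ω.bilin x u (J.map x v) = tderiv E ℝ f x v := fun v => by
    rw [hu]
    change -(tderiv E ℝ f x (J.map x (J.map x v))) = tderiv E ℝ f x v
    rw [J.map_map, map_neg, neg_neg]
  exact Classical.epsilon_spec (p := fun u : TangentSpace 𝓘(ℝ, E) x =>
    ∀ v, Ω.toFun x u (J.toFun x v) = (mfderiv 𝓘(ℝ, E) 𝓘(ℝ, ℝ) f x v : ℝ)) ⟨u, key⟩ v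

lemma bilin_gradVec (J : CompatibleAlmostComplex Ω) (f : V → ℝ) (x : V) (v : E) :
    Ω.bilin x (gradVec J f x) v = -tderiv E ℝ f x (J.map x v) := by
  have h1 := bilin_gradVec_map J f x (J.map x v)
  rw [J.map_map, map_neg] at h1
  linarith

/-- At a regular point `df(∇f)` is the squared length of a nonzero vector. -/
lemma tderiv_gradVec_ne_zero (J : CompatibleAlmostComplex Ω) {x : V} (hx : tderiv E ℝ f x ≠ 0) :
    tderiv E ℝ f x (gradVec J f x) ≠ 0 := by
  have hne : gradVec J f x ≠ 0 := fun h0 => hx <| by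
    ext v
    rw [← bilin_gradVec_map J, h0, map_zero]
    rfl
  rw [← bilin_gradVec_map J]
  exact (J.pos x hne).ne'

/-- The gradient, normalized to have `df (N) = 1`. -/
def normGrad (J : CompatibleAlmostComplex Ω) (f : V → ℝ) (x : V) : E :=
  (tderiv E ℝ f x (gradVec J f x))⁻¹ • gradVec J f x

lemma tderiv_normGrad (J : CompatibleAlmostComplex Ω) {x : V} (hx : tderiv E ℝ f x ≠ 0) :
    tderiv E ℝ f x (normGrad J f x) = 1 := by
  rw [normGrad, map_smul, smul_eq_mul, inv_mul_cancel₀ (tderiv_gradVec_ne_zero J hx)]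

/-- By hypothesis the flow maps the gradient to a multiple of the gradient, and invariance of `df`
determines the multiple. The normalization turns invariance of a line field into invariance of a
vector field. -/
lemma tderiv_flow_normGrad (J : CompatibleAlmostComplex Ω)
    (hφ : IsFlow (timeHamiltonianVectorField Ω h) D φ)
    (hf : IsFirstIntegral (timeHamiltonianVectorField Ω h) f) (hgrad : PreservesGradientSpan J f c D φ)
    {t : ℝ} {z : V} (ht : (t, z) ∈ D) (hz : f z = c) (hdf : tderiv E ℝ f z ≠ 0)
    (hdf' : tderiv E ℝ f (φ t z) ≠ 0) :
    tderiv E E (φ t) z (normGrad J f z) = normGrad J f (φ t z) := by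
  obtain ⟨a, ha⟩ := Submodule.mem_span_singleton.1 (hgrad t z ht hz)
  have ha' : a • gradVec J f (φ t z) = tderiv E E (φ t) z (gradVec J f z) := ha
  have h1 := hf.tderiv_flow hφ ht (gradVec J f z)
  rw [← ha', map_smul, smul_eq_mul] at h1
  have h2 := tderiv_gradVec_ne_zero J hdf
  have h3 := tderiv_gradVec_ne_zero J hdf'
  rw [normGrad, map_smul, ← ha', normGrad, smul_smul, ← h1]
  congr 1
  have ha0 : a ≠ 0 := fun h0 => h2 (by rw [← h1, h0, zero_mul])
  field_simp

end Gradient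

/-! ### Symplectic coordinates adapted to the reduction. -/

section AdaptedCoordinates

variable {E : Type*} [NormedAddCommGroup E] [NormedSpace ℝ E]
  {E₂ : Type*} [NormedAddCommGroup E₂] [NormedSpace ℝ E₂] {n : ℕ}

/-- Coordinates adapted to a splitting into the symplectic plane of the reduction and its
complement. -/
def adaptedCoord (B : E →L[ℝ] E →L[ℝ] ℝ) (l : E →L[ℝ] ℝ) (N : E) (P : E →L[ℝ] E₂)
    (fr : E₂ ≃ₗ[ℝ] (Fin n ⊕ Fin n → ℝ)) : E →ₗ[ℝ] (Fin (n + 1) ⊕ Fin (n + 1) → ℝ) where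
  toFun w := CZ.blockVec (fr (P (w - l w • N))) (Sum.elim (fun _ => l w) fun _ => B N w)
  map_add' w w' := by
    rw [← CZ.blockVec_add]
    congr 1
    · rw [← map_add, ← map_add]
      congr 2
      rw [map_add, add_smul]
      abel
    · ext (i | i) <;> simp
  map_smul' r w := by
    rw [RingHom.id_apply, ← CZ.blockVec_smul]
    congr 1
    · rw [← map_smul, ← map_smul]
      congr 2
      rw [map_smul, smul_sub, smul_assoc]
    · ext (i | i) <;> simp

lemma adaptedCoord_apply (B : E →L[ℝ] E →L[ℝ] ℝ) (l : E →L[ℝ] ℝ) (N : E) (P : E →L[ℝ] E₂)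
    (fr : E₂ ≃ₗ[ℝ] (Fin n ⊕ Fin n → ℝ)) (w : E) : adaptedCoord B l N P fr w
      = CZ.blockVec (fr (P (w - l w • N))) (Sum.elim (fun _ => l w) fun _ => B N w) := rfl

/-- The vector `w - l w • N` lies in `ker l`, where `P` relates `B` to the reduced form. What is
lost by subtracting multiples of `N` is `l w * B N w' - B N w * l w'`, the standard form of the last
two coordinates. -/
lemma stdForm_adaptedCoord {B : E →L[ℝ] E →L[ℝ] ℝ} {l : E →L[ℝ] ℝ} {N : E} {P : E →L[ℝ] E₂}
    {fr : E₂ ≃ₗ[ℝ] (Fin n ⊕ Fin n → ℝ)} (hB : ∀ u v, B u v = -B v u) (hN : l N = 1)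
    (hP : ∀ u v, l u = 0 → l v = 0 → CZ.stdForm (fr (P u)) (fr (P v)) = B u v) (w w' : E) :
    CZ.stdForm (adaptedCoord B l N P fr w) (adaptedCoord B l N P fr w') = B w w' := by
  have hker : ∀ w, l (w - l w • N) = 0 := fun w => by
    rw [map_sub, map_smul, hN, smul_eq_mul, mul_one, sub_self]
  rw [adaptedCoord_apply, adaptedCoord_apply, CZ.stdForm_blockVec, CZ.stdForm_fin_one,
    hP _ _ (hker w) (hker w')]
  have hNN : B N N = 0 := by linarith [hB N N]
  simp only [map_sub, map_smul, _root_.sub_apply, _root_.smul_apply, smul_eq_mul, hNN]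
  rw [hB w N]
  ring

end AdaptedCoordinates

/-! ### The linearized flow in a trivialization. -/

section Linearization

variable {E : Type*} [NormedAddCommGroup E] [NormedSpace ℝ E] [FiniteDimensional ℝ E]
  {M : Type*} [TopologicalSpace M] [ChartedSpace E M] [IsManifold 𝓘(ℝ, E) ∞ M]
  {Ω : SymplecticForm E M} {n : ℕ} {σ : C(Disk, M)} {D : Set (ℝ × M)} {φ : ℝ → M → M}
  {h : M × ℝ → ℝ}

/-- In charts the linearized flow is a space derivative of a smooth function of time and position,
hence continuous in time; the chart at `φ t₀ x` carries this back to the tangent bundle. -/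
lemma IsFlow.continuousAt_tvec {X : ∀ (_ : ℝ) (x : M), TangentSpace 𝓘(ℝ, E) x} (hφ : IsFlow X D φ)
    {t₀ : ℝ} {x : M} (ht₀ : (t₀, x) ∈ D) (u : E) :
    ContinuousAt (fun t => tvec (φ t x) (tderiv E E (φ t) x u)) t₀ := by
  have hxs := mem_extChartAt_source (I := 𝓘(ℝ, E)) x
  set y₀ := extChartAt 𝓘(ℝ, E) x x with hy₀
  have hy : (extChartAt 𝓘(ℝ, E) x).symm y₀ = x := (extChartAt 𝓘(ℝ, E) x).left_inv hxs
  set p := φ t₀ x with hp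
  have hq : (t₀, y₀) ∈ chartFlowDomain E D φ x p := by
    refine ⟨(extChartAt 𝓘(ℝ, E) x).map_source hxs, ?_, ?_⟩
    · rw [hy]; exact ht₀
    · rw [hy]; exact mem_extChartAt_source p
  have hopen := (hφ.isOpen_chartFlowDomain x p).mem_nhds hq
  have hcont : Continuous fun t : ℝ => (t, y₀) := by fun_prop
  have hF := hφ.contDiffAt_chartFlow hq
  have h1 : ContinuousAt (fun t => chartFlow E φ x p (t, y₀)) t₀ :=
    ContinuousAt.comp (f := fun t : ℝ => (t, y₀)) hF.continuousAt hcont.continuousAt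
  have h2 : ContinuousAt (fun t => fderiv ℝ (chartFlow E φ x p) (t, y₀)
      (0, tderiv E E (extChartAt 𝓘(ℝ, E) x) x u)) t₀ := by
    have h3 := (hF.fderiv_right (m := 1) (by rw [one_add_one_eq_two]; exact two_le_infty)).continuousAt
    exact (ContinuousAt.comp (f := fun t : ℝ => (t, y₀)) h3 hcont.continuousAt).clm_apply
      continuousAt_const
  have h3 : ContinuousAt (fun t => tvec (E := E) (M := E) (chartFlow E φ x p (t, y₀))
      (fderiv ℝ (chartFlow E φ x p) (t, y₀) (0, tderiv E E (extChartAt 𝓘(ℝ, E) x) x u))) t₀ :=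
    (tangentBundleModelSpaceHomeomorph 𝓘(ℝ, E)).symm.continuous.continuousAt.comp (h1.prodMk h2)
  have h4 := continuousAt_tderiv (b := fun t => chartFlow E φ x p (t, y₀))
    (u := fun t => fderiv ℝ (chartFlow E φ x p) (t, y₀)
      (0, tderiv E E (extChartAt 𝓘(ℝ, E) x) x u)) (x₀ := t₀) (isOpen_extChartAt_target p)
    ((contMDiffOn_extChartAt_symm (I := 𝓘(ℝ, E)) (n := ∞) p).of_le (by simp))
    (chartFlow_mem_target (E := E) hq) h3
  refine h4.congr ?_
  filter_upwards [hcont.continuousAt.preimage_mem_nhds hopen] with t ht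
  have e1 := symm_chartFlow (E := E) ht
  have e2 := hφ.tderiv_symm_fderiv_chartFlow ht (tderiv E E (extChartAt 𝓘(ℝ, E) x) x u)
  simp only [hy] at e1 e2
  rw [e1, e2, hy₀, tderiv_extChartAt_symm_comp hxs]

/-- The linearized flow in a trivialization, as a linear map. -/
def linearizedMap (φ : ℝ → M → M) (Φ : SymplecticTrivialization Ω n σ) (p p' : Disk) (t : ℝ) :
    (Fin n ⊕ Fin n → ℝ) →ₗ[ℝ] (Fin n ⊕ Fin n → ℝ) :=
  (Φ.frame p').toLinearMap ∘ₗ (tderiv E E (φ t) (σ p)).toLinearMap ∘ₗ (Φ.frame p).symm.toLinearMap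

lemma linearizedPath_eq {T t : ℝ} (Φ : SymplecticTrivialization Ω n σ)
    (ht : φ t (σ (boundaryPoint 0)) = σ (boundaryPoint (t / T))) :
    linearizedPath φ T Φ t
      = LinearMap.toMatrix' (linearizedMap φ Φ (boundaryPoint 0) (boundaryPoint (t / T)) t) := by
  ext i j
  rw [LinearMap.toMatrix'_apply]
  exact congrFun (Φ.coord_of_eq (u := tderiv E E (φ t) (σ (boundaryPoint 0))
    ((Φ.frame (boundaryPoint 0)).symm (Pi.single j 1))) ht) i

lemma IsFlow.continuousOn_linearizedPath {X : ∀ (_ : ℝ) (x : M), TangentSpace 𝓘(ℝ, E) x}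
    (hφ : IsFlow X D φ) {T : ℝ} (Φ : SymplecticTrivialization Ω n σ)
    (hD : ∀ t ∈ Icc 0 T, (t, σ (boundaryPoint 0)) ∈ D)
    (ht : ∀ t ∈ Icc 0 T, φ t (σ (boundaryPoint 0)) = σ (boundaryPoint (t / T))) :
    ContinuousOn (linearizedPath φ T Φ) (Icc 0 T) := by
  rw [continuousOn_iff_continuous_domRestrict]
  refine continuous_iff_continuousAt.2 fun t₀ => ?_
  have h1 : (Icc 0 T).domRestrict (linearizedPath φ T Φ) = fun t : Icc 0 T => LinearMap.toMatrix'
      (linearizedMap φ Φ (boundaryPoint 0) (boundaryPoint ((t : ℝ) / T)) t) :=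
    funext fun t => linearizedPath_eq Φ (ht t t.2)
  rw [h1]
  refine continuousAt_pi.2 fun i => continuousAt_pi.2 fun j => ?_
  have hb : Continuous fun t : Icc 0 T => boundaryPoint ((t : ℝ) / T) :=
    CZ.continuous_boundaryPoint.comp (by fun_prop)
  have h2 := Φ.continuousAt_frame (x₀ := t₀) (u := fun t : Icc 0 T => tderiv E E (φ t)
    (σ (boundaryPoint 0)) ((Φ.frame (boundaryPoint 0)).symm (Pi.single j 1))) hb.continuousAt ?_
  · have h3 := continuousAt_pi.1 h2 i
    exact h3.congr (Filter.Eventually.of_forall fun t => (LinearMap.toMatrix'_apply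
      (linearizedMap φ Φ (boundaryPoint 0) (boundaryPoint ((t : ℝ) / T)) t) i j).symm)
  · have h3 := ContinuousAt.comp (f := fun t : Icc 0 T => (t : ℝ)) (x := t₀)
      (hφ.continuousAt_tvec (hD t₀ t₀.2)
        ((Φ.frame (boundaryPoint 0)).symm (Pi.single j 1))) continuous_subtype_val.continuousAt
    refine h3.congr (Filter.Eventually.of_forall fun t => ?_)
    simp only [Function.comp, ht t t.2]

lemma IsFlow.linearizedPath_mem (hφ : IsFlow (timeHamiltonianVectorField Ω h) D φ)
    (hh : ContMDiff (𝓘(ℝ, E).prod 𝓘(ℝ, ℝ)) 𝓘(ℝ, ℝ) ∞ h) {T t : ℝ}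
    (Φ : SymplecticTrivialization Ω n σ) (hD : (t, σ (boundaryPoint 0)) ∈ D)
    (ht : φ t (σ (boundaryPoint 0)) = σ (boundaryPoint (t / T))) :
    linearizedPath φ T Φ t ∈ Matrix.symplecticGroup (Fin n) ℝ := by
  rw [linearizedPath_eq Φ ht]
  refine CZ.toMatrix'_mem fun a b => ?_
  have h1 := Φ.bilin_eq (boundaryPoint (t / T))
    (tderiv E E (φ t) (σ (boundaryPoint 0)) ((Φ.frame (boundaryPoint 0)).symm a))
    (tderiv E E (φ t) (σ (boundaryPoint 0)) ((Φ.frame (boundaryPoint 0)).symm b))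
  rw [← ht, hφ.bilin_tderiv hh hD, Φ.bilin_eq, LinearEquiv.apply_symm_apply,
    LinearEquiv.apply_symm_apply] at h1
  exact h1.symm

end Linearization

/-! ### Continuity of the normalized gradient over the disk. -/

section GradientSection

variable {E : Type*} [NormedAddCommGroup E] [NormedSpace ℝ E] [FiniteDimensional ℝ E]
  {M : Type*} [TopologicalSpace M] [ChartedSpace E M] [IsManifold 𝓘(ℝ, E) ∞ M]
  {Ω : SymplecticForm E M} {f : M → ℝ} {n : ℕ} {σ : C(Disk, M)}
  {X : Type*} [TopologicalSpace X]

lemma CompatibleAlmostComplex.continuousAt_map (J : CompatibleAlmostComplex Ω) {b : X → M} {u : X → E}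
    {x₀ : X} (hu : ContinuousAt (fun x => tvec (b x) (u x)) x₀) :
    ContinuousAt (fun x => tvec (b x) (J.map (b x) (u x))) x₀ := by
  have h1 : ContinuousAt (fun x => TotalSpace.mk' (E →L[ℝ] E)
      (E := fun x : M => TangentSpace 𝓘(ℝ, E) x →L[ℝ] TangentSpace 𝓘(ℝ, E) x)
      (b x) (J.toFun (b x))) x₀ :=
    ContinuousAt.comp (f := b) J.smooth.continuous.continuousAt (continuousAt_base hu)
  exact ContinuousAt.clm_bundle_apply h1 hu

/-- The gradient is chosen pointwise, so continuity is read off from its coordinates in the frame: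
up to sign they are the values of `df ∘ J` on continuous frame vectors. -/
lemma SymplecticTrivialization.continuousAt_normGrad (Φ : SymplecticTrivialization Ω n σ)
    (J : CompatibleAlmostComplex Ω) (hf : ContMDiff 𝓘(ℝ, E) 𝓘(ℝ, ℝ) ∞ f)
    (hdf : ∀ p, tderiv E ℝ f (σ p) ≠ 0) (p₀ : Disk) :
    ContinuousAt (fun p => tvec (σ p) (normGrad J f (σ p))) p₀ := by
  have h1 : ContinuousAt (fun p => Φ.frame p (gradVec J f (σ p))) p₀ := by
    refine continuousAt_pi.2 fun i => ?_
    simp only [Φ.frame_apply, bilin_gradVec]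
    exact (continuousAt_tderiv_fun hf (J.continuousAt_map
      (Φ.continuous_frame_symm _).continuousAt)).neg
  have h2 := Φ.continuousAt_frame_symm (b := fun p => p) continuousAt_id h1
  simp only [LinearEquiv.symm_apply_apply] at h2
  have h3 := (continuousAt_tderiv_fun hf h2).inv₀ (tderiv_gradVec_ne_zero J (hdf p₀))
  have h4 := Φ.continuousAt_frame_symm (b := fun p => p) continuousAt_id (h3.smul h1)
  simp only [Pi.smul_apply', Pi.inv_apply, map_smul, LinearEquiv.symm_apply_apply] at h4
  exact h4

end GradientSection

/-! ### Block form of the linearized flow and equality of the indices. -/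

section ReducedTrivialization

variable {E : Type*} [NormedAddCommGroup E] [NormedSpace ℝ E] [FiniteDimensional ℝ E]
  {V : Type*} [TopologicalSpace V] [ChartedSpace E V] [IsManifold 𝓘(ℝ, E) ∞ V]
  {E₁ : Type*} [NormedAddCommGroup E₁] [NormedSpace ℝ E₁] [FiniteDimensional ℝ E₁]
  {f : V → ℝ} {c : ℝ} [ChartedSpace E₁ (LevelSet f c)]
  [IsManifold 𝓘(ℝ, E₁) ∞ (LevelSet f c)]
  {E₂ : Type*} [NormedAddCommGroup E₂] [NormedSpace ℝ E₂] [FiniteDimensional ℝ E₂]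
  {W : Type*} [TopologicalSpace W] [ChartedSpace E₂ W] [IsManifold 𝓘(ℝ, E₂) ∞ W]
  {Ω : SymplecticForm E V} {ωW : SymplecticForm E₂ W} {pr : LevelSet f c → W}
  {n : ℕ} {σ : C(Disk, LevelSet f c)} {σW : C(Disk, W)} {q : Disk → V → W} {U : Disk → Set V}

lemma CZ.continuousAt_blockVec {X : Type*} [TopologicalSpace X] {x : X → Fin n ⊕ Fin n → ℝ}
    {y : X → Fin 1 ⊕ Fin 1 → ℝ} {x₀ : X} (hx : ContinuousAt x x₀) (hy : ContinuousAt y x₀) :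
    ContinuousAt (fun s => CZ.blockVec (x s) (y s)) x₀ := by
  refine continuousAt_pi.2 fun i => ?_
  simp only [CZ.blockVec, Function.comp]
  rcases (CZ.blockEquiv n).symm i with j | j
  · exact continuousAt_pi.1 hx j
  · exact continuousAt_pi.1 hy j

/-- On vectors tangent to the level every extension has the derivative of the projection itself, so
the choice of extensions is immaterial there. -/
lemma IsReduction.tderiv_extension_eq (R : IsReduction E₁ Ω f c ωW pr) {z₀ z₁ z : LevelSet f c}
    {q₀ q₁ : V → W} {U₀ U₁ : Set V} (e₀ : LocalExtension E E₂ pr z₀ q₀ U₀)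
    (e₁ : LocalExtension E E₂ pr z₁ q₁ U₁) (h₀ : (z : V) ∈ U₀) (h₁ : (z : V) ∈ U₁) {u : E}
    (hu : tderiv E ℝ f z u = 0) : tderiv E E₂ q₀ z u = tderiv E E₂ q₁ z u := by
  obtain ⟨u', rfl⟩ := exists_tderiv_levelIncl_eq R.level R.smooth_fun R.finrank hu
  rw [R.tderiv_extension e₀ h₀, R.tderiv_extension e₁ h₁]

/-- The trivialization of `TV` over the disk `σ` in the level that is the sum of a trivialization of
the tangent bundle of the reduction and of the plane spanned by the gradient and the Hamiltonian
vector field of `f`. Here `q p` extends the projection of the level near `σ p`. -/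
def adaptedFrame (J : CompatibleAlmostComplex Ω) (σ : C(Disk, LevelSet f c)) (q : Disk → V → W)
    (Λ : SymplecticTrivialization ωW n σW) (p : Disk) : E →ₗ[ℝ] (Fin (n + 1) ⊕ Fin (n + 1) → ℝ) :=
  adaptedCoord (Ω.bilin (σ p : V)) (tderiv E ℝ f (σ p : V)) (normGrad J f (σ p : V))
    (tderiv E E₂ (q p) (σ p : V)) (Λ.frame p)

/-- The change of trivialization from `Φ` to the adapted one. -/
def transitionMatrix (J : CompatibleAlmostComplex Ω) (q : Disk → V → W)
    (Φ : SymplecticTrivialization Ω (n + 1) (inclDisk σ)) (Λ : SymplecticTrivialization ωW n σW)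
    (p : Disk) : CZ.Mat (n + 1) :=
  LinearMap.toMatrix' (adaptedFrame J σ q Λ p ∘ₗ (Φ.frame p).symm.toLinearMap)

lemma IsReduction.stdForm_adaptedFrame (R : IsReduction E₁ Ω f c ωW pr)
    (J : CompatibleAlmostComplex Ω) (e : ∀ p, LocalExtension E E₂ pr (σ p) (q p) (U p))
    (hσ : ∀ p, σW p = pr (σ p)) (Λ : SymplecticTrivialization ωW n σW) (p : Disk) (u v : E) :
    CZ.stdForm (adaptedFrame J σ q Λ p u) (adaptedFrame J σ q Λ p v) = Ω.bilin (σ p : V) u v := by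
  refine stdForm_adaptedCoord (Ω.neg_swap _) (tderiv_normGrad J (R.level.regular (σ p)))
    (fun u v hu hv => ?_) u v
  rw [← Λ.bilin_eq, hσ, R.bilin_tderiv_extension (e p) (e p).mem hu hv]

lemma IsReduction.transitionMatrix_mem (R : IsReduction E₁ Ω f c ωW pr)
    (J : CompatibleAlmostComplex Ω) (e : ∀ p, LocalExtension E E₂ pr (σ p) (q p) (U p))
    (hσ : ∀ p, σW p = pr (σ p)) (Φ : SymplecticTrivialization Ω (n + 1) (inclDisk σ))
    (Λ : SymplecticTrivialization ωW n σW) (p : Disk) :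
    transitionMatrix J q Φ Λ p ∈ Matrix.symplecticGroup (Fin (n + 1)) ℝ := by
  refine CZ.toMatrix'_mem fun a b => ?_
  have h1 := Φ.bilin_eq p ((Φ.frame p).symm a) ((Φ.frame p).symm b)
  rw [LinearEquiv.apply_symm_apply, LinearEquiv.apply_symm_apply] at h1
  exact (R.stdForm_adaptedFrame J e hσ Λ p _ _).trans h1

/-- The extensions `q p` are chosen with no continuity in `p`. Their derivatives are applied to
vectors tangent to the level only, so near `p₀` the single extension `q p₀` may be used instead. -/
lemma IsReduction.continuousAt_adaptedFrame (R : IsReduction E₁ Ω f c ωW pr)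
    (J : CompatibleAlmostComplex Ω) (e : ∀ p, LocalExtension E E₂ pr (σ p) (q p) (U p))
    (hσ : ∀ p, σW p = pr (σ p)) (Φ : SymplecticTrivialization Ω (n + 1) (inclDisk σ))
    (Λ : SymplecticTrivialization ωW n σW) {w : Disk → E} {p₀ : Disk}
    (hw : ContinuousAt (fun p => tvec (σ p : V) (w p)) p₀) :
    ContinuousAt (fun p => adaptedFrame J σ q Λ p (w p)) p₀ := by
  have hN : ContinuousAt (fun p => tvec (σ p : V) (normGrad J f (σ p : V))) p₀ :=
    Φ.continuousAt_normGrad J R.smooth_fun (fun p => R.level.regular (σ p)) p₀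
  have hl := continuousAt_tderiv_fun R.smooth_fun hw
  have hB := continuousAt_bilin (Ω := Ω) hN hw
  have ha : ContinuousAt (fun p => tvec (σ p : V)
      (w p - tderiv E ℝ f (σ p : V) (w p) • normGrad J f (σ p : V))) p₀ := by
    have h1 := Φ.continuousAt_frame (b := fun p => p) continuousAt_id hw
    have h2 := Φ.continuousAt_frame (b := fun p => p) continuousAt_id hN
    have h3 := Φ.continuousAt_frame_symm (b := fun p => p) continuousAt_id (h1.sub (hl.smul h2))
    simp only [Pi.sub_apply, Pi.smul_apply', map_sub, map_smul, LinearEquiv.symm_apply_apply] at h3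
    exact h3
  have hker : ∀ p, tderiv E ℝ f (σ p : V)
      (w p - tderiv E ℝ f (σ p : V) (w p) • normGrad J f (σ p : V)) = 0 := fun p => by
    rw [map_sub, map_smul, tderiv_normGrad J (R.level.regular (σ p)), smul_eq_mul, mul_one, sub_self]
  have hq := continuousAt_tderiv (b := fun p => (σ p : V)) (x₀ := p₀) (e p₀).isOpen (e p₀).smooth (e p₀).mem ha
  have hev : ∀ᶠ p in 𝓝 p₀, (σ p : V) ∈ U p₀ :=
    (continuousAt_base hw).preimage_mem_nhds ((e p₀).isOpen.mem_nhds (e p₀).mem)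
  have hq' : ContinuousAt (fun p => tvec (σW p) (tderiv E E₂ (q p) (σ p : V)
      (w p - tderiv E ℝ f (σ p : V) (w p) • normGrad J f (σ p : V)))) p₀ := by
    refine hq.congr ?_
    filter_upwards [hev] with p hp
    rw [(e p₀).eq _ hp, ← hσ, R.tderiv_extension_eq (e p₀) (e p) hp (e p).mem (hker p)]
  have hfr := Λ.continuousAt_frame (b := fun p => p) continuousAt_id hq'
  refine CZ.continuousAt_blockVec hfr (continuousAt_pi.2 ?_)
  rintro (i | i)
  · exact hl
  · exact hB

lemma IsReduction.continuous_transitionMatrix (R : IsReduction E₁ Ω f c ωW pr)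
    (J : CompatibleAlmostComplex Ω) (e : ∀ p, LocalExtension E E₂ pr (σ p) (q p) (U p))
    (hσ : ∀ p, σW p = pr (σ p)) (Φ : SymplecticTrivialization Ω (n + 1) (inclDisk σ))
    (Λ : SymplecticTrivialization ωW n σW) : Continuous (transitionMatrix J q Φ Λ) := by
  refine continuous_iff_continuousAt.2 fun p₀ => continuousAt_pi.2 fun i => continuousAt_pi.2 fun j => ?_
  have h1 := continuousAt_pi.1 (R.continuousAt_adaptedFrame J e hσ Φ Λ (p₀ := p₀)
    (Φ.continuous_frame_symm (Pi.single j 1)).continuousAt) i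
  refine h1.congr (Filter.Eventually.of_forall fun p => ?_)
  simp only [transitionMatrix, LinearMap.toMatrix'_apply]
  rfl

variable {h : V × ℝ → ℝ} {D : Set (ℝ × V)} {φ : ℝ → V → V} {g : W × ℝ → ℝ} {DW : Set (ℝ × W)}
  {ψ : ℝ → W → W} {T : ℝ}

/-- The coordinate `df` is invariant since `f` is a first integral; `Ω(N, ·)` is invariant since the
flow is symplectic and carries `N` to `N`, which uses the hypothesis on the gradient. The part
tangent to the level is moved, after projection, by the linearized reduced flow. -/
lemma IsReduction.adaptedFrame_tderiv [T2Space W] (R : IsReduction E₁ Ω f c ωW pr)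
    (J : CompatibleAlmostComplex Ω) (e : ∀ p, LocalExtension E E₂ pr (σ p) (q p) (U p))
    (hσ : ∀ p, σW p = pr (σ p)) (Λ : SymplecticTrivialization ωW n σW)
    (hh : ContMDiff (𝓘(ℝ, E).prod 𝓘(ℝ, ℝ)) 𝓘(ℝ, ℝ) ∞ h)
    (hφ : IsFlow (timeHamiltonianVectorField Ω h) D φ)
    (hf : IsFirstIntegral (timeHamiltonianVectorField Ω h) f)
    (hg : ContMDiff (𝓘(ℝ, E₂).prod 𝓘(ℝ, ℝ)) 𝓘(ℝ, ℝ) ∞ g)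
    (hgh : ∀ (z : LevelSet f c) (t : ℝ), g (pr z, t) = h ((z : V), t))
    (hψ : IsFlow (timeHamiltonianVectorField ωW g) DW ψ) (hgrad : PreservesGradientSpan J f c D φ)
    {t : ℝ} {p p' : Disk} (hD : (t, (σ p : V)) ∈ D) (ht : φ t (σ p) = σ p') (u : E) :
    adaptedFrame J σ q Λ p' (tderiv E E (φ t) (σ p : V) u)
      = CZ.blockSum (LinearMap.toMatrix' (linearizedMap ψ Λ p p' t)) 1
        *ᵥ adaptedFrame J σ q Λ p u := by
  have hN : tderiv E ℝ f (σ p : V) (normGrad J f (σ p : V)) = 1 :=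
    tderiv_normGrad J (R.level.regular (σ p))
  have h1 := hf.tderiv_flow hφ hD u
  have h2 := tderiv_flow_normGrad J hφ hf hgrad hD (σ p).2 (R.level.regular (σ p))
    (by rw [ht]; exact R.level.regular (σ p'))
  have h3 := hφ.bilin_tderiv hh hD (normGrad J f (σ p : V)) u
  have h4 := R.tderiv_flow_proj hh hφ hf hg hgh hψ hD (e p) (e p).mem (e p')
    (by rw [ht]; exact (e p').mem)
    (u := u - tderiv E ℝ f (σ p : V) u • normGrad J f (σ p : V))
    (by rw [map_sub, map_smul, hN, smul_eq_mul, mul_one, sub_self])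
  rw [map_sub (tderiv E E (φ t) (σ p : V)), map_smul (tderiv E E (φ t) (σ p : V)), h2] at h4
  rw [h2] at h3
  rw [ht] at h1 h3 h4
  rw [adaptedFrame, adaptedFrame, adaptedCoord_apply, adaptedCoord_apply, CZ.blockSum_mulVec,
    Matrix.one_mulVec, h1, h3, ← h4, LinearMap.toMatrix'_mulVec]
  simp only [linearizedMap, LinearMap.comp_apply, LinearEquiv.coe_coe, LinearEquiv.symm_apply_apply]
  rw [← hσ]
  rfl

/-- The index of a closed orbit in the level equals that of its projection. -/
theorem IsReduction.orbitIndex_eq [T2Space W] (R : IsReduction E₁ Ω f c ωW pr)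
    (J : CompatibleAlmostComplex Ω) (hσ : ∀ p, σW p = pr (σ p))
    (hh : ContMDiff (𝓘(ℝ, E).prod 𝓘(ℝ, ℝ)) 𝓘(ℝ, ℝ) ∞ h)
    (hφ : IsFlow (timeHamiltonianVectorField Ω h) D φ)
    (hf : IsFirstIntegral (timeHamiltonianVectorField Ω h) f)
    (hg : ContMDiff (𝓘(ℝ, E₂).prod 𝓘(ℝ, ℝ)) 𝓘(ℝ, ℝ) ∞ g)
    (hgh : ∀ (z : LevelSet f c) (t : ℝ), g (pr z, t) = h ((z : V), t))
    (hψ : IsFlow (timeHamiltonianVectorField ωW g) DW ψ) (hgrad : PreservesGradientSpan J f c D φ)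
    (hT : 0 < T) (hD : ∀ t ∈ Icc 0 T, (t, (σ (boundaryPoint 0) : V)) ∈ D)
    (ht : ∀ t ∈ Icc 0 T, φ t (σ (boundaryPoint 0)) = σ (boundaryPoint (t / T)))
    (Φ : SymplecticTrivialization Ω (n + 1) (inclDisk σ)) (Λ : SymplecticTrivialization ωW n σW) :
    orbitIndex φ T Φ = orbitIndex ψ T Λ := by
  choose q U e using fun p => R.exists_localExtension (σ p)
  have hDW : ∀ t ∈ Icc 0 T, (t, σW (boundaryPoint 0)) ∈ DW := fun t h0 => by
    rw [hσ]
    exact (R.flow_proj hh hφ hf hg hgh hψ (hD t h0)).1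
  have htW : ∀ t ∈ Icc 0 T, ψ t (σW (boundaryPoint 0)) = σW (boundaryPoint (t / T)) := fun t h0 => by
    rw [hσ, hσ, (R.flow_proj hh hφ hf hg hgh hψ (hD t h0)).2]
    exact congrArg pr (Subtype.ext ((hf.coe_levelOrbit hφ (hD t h0)).trans (ht t h0)))
  refine CZ.index_eq_of_conj_blockSum hT (hψ.continuousOn_linearizedPath Λ hDW htW)
    (fun t h0 => hψ.linearizedPath_mem hg Λ (hDW t h0) (htW t h0))
    (R.continuous_transitionMatrix J e hσ Φ Λ) (R.transitionMatrix_mem J e hσ Φ Λ) fun t h0 => ?_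
  rw [linearizedPath_eq Λ (htW t h0), linearizedPath_eq Φ (ht t h0)]
  refine Matrix.toLin'.injective (LinearMap.ext fun v => ?_)
  rw [Matrix.toLin'_apply, Matrix.toLin'_apply, ← Matrix.mulVec_mulVec, ← Matrix.mulVec_mulVec,
    transitionMatrix, transitionMatrix, LinearMap.toMatrix'_mulVec, LinearMap.toMatrix'_mulVec,
    LinearMap.toMatrix'_mulVec]
  simp only [linearizedMap, LinearMap.comp_apply, LinearEquiv.coe_coe, LinearEquiv.symm_apply_apply]
  exact R.adaptedFrame_tderiv J e hσ Λ hh hφ hf hg hgh hψ hgrad (hD t h0) (ht t h0) _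

end ReducedTrivialization

end

/-! ### Equality of the Conley-Zehnder indices upstairs and in the reduction. -/

theorem lemma3p1 (n : ℕ)
    -- the symplectic manifold `(V, Ω)` with a compatible almost complex structure
    {V : Type*} [TopologicalSpace V] [T2Space V]
    [ChartedSpace (EuclideanSpace ℝ (Fin (2 * (n + 1)))) V]
    [IsManifold 𝓘(ℝ, EuclideanSpace ℝ (Fin (2 * (n + 1)))) ∞ V]
    (Ω : SymplecticForm (EuclideanSpace ℝ (Fin (2 * (n + 1)))) V)
    (J : CompatibleAlmostComplex Ω)
    -- the Hamiltonian `h`, its flow `φ`, and the first integral `f`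
    (h : V × ℝ → ℝ)
    (hh : ContMDiff (𝓘(ℝ, EuclideanSpace ℝ (Fin (2 * (n + 1)))).prod 𝓘(ℝ, ℝ)) 𝓘(ℝ, ℝ) ∞ h)
    (D : Set (ℝ × V)) (φ : ℝ → V → V) (hφ : IsFlow (timeHamiltonianVectorField Ω h) D φ)
    (f : V → ℝ) (hf : IsFirstIntegral (timeHamiltonianVectorField Ω h) f)
    -- the regular level `Z` of `f`, with the free circle action generated by `X_f`
    (c : ℝ)
    [ChartedSpace (EuclideanSpace ℝ (Fin (2 * n + 1))) (LevelSet f c)]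
    [IsManifold 𝓘(ℝ, EuclideanSpace ℝ (Fin (2 * n + 1))) ∞ (LevelSet f c)]
    (hZ : IsRegularLevel (EuclideanSpace ℝ (Fin (2 * (n + 1))))
      (EuclideanSpace ℝ (Fin (2 * n + 1))) f c)
    (τ : ℝ) [AddAction (AddCircle τ) (LevelSet f c)]
    (hS : GeneratesFreeCircleAction Ω f c τ)
    -- the reduced symplectic manifold `W = Z/S¹`
    [T2Space (OrbitSpace τ (LevelSet f c))]
    [ChartedSpace (EuclideanSpace ℝ (Fin (2 * n))) (OrbitSpace τ (LevelSet f c))]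
    [IsManifold 𝓘(ℝ, EuclideanSpace ℝ (Fin (2 * n))) ∞ (OrbitSpace τ (LevelSet f c))]
    (ωW : SymplecticForm (EuclideanSpace ℝ (Fin (2 * n))) (OrbitSpace τ (LevelSet f c)))
    (hW : IsMarsdenWeinsteinQuotient (EuclideanSpace ℝ (Fin (2 * n + 1))) Ω f c τ ωW)
    -- the reduced Hamiltonian `g` and its flow `ψ`
    (g : OrbitSpace τ (LevelSet f c) × ℝ → ℝ)
    (hg : IsReducedHamiltonian (E₂ := EuclideanSpace ℝ (Fin (2 * n))) h f c τ g)
    (DW : Set (ℝ × OrbitSpace τ (LevelSet f c)))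
    (ψ : ℝ → OrbitSpace τ (LevelSet f c) → OrbitSpace τ (LevelSet f c))
    (hψ : IsFlow (timeHamiltonianVectorField ωW g) DW ψ)
    -- the assumption on the linearized flow
    (hgrad : PreservesGradientSpan J f c D φ)
    -- a closed orbit in `Z` with a capping disk in `Z`
    (T : ℝ) (γ : ℝ → LevelSet f c) (hγ : IsClosedOrbit D φ T (fun t => (γ t : V)))
    (σ : C(Disk, LevelSet f c)) (hσ : IsCappingDisk T γ σ) :
    IsClosedOrbit DW ψ T (fun t => orbitProj τ (LevelSet f c) (γ t)) ∧
    IsCappingDisk T (fun t => orbitProj τ (LevelSet f c) (γ t)) (projDisk τ σ) ∧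
    ∀ (Φ : SymplecticTrivialization Ω (n + 1) (inclDisk σ))
      (Λ : SymplecticTrivialization ωW n (projDisk τ σ)),
      orbitIndex φ T Φ = orbitIndex ψ T Λ := by
  have R : IsReduction (EuclideanSpace ℝ (Fin (2 * n + 1))) Ω f c ωW
      (orbitProj τ (LevelSet f c)) :=
    { level := hZ
      smooth_fun := hf.smooth
      finrank := by
        rw [finrank_euclideanSpace_fin, finrank_euclideanSpace_fin]
        ring
      smooth := hW.smooth
      submersion := hW.submersion
      pullback := hW.pullback }
  have hcoe : ∀ t ∈ Icc 0 T, levelOrbit φ (γ 0) t = γ t := fun t ht =>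
    Subtype.ext ((hf.coe_levelOrbit hφ (hγ.mem t ht)).trans (hγ.orbit t ht))
  have hproj := fun t ht => R.flow_proj hh hφ hf hg.smooth hg.comp_proj hψ (hγ.mem t ht)
  have h0 : σ (boundaryPoint 0) = γ 0 := by
    have := hσ 0 (left_mem_Icc.2 hγ.pos.le)
    rwa [zero_div] at this
  refine ⟨⟨hγ.pos, ?_, fun t ht => (hproj t ht).1, fun t ht => ?_⟩, fun t ht => ?_,
    fun Φ Λ => ?_⟩
  · exact congrArg (orbitProj τ (LevelSet f c)) (Subtype.ext hγ.closed)
  · rw [(hproj t ht).2, hcoe t ht]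
  · exact congrArg (orbitProj τ (LevelSet f c)) (hσ t ht)
  · refine R.orbitIndex_eq J (fun _ => rfl) hh hφ hf hg.smooth hg.comp_proj hψ hgrad hγ.pos ?_ ?_ Φ Λ
    · rw [h0]
      exact hγ.mem
    · intro t ht
      rw [h0, hσ t ht]
      exact hγ.orbit t ht
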